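/- **Theorem (finite-time regret of SRTS).** *Setting.* There are $K\ge 2$ arms. In each round $t=1,2,\dots$ arm $i$ yields a reward $X_{i,t}\sim\mathcal N(\mu_i,\sigma_i^2)$, $\sigma_i^2>0$, all rewards being independent; the player sees only the reward of the arm $\pi(t)$ that is played. Fix $L_0>0$, $\rho\ge 0$ and let $\xi_i=\mu_i/(L_0+\rho\sigma_i^2)$. Assume that arm $1$ is the unique maximiser of $\xi_i$, that $\xi_1>0$, and that $\sigma_1^2\le 1$. The expected regret of a policy $\pi$ over $n$ rounds is $$\mathbb E[\mathcal R_n(\pi)]=n\Big(\xi_1-\mathbb E\Big[\frac{\bar\mu_n}{L_0+\rho\bar\sigma_n^2}\Big]\Big),\qquad \bar\mu_n=\frac1n\sum_{t\le n}X_{\pi(t),t},\quad \bar\sigma^2_n=\frac1n\sum_{t\le n}(X_{\pi(t),t}-\bar\mu_n)^2 .$$ *Algorithm.* SRTS keeps for each arm a quadruple $(\hat\mu_i,s_i,\alpha_i,\beta_i)$, initially $(0,0,\frac12,\frac12)$, which a reward $x$ of arm $i$ replaces by $$\Big(\frac{s_i\hat\mu_i+x}{s_i+1},\ s_i+1,\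 \alpha_i+\tfrac12,\ \beta_i+\frac{s_i}{s_i+1}\frac{(x-\hat\mu_i)^2}{2}\Big).$$ It plays each arm once in rounds $1,\dots,K$. In every later round $t$ it draws, independently, for each arm $\tau_{i,t}\sim\mathrm{Gamma}(\alpha_i,\beta_i)$ (shape, rate) and $\theta_{i,t}\sim\mathcal N(\hat\mu_i,1/s_i)$, and plays an arm that maximises $\theta_{i,t}/(L_0+\rho/\tau_{i,t})$. *Claim.* Let $\Delta_i=\xi_1-\xi_i$, $\Gamma_i=\mu_1-\mu_i$, $\Lambda_{\max}=\max_{i,j}|\mu_i-\mu_j|$, $h(x)=(x-1-\log x)/2$, and let $\varepsilon_{\mu,i}=c_i(\log n)^{-1/4}$, $\varepsilon_{\sigma,i}=c_i'(\log n)^{-1/4}$ with arbitrary constants $c_i,c_i'>0$. There are constants $A_7,\dots,A_{11}$, which do not depend on $n$ or on the pull counts, such that for all $n\ge 2$ $$\mathbb E[\mathcal R_n(\mathrm{SRTS})]\le\sum_{i=1}^K\Big[1+\max\Big\{\frac{2\log(2n)}{(\Gamma_i-\varepsilon_{\mu,i}L_0)^2},\frac{\log(2n)}{h\big(\sigma_i^2(1-\varepsilon_{\sigma,i}/\xi_1)/\sigma_1^2\big)}\Big\}+A_8(\log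 n)^{3/4}+A_9(\log n)^{1/2}+A_{10}(\log n)^{1/4}+A_{11}\Big]\,w_i+A_7,$$ $$w_i=\Delta_i+\frac{\xi_i\,\rho\big(\frac{\Lambda_{\max}^2}{2}+\sum_{j=1}^K\sigma_j^2-\sigma_i^2\big)}{L_0+\frac{\rho}{2}\Lambda_{\max}^2+\rho\sum_{j=1}^K\sigma_j^2}.$$ (For the finitely many $n$ at which a denominator vanishes or $\varepsilon_{\sigma,i}\ge\xi_1$, the undefined expressions may be given any finite value.) Moreover the regret is logarithmic: there is a constant $C$, independent of $n$, with $\mathbb E[\mathcal R_n(\mathrm{SRTS})]\le C\log n$ for all $n\ge 2$. -/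

import Mathlib

open MeasureTheory ProbabilityTheory
open scoped NNReal

namespace SharpeBandit

noncomputable section

/-- The regularised Sharpe ratio of a law with mean `m` and variance `s2`. -/
def sharpe (L₀ ρ m s2 : ℝ) : ℝ := m / (L₀ + ρ * s2)

/-! ### Regret -/

/-- Empirical mean of the rewards `y 0, …, y (n - 1)`. -/
def empMean (y : ℕ → ℝ) (n : ℕ) : ℝ := (∑ t ∈ Finset.range n, y t) / n

/-- (Biased) empirical variance of the rewards `y 0, …, y (n - 1)`. -/
def empVar (y : ℕ → ℝ) (n : ℕ) : ℝ :=
  (∑ t ∈ Finset.range n, (y t - empMean y n) ^ 2) / n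

/-- Empirical Sharpe ratio of the rewards `y 0, …, y (n - 1)`. -/
def empSharpe (L₀ ρ : ℝ) (y : ℕ → ℝ) (n : ℕ) : ℝ :=
  sharpe L₀ ρ (empMean y n) (empVar y n)

/-- Empirical Sharpe ratio collected in the first `n` rounds by a player who receives the reward
`X (A t ω) t ω` in round `t`. -/
def algSharpe {Ω : Type*} {K : ℕ} (L₀ ρ : ℝ) (X : Fin K → ℕ → Ω → ℝ) (A : ℕ → Ω → Fin K)
    (n : ℕ) (ω : Ω) : ℝ :=
  empSharpe L₀ ρ (fun t => X (A t ω) t ω) n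

/-- Expected regret over `n` rounds, `ξ` being the Sharpe ratio of the best arm. -/
def expectedRegret {Ω : Type*} [MeasurableSpace Ω] (P : Measure Ω) {K : ℕ} (L₀ ρ ξ : ℝ)
    (X : Fin K → ℕ → Ω → ℝ) (A : ℕ → Ω → Fin K) (n : ℕ) : ℝ :=
  n * (ξ - ∫ ω, algSharpe L₀ ρ X A n ω ∂P)

/-! ### The algorithm -/

/-- Parameters kept for one arm: posterior mean, number of pulls, and shape and rate of the Gamma
posterior of the precision. -/
structure PostParams where
  mean : ℝ
  pulls : ℕ
  shape : ℝ
  rate : ℝ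

/-- The parameters before any pull. -/
def PostParams.init : PostParams := ⟨0, 0, 1 / 2, 1 / 2⟩

/-- Conjugate Normal–Gamma update with a new reward `x`. -/
def PostParams.update (p : PostParams) (x : ℝ) : PostParams where
  mean := (p.pulls * p.mean + x) / (p.pulls + 1)
  pulls := p.pulls + 1
  shape := p.shape + 1 / 2
  rate := p.rate + p.pulls / (p.pulls + 1) * (x - p.mean) ^ 2 / 2

/-- Parameters of arm `i` at the beginning of round `t` (rounds are numbered from `0`), when arm
`a s` was played and reward `y s` was received in each round `s < t`. -/
def postParams {K : ℕ} (a : ℕ → Fin K) (y : ℕ → ℝ) (i : Fin K) : ℕ → PostParams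
  | 0 => PostParams.init
  | t + 1 => if a t = i then (postParams a y i t).update (y t) else postParams a y i t

/-- The law from which the pair `(τ, θ)` of an arm with parameters `p` is sampled:
`τ ∼ Gamma(shape, rate)` and, independently, `θ ∼ 𝓝(mean, 1 / pulls)`. -/
def PostParams.sampleLaw (p : PostParams) : Measure (ℝ × ℝ) :=
  (gammaMeasure p.shape p.rate).prod (gaussianReal p.mean (p.pulls : ℝ≥0)⁻¹)

section Run

variable {Ω : Type*} {K : ℕ}

/-- The pairs `(τ, θ)` of all arms in round `t`. -/
def samples (τ θ : Fin K → ℕ → Ω → ℝ) (t : ℕ) (ω : Ω) : Fin K → ℝ × ℝ :=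
  fun i => (τ i t ω, θ i t ω)

/-- The rewards of all arms in round `t`. -/
def rewards (X : Fin K → ℕ → Ω → ℝ) (t : ℕ) (ω : Ω) : Fin K → ℝ := fun i => X i t ω

/-- The `σ`-algebra of the decision in round `t`: posterior samples and arm played. -/
abbrev decisionSigma (τ θ : Fin K → ℕ → Ω → ℝ) (A : ℕ → Ω → Fin K) (t : ℕ) : MeasurableSpace Ω :=
  MeasurableSpace.comap (samples τ θ t) inferInstance ⊔ MeasurableSpace.comap (A t) inferInstance

/-- The `σ`-algebra of all rewards, posterior samples and arms played before round `t`. -/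
abbrev pastSigma (X τ θ : Fin K → ℕ → Ω → ℝ) (A : ℕ → Ω → Fin K) (t : ℕ) : MeasurableSpace Ω :=
  ⨆ s ∈ Finset.range t,
    MeasurableSpace.comap (rewards X s) inferInstance ⊔ decisionSigma τ θ A s

/-- `X i t` is the reward that arm `i` yields in round `t`, `(τ i t, θ i t)` are the posterior
samples of arm `i` in round `t`, and `A t` is the arm played in round `t`, when Sharpe ratio
Thompson sampling is run on `K` Gaussian arms with means `μ i` and variances `v i`. -/
structure IsSRTS [MeasurableSpace Ω] (P : Measure Ω) (μ : Fin K → ℝ) (v : Fin K → ℝ≥0)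
    (L₀ ρ : ℝ) (X τ θ : Fin K → ℕ → Ω → ℝ) (A : ℕ → Ω → Fin K) : Prop where
  measurable_reward : ∀ i t, Measurable (X i t)
  measurable_precision : ∀ i t, Measurable (τ i t)
  measurable_mean : ∀ i t, Measurable (θ i t)
  measurable_arm : ∀ t, Measurable (A t)
  /-- The rewards of a round are independent Gaussian variables ... -/
  reward_law : ∀ t, P.map (rewards X t) = Measure.pi (fun i => gaussianReal (μ i) (v i))
  /-- ... and independent of the past and of the decision taken in that round. -/
  reward_indep : ∀ t, Indep (MeasurableSpace.comap (rewards X t) inferInstance)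
    (pastSigma X τ θ A t ⊔ decisionSigma τ θ A t) P
  /-- Every arm is played once in the first `K` rounds. -/
  initial_rounds : ∀ (t : ℕ) (ht : t < K) (ω : Ω), A t ω = ⟨t, ht⟩
  /-- Afterwards, given the past, the samples of the arms are drawn independently, those of arm `i`
  from its current sampling law. -/
  sample_law : ∀ t, K ≤ t → ∀ B : Set (Fin K → ℝ × ℝ), MeasurableSet B →
    P⟦samples τ θ t ⁻¹' B | pastSigma X τ θ A t⟧ =ᵐ[P] fun ω =>
      (Measure.pi fun i =>
        (postParams (fun s => A s ω) (fun s => X (A s ω) s ω) i t).sampleLaw).real B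
  /-- The arm played maximises the sampled Sharpe ratio. -/
  arm_argmax : ∀ t, K ≤ t → ∀ (ω : Ω) (j : Fin K),
    θ j t ω / (L₀ + ρ / τ j t ω) ≤ θ (A t ω) t ω / (L₀ + ρ / τ (A t ω) t ω)

end Run

/-! ### The quantities in the bound -/

/-- `h(x) = (x - 1 - log x) / 2`. -/
def rateFun (x : ℝ) : ℝ := (x - 1 - Real.log x) / 2

/-- `Λ_max`, the largest gap between the means of two arms. -/
def maxMeanGap {K : ℕ} (μ : Fin K → ℝ) : ℝ := ⨆ p : Fin K × Fin K, |μ p.1 - μ p.2|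

/-- The weight of a pull of arm `i` in the regret decomposition; `b` is the best arm. -/
def pullWeight {K : ℕ} (μ : Fin K → ℝ) (v : Fin K → ℝ≥0) (L₀ ρ : ℝ) (b i : Fin K) : ℝ :=
  (sharpe L₀ ρ (μ b) (v b) - sharpe L₀ ρ (μ i) (v i)) +
    sharpe L₀ ρ (μ i) (v i) * ρ * (maxMeanGap μ ^ 2 / 2 + ∑ j, (v j : ℝ) - v i) /
      (L₀ + ρ / 2 * maxMeanGap μ ^ 2 + ρ * ∑ j, (v j : ℝ))

/-- The leading term of the bound on the pulls of arm `i`; `b` is the best arm. -/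
def leadingPulls {K : ℕ} (μ : Fin K → ℝ) (v : Fin K → ℝ≥0) (L₀ ρ : ℝ) (b i : Fin K)
    (εμ εσ : ℝ) (n : ℕ) : ℝ :=
  max (2 * Real.log (2 * n) / ((μ b - μ i) - εμ * L₀) ^ 2)
    (Real.log (2 * n) /
      rateFun ((v i : ℝ) * (1 - εσ / sharpe L₀ ρ (μ b) (v b)) / (v b : ℝ)))

end

end SharpeBandit

namespace SharpeBandit

noncomputable section

open scoped ENNReal
open Set Real

universe w

/-! ### Exponential moments and tails of the Gamma law -/

/-! Two facts carry the theorem: the regret is `O(log n)`, and for `ρ = 0` the pulls of a suboptimal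
arm are at most `2 log n / Γ_i²` up to `O((log n)^(3/4))`.

They suffice because of the shape of the bound. The best arm has `Γ = 0`, so its leading term is at
least of order `(log n)^(3/2)`. If `ρ > 0` its weight is positive, and this single summand absorbs
any `C log n` up to an additive constant (`exists_expectedRegret_le_of_rho_pos`). If `ρ = 0` the
weight of the best arm vanishes, the other weights are the gaps `Δ_i`, and the regret is exactly the
sum of gaps times expected pulls. The constant `2 / Γ_i²` is then needed, and it comes from levels
at distance `ε = (log n)^(-1/4)` from the true means (`exists_expectedPulls_le_leadingPulls`).

From regret to pulls (`exists_expectedRegret_le`): the empirical Sharpe ratio is expanded to second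
order around the best arm. The first order terms are sums of functions of the rewards that are
centred for the best arm, so their means are controlled by the suboptimal pulls. The second order
terms are squares of such sums divided by `n`. Their martingale parts contribute `O(1)`, and their
drifts again contribute at most a multiple of the suboptimal pulls.

From pulls to tails (`IsSRTS.sum_prob_arm_le`): fix a level `y`, in the logarithmic bound one
strictly between the two Sharpe ratios. If arm `i` is played, either its own sample exceeds `y` or
no sample does. The first event is rare once `i` has been pulled often and its statistics are
typical. For the second, compare with the event that only the best arm `b` exceeds `y`, which forces
`b` to be played. Given the past, the two probabilities differ by the factor `1 / p - 1`, where `p`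
is the probability that the sample of `b` exceeds `y`. Organising the rounds by the number of pulls
of `b` leaves a sum over `k` of expectations of `1 / p - 1` under the law of the statistics of `k +
1` independent rewards (`IsSRTS.sum_playMean_le`).

This sum must be bounded uniformly in `n`. The probability `p` is at least a Gamma tail times a
Gaussian tail, evaluated at independent statistics, so the two factors can be treated separately.
The Gaussian factor uses that the reward variance is at most the variance `1` assumed by the
sampler. The Gamma factor uses an integral representation of the inverse tail that turns its
expectation into a moment generating function of a sum of squares. -/

theorem lintegral_exp_mul_gammaMeasure {α β l : ℝ} (hα : 0 < α) (hβ : 0 < β) (hl : l < β) :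
    ∫⁻ x, ENNReal.ofReal (exp (l * x)) ∂gammaMeasure α β
      = ENNReal.ofReal ((β / (β - l)) ^ α) := by
  have hβl : 0 < β - l := by linarith
  rw [gammaMeasure, lintegral_withDensity_eq_lintegral_mul _
    (show Measurable (gammaPDF α β) from (measurable_gammaPDFReal α β).ennreal_ofReal)
    (by fun_prop)]
  have key : ∀ x, (gammaPDF α β * fun x => ENNReal.ofReal (exp (l * x))) x
      = ENNReal.ofReal ((β / (β - l)) ^ α) * gammaPDF α (β - l) x := by
    intro x
    simp only [Pi.mul_apply, gammaPDF]
    rw [← ENNReal.ofReal_mul (gammaPDFReal_nonneg hα hβ x), ← ENNReal.ofReal_mul (by positivity)]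
    congr 1
    unfold gammaPDFReal
    split_ifs with hx
    · rw [div_rpow hβ.le hβl.le]
      have : exp (-(β * x)) * exp (l * x) = exp (-((β - l) * x)) := by
        rw [← exp_add]; congr 1; ring
      have h2 := (rpow_pos_of_pos hβl α).ne'
      rw [← this]
      field_simp
    · simp
  calc _ = ∫⁻ x, ENNReal.ofReal ((β / (β - l)) ^ α) * gammaPDF α (β - l) x :=
        lintegral_congr key
    _ = _ := by
      rw [lintegral_const_mul' _ _ ENNReal.ofReal_ne_top, lintegral_gammaPDF_eq_one hα hβl, mul_one]

/-- Exponential Markov inequality. The sign condition on `l * (x - u)` lets one statement serve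
upper tails (`l ≥ 0`) and lower tails (`l ≤ 0`). -/
theorem measure_le_lintegral_exp {ν : Measure ℝ} {S : Set ℝ} (hS : MeasurableSet S) (l u : ℝ)
    (h : ∀ x ∈ S, 0 ≤ l * (x - u)) :
    ν S ≤ ENNReal.ofReal (exp (-(l * u))) * ∫⁻ x, ENNReal.ofReal (exp (l * x)) ∂ν := by
  rw [← lintegral_const_mul' _ _ ENNReal.ofReal_ne_top, ← lintegral_indicator_one hS]
  refine lintegral_mono fun x => ?_
  by_cases hx : x ∈ S
  · rw [indicator_of_mem hx, Pi.one_apply, ← ENNReal.ofReal_mul (by positivity), ← exp_add,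
      ENNReal.one_le_ofReal, one_le_exp_iff]
    linarith [h x hx]
  · simp [hx]

theorem rateFun_pos {x : ℝ} (hx : 0 < x) (hx1 : x ≠ 1) : 0 < rateFun x := by
  have := log_lt_sub_one_of_pos hx hx1
  unfold rateFun; linarith

theorem rpow_mul_exp_eq_exp_rateFun {α κ : ℝ} (hκ : 0 < κ) :
    κ ^ α * exp (α * (1 - κ)) = exp (-(2 * α * rateFun κ)) := by
  rw [rpow_def_of_pos hκ, ← exp_add]; congr 1; unfold rateFun; ring

/-- Chernoff bound with the tilt `β (1 - 1 / κ)`, for which the moment generating function equals `κ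
^ α`; this tilt is optimal at the threshold `β u = κ α`. The sign of `1 - 1 / κ` decides which tail
is meant. -/
theorem gammaMeasure_tail {α β κ u : ℝ} {S : Set ℝ} (hS : MeasurableSet S) (hα : 0 < α)
    (hβ : 0 < β) (hκ : 0 < κ) (hSu : ∀ x ∈ S, 0 ≤ (1 - 1 / κ) * (x - u))
    (hu : 0 ≤ (1 - 1 / κ) * (β * u - κ * α)) :
    gammaMeasure α β S ≤ ENNReal.ofReal (exp (-(2 * α * rateFun κ))) := by
  have hl : β * (1 - 1 / κ) < β := by
    have : 0 < β * (1 / κ) := by positivity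
    linarith
  refine (measure_le_lintegral_exp hS (β * (1 - 1 / κ)) u fun x hx => ?_).trans ?_
  · rw [mul_assoc]; exact mul_nonneg hβ.le (hSu x hx)
  rw [lintegral_exp_mul_gammaMeasure hα hβ hl, ← ENNReal.ofReal_mul (by positivity),
    ← rpow_mul_exp_eq_exp_rateFun hκ]
  have : β / (β - β * (1 - 1 / κ)) = κ := by field_simp; ring
  rw [this, mul_comm]
  refine ENNReal.ofReal_le_ofReal (mul_le_mul_of_nonneg_left (exp_le_exp.2 ?_) (by positivity))
  have h2 : (1 - 1 / κ) * (κ * α) = α * (κ - 1) := by field_simp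
  nlinarith

theorem gammaMeasure_Ici_le {α β κ u : ℝ} (hα : 0 < α) (hβ : 0 < β) (hκ : 1 ≤ κ)
    (hu : κ * α ≤ β * u) :
    gammaMeasure α β (Ici u) ≤ ENNReal.ofReal (exp (-(2 * α * rateFun κ))) := by
  have hκ0 : 0 < κ := by linarith
  have h1 : 0 ≤ 1 - 1 / κ := by rw [sub_nonneg, div_le_one hκ0]; exact hκ
  exact gammaMeasure_tail measurableSet_Ici hα hβ hκ0
    (fun x hx => mul_nonneg h1 (sub_nonneg.2 hx)) (mul_nonneg h1 (sub_nonneg.2 hu))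

theorem gammaMeasure_Iio_le {α β κ u : ℝ} (hα : 0 < α) (hβ : 0 < β) (hκ0 : 0 < κ) (hκ : κ ≤ 1)
    (hu : β * u ≤ κ * α) :
    gammaMeasure α β (Iio u) ≤ ENNReal.ofReal (exp (-(2 * α * rateFun κ))) := by
  have h1 : 1 - 1 / κ ≤ 0 := by rw [sub_nonpos, le_div_iff₀ hκ0]; linarith
  exact gammaMeasure_tail measurableSet_Iio hα hβ hκ0
    (fun x hx => mul_nonneg_of_nonpos_of_nonpos h1 (sub_nonpos.2 (le_of_lt hx)))
    (mul_nonneg_of_nonpos_of_nonpos h1 (sub_nonpos.2 hu))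

/-- For `α ≥ 1` the power `x ^ (α - 1)` in the density is at least `u ^ (α - 1)` beyond `u`, and
what remains is an exponential integral. -/
theorem le_gammaMeasure_Ici {α β u : ℝ} (hα : 1 ≤ α) (hβ : 0 < β) (hu : 0 < u) :
    ENNReal.ofReal ((β * u) ^ (α - 1) * exp (-(β * u)) / Real.Gamma α)
      ≤ gammaMeasure α β (Ici u) := by
  have hα0 : 0 < α := by linarith
  have hG := Real.Gamma_pos_of_pos hα0
  have h1 : ∫⁻ x in Ioi u, ENNReal.ofReal (exp (-β * x)) = ENNReal.ofReal (exp (-β * u) / β) := by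
    rw [← ofReal_integral_eq_lintegral_ofReal (integrableOn_exp_mul_Ioi (by linarith) u)
      (Filter.Eventually.of_forall fun x => (exp_pos _).le),
      integral_exp_mul_Ioi (by linarith) u]
    congr 1; field_simp
  calc ENNReal.ofReal ((β * u) ^ (α - 1) * exp (-(β * u)) / Real.Gamma α)
      = ENNReal.ofReal (β ^ α / Real.Gamma α * u ^ (α - 1)) * ENNReal.ofReal (exp (-β * u) / β) := by
        rw [← ENNReal.ofReal_mul (by positivity), mul_rpow hβ.le hu.le, rpow_sub_one hβ.ne']
        congr 1
        field_simp
    _ = ∫⁻ x in Ioi u, ENNReal.ofReal (β ^ α / Real.Gamma α * u ^ (α - 1)) *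
          ENNReal.ofReal (exp (-β * x)) := by
        rw [lintegral_const_mul' _ _ ENNReal.ofReal_ne_top, h1]
    _ ≤ ∫⁻ x in Ioi u, gammaPDF α β x := by
        refine setLIntegral_mono' measurableSet_Ioi fun x hx => ?_
        have hx : u < x := hx
        rw [gammaPDF_of_nonneg (by linarith), ← ENNReal.ofReal_mul (by positivity), neg_mul]
        refine ENNReal.ofReal_le_ofReal (mul_le_mul_of_nonneg_right
          (mul_le_mul_of_nonneg_left ?_ (by positivity)) (exp_pos _).le)
        exact rpow_le_rpow hu.le hx.le (by linarith)
    _ = gammaMeasure α β (Ioi u) := by rw [gammaMeasure, withDensity_apply _ measurableSet_Ioi]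
    _ ≤ gammaMeasure α β (Ici u) := measure_mono Ioi_subset_Ici_self

theorem gammaMeasure_Ici_pos {α β u : ℝ} (hα : 1 ≤ α) (hβ : 0 < β) (hu : 0 < u) :
    0 < gammaMeasure α β (Ici u) := by
  have hG := Real.Gamma_pos_of_pos (show 0 < α by linarith)
  refine lt_of_lt_of_le ?_ (le_gammaMeasure_Ici hα hβ hu)
  rw [ENNReal.ofReal_pos]; positivity

/-! ### Sums of squares of centred Gaussian variables -/

/-- The law of the sum of the squares of `k` independent variables with law `𝓝(0, v)`. -/
def sumSqLaw (v : ℝ≥0) : ℕ → Measure ℝ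
  | 0 => Measure.dirac 0
  | k + 1 => ((sumSqLaw v k).prod (gaussianReal 0 v)).map fun p => p.1 + p.2 ^ 2

instance isProbabilityMeasure_sumSqLaw (v : ℝ≥0) (k : ℕ) : IsProbabilityMeasure (sumSqLaw v k) := by
  induction k with
  | zero => unfold sumSqLaw; infer_instance
  | succ k ih =>
    unfold sumSqLaw
    exact Measure.isProbabilityMeasure_map (by fun_prop)

theorem lintegral_sumSqLaw_succ (v : ℝ≥0) (k : ℕ) {f : ℝ → ℝ≥0∞} (hf : Measurable f) :
    ∫⁻ S, f S ∂sumSqLaw v (k + 1) = ∫⁻ S, ∫⁻ z, f (S + z ^ 2) ∂gaussianReal 0 v ∂sumSqLaw v k := by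
  rw [sumSqLaw, lintegral_map hf (by fun_prop), lintegral_prod _ (by fun_prop)]

theorem ae_sumSqLaw_nonneg (v : ℝ≥0) (k : ℕ) : ∀ᵐ S ∂sumSqLaw v k, 0 ≤ S := by
  induction k with
  | zero => unfold sumSqLaw; rw [ae_dirac_iff measurableSet_Ici]
  | succ k ih =>
    unfold sumSqLaw
    rw [ae_map_iff (by fun_prop) measurableSet_Ici]
    have := (Measure.quasiMeasurePreserving_fst (μ := sumSqLaw v k)
      (ν := gaussianReal 0 v)).ae ih
    filter_upwards [this] with p hp
    exact add_nonneg hp (sq_nonneg _)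

/-- The factor `exp (l z²)` turns the density into a multiple of another centred Gaussian density,
of variance `v / (1 - 2 l v)`. -/
theorem lintegral_exp_mul_sq_gaussianReal {v : ℝ≥0} (hv : 0 < v) {l : ℝ} (hl : 2 * l * v < 1) :
    ∫⁻ z, ENNReal.ofReal (exp (l * z ^ 2)) ∂gaussianReal 0 v
      = ENNReal.ofReal ((1 - 2 * l * v) ^ (-(1 / 2) : ℝ)) := by
  have hv' : (0 : ℝ) < v := hv
  have hA : 0 < 1 - 2 * l * v := by linarith
  set w : ℝ≥0 := ⟨v / (1 - 2 * l * v), by positivity⟩ with hw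
  have hwv : (w : ℝ) = v / (1 - 2 * l * v) := rfl
  have hw0 : w ≠ 0 := by
    intro h
    have : (w : ℝ) = 0 := by rw [h]; rfl
    rw [hwv] at this
    exact (div_pos hv' hA).ne' this
  rw [gaussianReal_of_var_ne_zero _ hv.ne', lintegral_withDensity_eq_lintegral_mul _
    (measurable_gaussianPDF 0 v) (by fun_prop)]
  have key : ∀ x, (gaussianPDF 0 v * fun z => ENNReal.ofReal (exp (l * z ^ 2))) x
      = ENNReal.ofReal ((1 - 2 * l * v) ^ (-(1 / 2) : ℝ)) * gaussianPDF 0 w x := by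
    intro x
    simp only [Pi.mul_apply, gaussianPDF]
    rw [← ENNReal.ofReal_mul (gaussianPDFReal_nonneg _ _ _), ← ENNReal.ofReal_mul (by positivity)]
    congr 1
    unfold gaussianPDFReal
    rw [hwv, rpow_neg hA.le, ← sqrt_eq_rpow]
    have e1 : √(2 * π * (v / (1 - 2 * l * v))) = √(2 * π * v) / √(1 - 2 * l * v) := by
      rw [← sqrt_div (by positivity)]; congr 1; ring
    have e2 : exp (-(x - 0) ^ 2 / (2 * v)) * exp (l * x ^ 2)
        = exp (-(x - 0) ^ 2 / (2 * (v / (1 - 2 * l * v)))) := by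
      rw [← exp_add]; congr 1; field_simp; ring
    rw [e1, mul_assoc, e2]
    have := (sqrt_pos.2 hA).ne'
    generalize √(1 - 2 * l * v) = q at *
    field_simp
  calc _ = ∫⁻ x, ENNReal.ofReal ((1 - 2 * l * v) ^ (-(1 / 2) : ℝ)) * gaussianPDF 0 w x :=
        lintegral_congr key
    _ = _ := by
      rw [lintegral_const_mul' _ _ ENNReal.ofReal_ne_top, lintegral_gaussianPDF_eq_one 0 hw0,
        mul_one]

theorem lintegral_exp_mul_sumSqLaw {v : ℝ≥0} (hv : 0 < v) {l : ℝ} (hl : 2 * l * v < 1) (k : ℕ) :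
    ∫⁻ S, ENNReal.ofReal (exp (l * S)) ∂sumSqLaw v k
      = ENNReal.ofReal ((1 - 2 * l * v) ^ (-(k / 2) : ℝ)) := by
  have hA : 0 < 1 - 2 * l * v := by linarith
  induction k with
  | zero => unfold sumSqLaw; simp
  | succ k ih =>
    rw [lintegral_sumSqLaw_succ v k (by fun_prop)]
    have : ∀ S : ℝ, ∫⁻ z, ENNReal.ofReal (exp (l * (S + z ^ 2))) ∂gaussianReal 0 v
        = ENNReal.ofReal (exp (l * S)) * ENNReal.ofReal ((1 - 2 * l * v) ^ (-(1 / 2) : ℝ)) := by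
      intro S
      rw [← lintegral_exp_mul_sq_gaussianReal hv hl, ← lintegral_const_mul' _ _ ENNReal.ofReal_ne_top]
      refine lintegral_congr fun z => ?_
      rw [← ENNReal.ofReal_mul (exp_pos _).le, ← exp_add, mul_add]
    simp_rw [this]
    rw [lintegral_mul_const' _ _ ENNReal.ofReal_ne_top, ih, ← ENNReal.ofReal_mul (by positivity),
      ← rpow_add hA]
    congr 2
    push_cast; ring

/-! ### Inverse moments of the Gamma tail -/

theorem inv_sub_one_le_ofReal {p : ℝ≥0∞} {δ : ℝ} (hδ : δ < 1) (hp : 1 ≤ p + ENNReal.ofReal δ) :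
    p⁻¹ - 1 ≤ ENNReal.ofReal (δ / (1 - δ)) := by
  rcases lt_or_ge δ 0 with h0 | h0
  · rw [ENNReal.ofReal_of_nonpos h0.le, add_zero] at hp
    rw [tsub_eq_zero_of_le (ENNReal.inv_le_one.2 hp)]
    exact zero_le
  have h1 : 0 < 1 - δ := by linarith
  have hle : ENNReal.ofReal (1 - δ) ≤ p := by
    rw [ENNReal.ofReal_sub _ h0, ENNReal.ofReal_one]
    exact tsub_le_iff_right.2 hp
  rw [tsub_le_iff_right]
  calc p⁻¹ ≤ (ENNReal.ofReal (1 - δ))⁻¹ := ENNReal.inv_le_inv.2 hle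
    _ = ENNReal.ofReal (δ / (1 - δ)) + 1 := by
      rw [← ENNReal.ofReal_inv_of_pos h1, ← ENNReal.ofReal_one, ← ENNReal.ofReal_add
        (by positivity) zero_le_one]
      congr 1; field_simp; ring

/-- With `x = β u`, the inverse of the lower bound of `le_gammaMeasure_Ici` is `Γ(α) x^(-(α-1))
e^x`. Writing `Γ(α) = (α - 1) Γ(α - 1)` and expressing `Γ(α - 1) x^(-(α-1))` as an Euler integral
makes the bound a mixture of exponentials in `β`. The random rate can then be averaged through its
moment generating function. -/
theorem inv_gammaMeasure_Ici_le {α β u : ℝ} (hα : 1 < α) (hβ : 0 < β) (hu : 0 < u) :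
    (gammaMeasure α β (Ici u))⁻¹ ≤ ENNReal.ofReal (α - 1) *
      ∫⁻ y in Ioi 0, ENNReal.ofReal (y ^ (α - 2) * exp ((1 - y) * (β * u))) := by
  have hx : 0 < β * u := by positivity
  have hG := Real.Gamma_pos_of_pos (show 0 < α by linarith)
  have hα1 : 0 < α - 1 := by linarith
  have h1 := Real.integral_rpow_mul_exp_neg_mul_Ioi hα1 hx
  have h3 : ∫⁻ y in Ioi 0, ENNReal.ofReal (y ^ (α - 1 - 1) * exp (-(β * u * y)))
      = ENNReal.ofReal ((1 / (β * u)) ^ (α - 1) * Real.Gamma (α - 1)) := by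
    rw [← h1, ofReal_integral_eq_lintegral_ofReal]
    · by_contra hni
      rw [integral_undef hni] at h1
      have := Real.Gamma_pos_of_pos hα1
      have : 0 < (1 / (β * u)) ^ (α - 1) * Real.Gamma (α - 1) := by positivity
      linarith
    · filter_upwards [ae_restrict_mem measurableSet_Ioi] with y hy
      have hy : 0 < y := hy
      positivity
  have h4 : ∀ y : ℝ, y ∈ Ioi (0:ℝ) → ENNReal.ofReal (y ^ (α - 2) * exp ((1 - y) * (β * u)))
      = ENNReal.ofReal (exp (β * u)) *
        ENNReal.ofReal (y ^ (α - 1 - 1) * exp (-(β * u * y))) := by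
    intro y _
    rw [← ENNReal.ofReal_mul (exp_pos _).le, mul_left_comm (exp (β * u)), ← exp_add]
    congr 3 <;> ring
  rw [setLIntegral_congr_fun measurableSet_Ioi h4,
    lintegral_const_mul' _ _ ENNReal.ofReal_ne_top, h3, ← ENNReal.ofReal_mul (exp_pos _).le,
    ← ENNReal.ofReal_mul hα1.le, ENNReal.inv_le_iff_inv_le]
  refine le_trans ?_ (le_gammaMeasure_Ici hα.le hβ hu)
  have hG1 := Real.Gamma_pos_of_pos hα1
  have hG2 : Real.Gamma α = (α - 1) * Real.Gamma (α - 1) := by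
    rw [← Real.Gamma_add_one hα1.ne', sub_add_cancel]
  rw [← ENNReal.ofReal_inv_of_pos (by positivity)]
  refine ENNReal.ofReal_le_ofReal (le_of_eq ?_)
  rw [hG2, div_rpow zero_le_one hx.le, one_rpow, exp_neg]
  have := (rpow_pos_of_pos hx (α - 1)).ne'
  field_simp

theorem measurable_gammaMeasure_Ici (α u : ℝ) :
    Measurable fun β => gammaMeasure α β (Ici u) := by
  simp_rw [gammaMeasure, withDensity_apply _ measurableSet_Ici]
  refine Measurable.lintegral_prod_right' (f := fun p : ℝ × ℝ => gammaPDF α p.1 p.2) ?_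
  unfold gammaPDF gammaPDFReal
  refine Measurable.ennreal_ofReal (Measurable.ite (measurableSet_le measurable_const
    measurable_snd) ?_ measurable_const)
  fun_prop

theorem lintegral_rpow_neg_half_mul_exp {c : ℝ} (hc : 0 < c) :
    ∃ C : ℝ, 0 ≤ C ∧ ∫⁻ y in Ioi (0 : ℝ), ENNReal.ofReal (y ^ (-(1 / 2) : ℝ) * exp (-(c * y)))
      ≤ ENNReal.ofReal C := by
  have h1 := Real.integral_rpow_mul_exp_neg_mul_Ioi (show (0 : ℝ) < 1 / 2 by norm_num) hc
  have hpos : 0 < (1 / c) ^ (1 / 2 : ℝ) * Real.Gamma (1 / 2) := by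
    have := Real.Gamma_pos_of_pos (show (0 : ℝ) < 1 / 2 by norm_num)
    positivity
  refine ⟨_, hpos.le, le_of_eq ?_⟩
  have e : (1 / 2 : ℝ) - 1 = -(1 / 2) := by norm_num
  rw [e] at h1
  rw [← h1, ofReal_integral_eq_lintegral_ofReal]
  · by_contra hni
    rw [integral_undef hni] at h1
    linarith
  · filter_upwards [ae_restrict_mem measurableSet_Ioi] with y hy
    have hy : 0 < y := hy
    positivity

/-- If `β u ≤ κ α`, the level lies well below the bulk of the law and Chernoff gives `p ≥ 1 - δ`
with `δ` exponentially small. Otherwise the integral representation is multiplied by `exp (η (β u -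
κ α)) ≥ 1`. This tilt pays for the unlikely event `β u > κ α` and makes the second term decay in
`α`. -/
theorem inv_gammaMeasure_Ici_sub_one_le {α β u κ η : ℝ} (hα : 1 < α) (hβ : 0 < β) (hu : 0 < u)
    (hκ0 : 0 < κ) (hκ1 : κ < 1) (hη : 0 ≤ η) :
    (gammaMeasure α β (Ici u))⁻¹ - 1 ≤
      ENNReal.ofReal (exp (-(2 * α * rateFun κ)) / (1 - exp (-(2 * α * rateFun κ)))) +
      ENNReal.ofReal ((α - 1) * exp (-(η * κ * α))) *
        ∫⁻ y in Ioi 0, ENNReal.ofReal (y ^ (α - 2) * exp ((1 + η - y) * (β * u))) := by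
  have hα0 : 0 < α := by linarith
  have hh := rateFun_pos hκ0 hκ1.ne
  rcases le_or_gt (β * u) (κ * α) with hx | hx
  · refine le_add_right (inv_sub_one_le_ofReal ?_ ?_)
    · rw [exp_lt_one_iff, neg_lt_zero]; positivity
    · have := isProbabilityMeasure_gammaMeasure hα0 hβ
      rw [← prob_add_prob_compl (μ := gammaMeasure α β) (s := Ici u) measurableSet_Ici, compl_Ici]
      gcongr
      exact gammaMeasure_Iio_le hα0 hβ hκ0 hκ1.le hx
  · refine le_add_left (tsub_le_self.trans ((inv_gammaMeasure_Ici_le hα hβ hu).trans ?_))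
    rw [ENNReal.ofReal_mul (by linarith), mul_assoc,
      ← lintegral_const_mul' (ENNReal.ofReal (exp (-(η * κ * α)))) _ ENNReal.ofReal_ne_top]
    refine mul_le_mul_right ?_ _
    refine setLIntegral_mono' measurableSet_Ioi fun y hy => ?_
    have hy : 0 < y := hy
    rw [← ENNReal.ofReal_mul (exp_pos _).le, mul_left_comm (exp (-(η * κ * α))), ← exp_add]
    refine ENNReal.ofReal_le_ofReal (mul_le_mul_of_nonneg_left (exp_le_exp.2 ?_) (by positivity))
    nlinarith [mul_nonneg hη (sub_nonneg.2 hx.le)]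

/-- Tonelli moves the average over `S` inside, where it is an explicit moment generating function;
the remaining integral over `y` is a Gamma integral independent of `k`. The factor `exp (-(u / 2)
y)` that makes it converge stems from the initial rate `1 / 2`. -/
theorem exists_lintegral_lintegral_exp_sumSqLaw_le {v : ℝ≥0} (hv : 0 < v) {u η : ℝ} (hu : 0 < u)
    (hη : (1 + η) * (v * u) < 1) :
    ∃ C : ℝ, 0 ≤ C ∧ ∀ k : ℕ, 1 ≤ k →
      ∫⁻ S, (∫⁻ y in Ioi 0, ENNReal.ofReal
        (y ^ (((k : ℝ) + 2) / 2 - 2) * exp ((1 + η - y) * ((1 / 2 + S / 2) * u)))) ∂sumSqLaw v k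
      ≤ ENNReal.ofReal (C * (v * u) ^ (-((k : ℝ) - 1) / 2)) := by
  have hv' : (0 : ℝ) < v := hv
  have hr : 0 < v * u := by positivity
  have hA : 0 < 1 - (1 + η) * (v * u) := by linarith
  obtain ⟨C, hC, hCle⟩ := lintegral_rpow_neg_half_mul_exp (show 0 < u / 2 by linarith)
  set A := 1 - (1 + η) * (v * u) with hAdef
  refine ⟨exp ((1 + η) * (u / 2)) * A ^ (-(1 / 2) : ℝ) * C, by positivity, fun k hk => ?_⟩
  have hk' : (1 : ℝ) ≤ k := by exact_mod_cast hk
  rw [lintegral_lintegral_swap (by fun_prop)]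
  have inner : ∀ y ∈ Ioi (0 : ℝ), ∫⁻ S, ENNReal.ofReal
        (y ^ (((k : ℝ) + 2) / 2 - 2) * exp ((1 + η - y) * ((1 / 2 + S / 2) * u))) ∂sumSqLaw v k
      ≤ ENNReal.ofReal (exp ((1 + η) * (u / 2)) * A ^ (-(1 / 2) : ℝ)
          * (v * u) ^ (-((k : ℝ) - 1) / 2)) *
        ENNReal.ofReal (y ^ (-(1 / 2) : ℝ) * exp (-(u / 2 * y))) := by
    intro y hy
    have hy : 0 < y := hy
    have hl : 2 * ((1 + η - y) * u / 2) * v < 1 := by nlinarith [mul_pos hr hy]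
    have e : ∀ S : ℝ, ENNReal.ofReal
        (y ^ (((k : ℝ) + 2) / 2 - 2) * exp ((1 + η - y) * ((1 / 2 + S / 2) * u)))
        = ENNReal.ofReal (y ^ (((k : ℝ) + 2) / 2 - 2) * exp ((1 + η - y) * (u / 2))) *
          ENNReal.ofReal (exp ((1 + η - y) * u / 2 * S)) := by
      intro S
      rw [← ENNReal.ofReal_mul (by positivity), mul_assoc, ← exp_add]
      congr 3; ring
    simp_rw [e]
    rw [lintegral_const_mul' _ _ ENNReal.ofReal_ne_top, lintegral_exp_mul_sumSqLaw hv hl,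
      ← ENNReal.ofReal_mul (by positivity), ← ENNReal.ofReal_mul (by positivity)]
    refine ENNReal.ofReal_le_ofReal ?_
    have e2 : 1 - 2 * ((1 + η - y) * u / 2) * v = A + v * u * y := by rw [hAdef]; ring
    rw [e2]
    have hry : 0 < v * u * y := by positivity
    -- Of the exponent `k / 2`, one half is spent on `A` and the rest on `v u y`. The powers of `y`
    -- then combine to `y ^ (-1/2)`, which is integrable at `0`.
    have b1 : (A + v * u * y) ^ (-((k : ℝ) / 2))
        ≤ A ^ (-(1 / 2) : ℝ) * ((v * u) ^ (-((k : ℝ) - 1) / 2) * y ^ (-((k : ℝ) - 1) / 2)) := by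
      rw [← mul_rpow hr.le hy.le]
      have : -((k : ℝ) / 2) = -(1 / 2) + -((k : ℝ) - 1) / 2 := by ring
      rw [this, rpow_add (by positivity)]
      refine mul_le_mul (rpow_le_rpow_of_nonpos hA (by linarith) (by norm_num))
        (rpow_le_rpow_of_nonpos hry (by linarith) (by linarith)) (by positivity) (by positivity)
    have e3 : y ^ (((k : ℝ) + 2) / 2 - 2) * y ^ (-((k : ℝ) - 1) / 2) = y ^ (-(1 / 2) : ℝ) := by
      rw [← rpow_add hy]; congr 1; ring
    have e4 : exp ((1 + η - y) * (u / 2)) = exp ((1 + η) * (u / 2)) * exp (-(u / 2 * y)) := by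
      rw [← exp_add]; congr 1; ring
    calc _ ≤ y ^ (((k : ℝ) + 2) / 2 - 2) * exp ((1 + η - y) * (u / 2)) *
          (A ^ (-(1 / 2) : ℝ) * ((v * u) ^ (-((k : ℝ) - 1) / 2) * y ^ (-((k : ℝ) - 1) / 2))) :=
          mul_le_mul_of_nonneg_left b1 (by positivity)
      _ = _ := by rw [← e3, e4]; ring
  refine (setLIntegral_mono' measurableSet_Ioi inner).trans ?_
  rw [lintegral_const_mul' _ _ ENNReal.ofReal_ne_top]
  refine (mul_le_mul_right hCle _).trans (le_of_eq ?_)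
  rw [← ENNReal.ofReal_mul (by positivity)]
  congr 1; ring

/-- The expected inverse of the probability that the sampled precision exceeds a level below the
true precision exceeds `1` by a summable amount. -/
theorem exists_sum_lintegral_inv_gammaMeasure_le {v : ℝ≥0} (hv : 0 < v) {u : ℝ} (hu : 0 < u)
    (hvu : v * u < 1) :
    ∃ C : ℝ, 0 ≤ C ∧ ∀ n : ℕ, ∑ k ∈ Finset.range n,
      ∫⁻ S, ((gammaMeasure (((k : ℝ) + 2) / 2) (1 / 2 + S / 2) (Ici u))⁻¹ - 1) ∂sumSqLaw v k
      ≤ ENNReal.ofReal C := by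
  have hv' : (0 : ℝ) < v := hv
  have hr : 0 < v * u := by positivity
  set a := log (1 / (v * u)) with ha
  have ha0 : 0 < a := log_pos (by rw [lt_div_iff₀ hr]; linarith)
  have hab : a < 1 / (v * u) - 1 := by
    refine log_lt_sub_one_of_pos (by positivity) ?_
    rw [Ne, div_eq_one_iff_eq hr.ne']; exact hvu.ne'
  -- The factor `(v u)^(-(k-1)/2)` grows like `exp (a k / 2)` and the tilt decays like `exp (-η κ k
  -- / 2)`, so `η κ > a` is needed with `κ < 1`; finiteness of the exponential moment needs `η < 1 /
  -- (v u) - 1`. The strict inequality `log x < x - 1` leaves room for both.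
  obtain ⟨η, hη1, hη2⟩ := exists_between hab
  have hη0 : 0 < η := ha0.trans hη1
  obtain ⟨κ, hκ1, hκ2⟩ := exists_between ((div_lt_one hη0).2 hη1)
  have hκ0 : 0 < κ := (div_pos ha0 hη0).trans hκ1
  have hηκ : a < η * κ := by rw [div_lt_iff₀ hη0] at hκ1; linarith
  have hh := rateFun_pos hκ0 hκ2.ne
  have hη3 : (1 + η) * (v * u) < 1 := by
    rw [← lt_div_iff₀ hr]; linarith
  obtain ⟨C, hC, hCle⟩ := exists_lintegral_lintegral_exp_sumSqLaw_le hv hu hη3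
  set c := (η * κ - a) / 2 with hc
  have hc0 : 0 < c := by rw [hc]; linarith
  set D := 1 / (1 - exp (-(2 * rateFun κ))) with hD
  have hD0 : 0 < 1 - exp (-(2 * rateFun κ)) := by
    rw [sub_pos, exp_lt_one_iff]; linarith
  have hD1 : 0 < D := by positivity
  set g : ℕ → ℝ := fun k => D * exp (-(rateFun κ * k)) + C * (k * exp (-(c * k))) with hg
  have hg0 : ∀ k, 0 ≤ g k := fun k => by positivity
  have hgs : Summable g := by
    refine Summable.add (Summable.mul_left _ ?_) (Summable.mul_left _ ?_)
    · simpa [neg_mul] using Real.summable_pow_mul_exp_neg_nat_mul 0 hh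
    · have := Real.summable_pow_mul_exp_neg_nat_mul 1 hc0
      refine this.congr fun k => by simp [neg_mul]
  have bound : ∀ k : ℕ, 1 ≤ k →
      ∫⁻ S, ((gammaMeasure (((k : ℝ) + 2) / 2) (1 / 2 + S / 2) (Ici u))⁻¹ - 1) ∂sumSqLaw v k
      ≤ ENNReal.ofReal (g k) := by
    intro k hk
    have hk' : (1 : ℝ) ≤ k := by exact_mod_cast hk
    have hα : 1 < ((k : ℝ) + 2) / 2 := by linarith
    have : ∀ᵐ S ∂sumSqLaw v k, (gammaMeasure (((k : ℝ) + 2) / 2) (1 / 2 + S / 2) (Ici u))⁻¹ - 1 ≤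
        ENNReal.ofReal (D * exp (-(rateFun κ * k))) +
        ENNReal.ofReal (((k : ℝ) / 2) * exp (-(η * κ * (((k : ℝ) + 2) / 2)))) *
        ∫⁻ y in Ioi 0, ENNReal.ofReal (y ^ (((k : ℝ) + 2) / 2 - 2) *
          exp ((1 + η - y) * ((1 / 2 + S / 2) * u))) := by
      filter_upwards [ae_sumSqLaw_nonneg v k] with S hS
      refine (inv_gammaMeasure_Ici_sub_one_le hα (by linarith) hu hκ0 hκ2 hη0.le).trans ?_
      have e : ((k : ℝ) + 2) / 2 - 1 = (k : ℝ) / 2 := by ring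
      rw [e]
      refine add_le_add (ENNReal.ofReal_le_ofReal ?_) le_rfl
      rw [hD, one_div, inv_mul_eq_div]
      have h1 : exp (-(2 * (((k : ℝ) + 2) / 2) * rateFun κ)) ≤ exp (-(rateFun κ * k)) := by
        rw [exp_le_exp]; nlinarith
      have h2 : exp (-(2 * (((k : ℝ) + 2) / 2) * rateFun κ)) ≤ exp (-(2 * rateFun κ)) := by
        rw [exp_le_exp]; nlinarith
      exact div_le_div₀ (exp_pos _).le h1 hD0 (by linarith)
    refine (lintegral_mono_ae this).trans ?_
    rw [lintegral_add_left measurable_const, lintegral_const, measure_univ, mul_one,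
      lintegral_const_mul' _ _ ENNReal.ofReal_ne_top, hg,
      ENNReal.ofReal_add (by positivity) (by positivity)]
    refine add_le_add le_rfl ((mul_le_mul_right (hCle k hk) _).trans ?_)
    rw [← ENNReal.ofReal_mul (by positivity)]
    refine ENNReal.ofReal_le_ofReal ?_
    have e1 : (v * u) ^ (-((k : ℝ) - 1) / 2) = exp (a * (((k : ℝ) - 1) / 2)) := by
      rw [ha, one_div, log_inv, rpow_def_of_pos hr]; congr 1; ring
    have e2 : exp (-(η * κ * (((k : ℝ) + 2) / 2))) * exp (a * (((k : ℝ) - 1) / 2))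
        ≤ exp (-(c * k)) := by
      rw [← exp_add, exp_le_exp, hc]; nlinarith [mul_pos hη0 hκ0]
    rw [e1]
    calc _ = (C * k) * (exp (-(η * κ * (((k : ℝ) + 2) / 2))) * exp (a * (((k : ℝ) - 1) / 2))) / 2 := by
          ring
      _ ≤ (C * k) * exp (-(c * k)) / 2 := by gcongr
      _ ≤ C * (k * exp (-(c * k))) := by
          have : 0 ≤ C * (k * exp (-(c * k))) := by positivity
          linarith
  set f := fun k : ℕ =>
    ∫⁻ S, ((gammaMeasure (((k : ℝ) + 2) / 2) (1 / 2 + S / 2) (Ici u))⁻¹ - 1) ∂sumSqLaw v k with hf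
  -- For `k = 0` the shape is exactly `1`, outside the range `α > 1` of the general bound. Here `S =
  -- 0` almost surely, so only a positive tail is required.
  have hf0 : f 0 ≠ ∞ := by
    have hp := gammaMeasure_Ici_pos (show (1 : ℝ) ≤ (((0 : ℕ) : ℝ) + 2) / 2 by norm_num)
      (show (0 : ℝ) < 1 / 2 + 0 / 2 by norm_num) hu
    simp only [hf, sumSqLaw]
    rw [lintegral_dirac]
    exact ENNReal.sub_ne_top (ENNReal.inv_ne_top.2 hp.ne')
  refine ⟨(f 0).toReal + ∑' k, g k, add_nonneg ENNReal.toReal_nonneg (tsum_nonneg hg0), fun n => ?_⟩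
  have : ∀ k, f k ≤ (if k = 0 then f 0 else 0) + ENNReal.ofReal (g k) := by
    intro k
    rcases Nat.eq_zero_or_pos k with rfl | hk
    · simp
    · exact le_add_left (bound k hk)
  calc ∑ k ∈ Finset.range n, f k
      ≤ ∑ k ∈ Finset.range n, ((if k = 0 then f 0 else 0) + ENNReal.ofReal (g k)) :=
        Finset.sum_le_sum fun k _ => this k
    _ ≤ f 0 + ENNReal.ofReal (∑' k, g k) := by
      rw [Finset.sum_add_distrib]
      refine add_le_add ?_ ?_
      · rw [Finset.sum_ite_eq']; split_ifs <;> simp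
      · rw [← ENNReal.ofReal_sum_of_nonneg fun k _ => hg0 k]
        exact ENNReal.ofReal_le_ofReal (hgs.sum_le_tsum _ fun k _ => hg0 k)
    _ = _ := by
      rw [ENNReal.ofReal_add ENNReal.toReal_nonneg (tsum_nonneg hg0), ENNReal.ofReal_toReal hf0]

/-! ### Inverse moments of the Gaussian tail -/

theorem lintegral_exp_mul_gaussianReal (m : ℝ) (v : ℝ≥0) (l : ℝ) :
    ∫⁻ x, ENNReal.ofReal (exp (l * x)) ∂gaussianReal m v
      = ENNReal.ofReal (exp (m * l + v * l ^ 2 / 2)) := by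
  rw [← ofReal_integral_eq_lintegral_ofReal (integrable_exp_mul_gaussianReal l)
    (Filter.Eventually.of_forall fun x => (exp_pos _).le)]
  congr 1
  exact congrFun (mgf_fun_id_gaussianReal (μ := m) (v := v)) l

theorem gaussianReal_Ici_le (m : ℝ) {v : ℝ≥0} (hv : 0 < v) {a : ℝ} (ha : 0 ≤ a) :
    gaussianReal m v (Ici (m + a)) ≤ ENNReal.ofReal (exp (-(a ^ 2 / (2 * v)))) := by
  have hv' : (0 : ℝ) < v := hv
  refine (measure_le_lintegral_exp measurableSet_Ici (a / v) (m + a) fun x hx =>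
    mul_nonneg (by positivity) (sub_nonneg.2 hx)).trans ?_
  rw [lintegral_exp_mul_gaussianReal, ← ENNReal.ofReal_mul (exp_pos _).le, ← exp_add]
  refine ENNReal.ofReal_le_ofReal (exp_le_exp.2 (le_of_eq ?_))
  field_simp; ring

theorem gaussianReal_Iic_le {g : ℝ} (hg : g ≤ 0) :
    gaussianReal 0 1 (Iic g) ≤ ENNReal.ofReal (exp (-(g ^ 2 / 2))) := by
  refine (measure_le_lintegral_exp measurableSet_Iic g g fun x hx =>
    mul_nonneg_of_nonpos_of_nonpos hg (sub_nonpos.2 hx)).trans ?_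
  rw [lintegral_exp_mul_gaussianReal, ← ENNReal.ofReal_mul (exp_pos _).le, ← exp_add]
  refine ENNReal.ofReal_le_ofReal (exp_le_exp.2 (le_of_eq ?_))
  simp; ring

/-- A constant in the lower bound on the Gaussian tail. -/
def tailConst : ℝ := (√(2 * π))⁻¹ * exp (-(3 / 2))

theorem tailConst_pos : 0 < tailConst := by unfold tailConst; positivity

/-- Only the interval of length `1 / (1 + g)` to the right of `g` is used: there `x²` exceeds `g²`
by at most `3`, whence the factor `exp (-3/2)` in `tailConst`. -/
theorem le_gaussianReal_Ioi {g : ℝ} (hg : 0 ≤ g) :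
    ENNReal.ofReal (tailConst * exp (-(g ^ 2 / 2)) / (1 + g)) ≤ gaussianReal 0 1 (Ioi g) := by
  have h1g : 0 < 1 + g := by linarith
  have hl1 : (1 + g)⁻¹ ≤ 1 := inv_le_one_of_one_le₀ (by linarith)
  have hl0 : 0 < (1 + g)⁻¹ := by positivity
  have hgl : g * (1 + g)⁻¹ ≤ 1 := by rw [mul_inv_le_iff₀ h1g]; linarith
  calc ENNReal.ofReal (tailConst * exp (-(g ^ 2 / 2)) / (1 + g))
      = ∫⁻ _ in Ioc g (g + (1 + g)⁻¹), ENNReal.ofReal (tailConst * exp (-(g ^ 2 / 2))) := by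
        rw [setLIntegral_const, Real.volume_Ioc, ← ENNReal.ofReal_mul
          (by have := tailConst_pos; positivity)]
        congr 1; ring
    _ ≤ ∫⁻ x in Ioc g (g + (1 + g)⁻¹), gaussianPDF 0 1 x := by
        refine setLIntegral_mono' measurableSet_Ioc fun x hx => ENNReal.ofReal_le_ofReal ?_
        unfold gaussianPDFReal tailConst
        rw [mul_assoc, ← exp_add]
        simp only [NNReal.coe_one, mul_one, sub_zero]
        refine mul_le_mul_of_nonneg_left (exp_le_exp.2 ?_) (by positivity)
        have hx2 : x ^ 2 ≤ (g + (1 + g)⁻¹) ^ 2 :=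
          pow_le_pow_left₀ (hg.trans hx.1.le) hx.2 2
        nlinarith
    _ ≤ ∫⁻ x in Ioi g, gaussianPDF 0 1 x := lintegral_mono_set Ioc_subset_Ioi_self
    _ = gaussianReal 0 1 (Ioi g) := by rw [gaussianReal_apply _ one_ne_zero]

theorem inv_sub_one_le_of_le {p : ℝ≥0∞} {c δ : ℝ} (hc : 0 < c) (h : ENNReal.ofReal c ≤ p)
    (hp : 1 ≤ p + ENNReal.ofReal δ) : p⁻¹ - 1 ≤ ENNReal.ofReal (δ / c) := by
  have hp0 : p ≠ 0 := (lt_of_lt_of_le (ENNReal.ofReal_pos.2 hc) h).ne'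
  rcases eq_or_ne p ∞ with rfl | hpt
  · simp
  rw [tsub_le_iff_right, div_eq_mul_inv, mul_comm, ENNReal.ofReal_mul (by positivity),
    ENNReal.ofReal_inv_of_pos hc]
  calc p⁻¹ = p⁻¹ * 1 := (mul_one _).symm
    _ ≤ p⁻¹ * (p + ENNReal.ofReal δ) := by gcongr
    _ = p⁻¹ * ENNReal.ofReal δ + 1 := by
      rw [mul_add, ENNReal.inv_mul_cancel hp0 hpt, add_comm]
    _ ≤ _ := by gcongr

theorem inv_gaussianReal_Ioi_sub_one_le (g : ℝ) :
    (gaussianReal 0 1 (Ioi g))⁻¹ - 1 ≤ if 0 < g then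
      ENNReal.ofReal (tailConst⁻¹ * (1 + g) * exp (g ^ 2 / 2))
      else ENNReal.ofReal (tailConst⁻¹ * exp (-(g ^ 2 / 2))) := by
  have hc := tailConst_pos
  split_ifs with hg
  · refine tsub_le_self.trans ?_
    rw [ENNReal.inv_le_iff_inv_le]
    refine le_trans (le_of_eq ?_) (le_gaussianReal_Ioi hg.le)
    rw [← ENNReal.ofReal_inv_of_pos (by positivity), exp_neg]
    congr 1; field_simp
  · rw [mul_comm, ← div_eq_mul_inv]
    refine inv_sub_one_le_of_le hc ?_ ?_
    · refine le_trans ?_ ((le_gaussianReal_Ioi le_rfl).trans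
        (measure_mono (Ioi_subset_Ioi (not_lt.1 hg))))
      simp
    · rw [← prob_add_prob_compl (μ := gaussianReal 0 1) (s := Ioi g) measurableSet_Ioi, compl_Ioi]
      gcongr
      exact gaussianReal_Iic_le (not_lt.1 hg)

theorem lintegral_one_add_mul_exp_neg_le {a : ℝ} (ha : 0 < a) :
    ∫⁻ g in Ioi (0 : ℝ), ENNReal.ofReal ((1 + g) * exp (-(a * g)))
      ≤ ENNReal.ofReal (1 / a + 1 / a ^ 2) := by
  have h1 := Real.integral_rpow_mul_exp_neg_mul_Ioi (show (0 : ℝ) < 1 by norm_num) ha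
  have h2 := Real.integral_rpow_mul_exp_neg_mul_Ioi (show (0 : ℝ) < 2 by norm_num) ha
  have i1 : IntegrableOn (fun g : ℝ => g ^ ((1 : ℝ) - 1) * exp (-(a * g))) (Ioi 0) := by
    by_contra hni
    rw [integral_undef hni] at h1
    have : 0 < (1 / a) ^ (1 : ℝ) * Real.Gamma 1 := by
      have := Real.Gamma_pos_of_pos one_pos; positivity
    linarith
  have i2 : IntegrableOn (fun g : ℝ => g ^ ((2 : ℝ) - 1) * exp (-(a * g))) (Ioi 0) := by
    by_contra hni
    rw [integral_undef hni] at h2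
    have : 0 < (1 / a) ^ (2 : ℝ) * Real.Gamma 2 := by
      have := Real.Gamma_pos_of_pos two_pos; positivity
    linarith
  have e : ∀ g : ℝ, (1 + g) * exp (-(a * g)) =
      g ^ ((1 : ℝ) - 1) * exp (-(a * g)) + g ^ ((2 : ℝ) - 1) * exp (-(a * g)) := by
    intro g; norm_num; ring
  have i12 : IntegrableOn (fun g : ℝ => g ^ ((1 : ℝ) - 1) * exp (-(a * g)) +
      g ^ ((2 : ℝ) - 1) * exp (-(a * g))) (Ioi 0) := i1.add i2
  simp_rw [e]
  rw [← ofReal_integral_eq_lintegral_ofReal i12, integral_add i1 i2, h1, h2]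
  · refine ENNReal.ofReal_le_ofReal (le_of_eq ?_)
    rw [Real.Gamma_one, Real.Gamma_two, rpow_one, rpow_two]; ring
  · filter_upwards [ae_restrict_mem measurableSet_Ioi] with y hy
    have hy : 0 < y := hy
    positivity

/-- For `g = z - a > 0` the inverse tail grows like `(1 + g) exp (g² / 2)`, just as fast as a
standard Gaussian density decays. Since `v ≤ 1`, the density of `z` is at most a multiple of `exp
(-(g + a)² / 2)`, and the cross term `exp (-a g)` gives convergence. For `g ≤ 0` the excess `1 / p -
1` is itself of order `exp (-g² / 2)`, and completing the square yields `exp (-a² / 4)`. -/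
theorem lintegral_inv_gaussianReal_Ioi_le {v : ℝ≥0} (hv : 0 < v) (hv1 : v ≤ 1) :
    ∃ C : ℝ, 0 ≤ C ∧ ∀ a : ℝ, 0 < a →
      ∫⁻ z, ((gaussianReal 0 1 (Ioi (z - a)))⁻¹ - 1) ∂gaussianReal 0 v
        ≤ ENNReal.ofReal (C * (exp (-(a ^ 2 / 4)) * (1 + 1 / a + 1 / a ^ 2))) := by
  have hv' : (0 : ℝ) < v := hv
  have hv1' : (v : ℝ) ≤ 1 := hv1
  have hc := tailConst_pos
  set K := (√(2 * π * v))⁻¹ with hK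
  have hK0 : 0 < K := by positivity
  refine ⟨K * tailConst⁻¹ * (1 + √π), by positivity, fun a ha => ?_⟩
  set F : ℝ → ℝ≥0∞ := fun g => (gaussianReal 0 1 (Ioi g))⁻¹ - 1 with hF
  have hFm : Measurable F := by
    have : Antitone fun g : ℝ => gaussianReal 0 1 (Ioi g) :=
      fun x y hxy => measure_mono (Ioi_subset_Ioi hxy)
    exact (this.measurable.inv).sub_const 1
  have s1 : ∫⁻ z, F (z - a) ∂gaussianReal 0 v
      ≤ ∫⁻ g, ENNReal.ofReal (K * exp (-((g + a) ^ 2 / 2))) * F g := by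
    rw [gaussianReal_of_var_ne_zero _ hv.ne', lintegral_withDensity_eq_lintegral_mul _
      (measurable_gaussianPDF 0 v) (by fun_prop),
      ← lintegral_sub_right_eq_self (fun g => ENNReal.ofReal (K * exp (-((g + a) ^ 2 / 2))) * F g) a]
    refine lintegral_mono fun z => ?_
    simp only [Pi.mul_apply, gaussianPDF, gaussianPDFReal, sub_add_cancel, sub_zero]
    refine mul_le_mul_left (ENNReal.ofReal_le_ofReal (mul_le_mul_of_nonneg_left
      (exp_le_exp.2 ?_) hK0.le)) _
    rw [neg_div, neg_le_neg_iff]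
    exact div_le_div_of_nonneg_left (sq_nonneg z) (by positivity) (by linarith)
  have s2 : ∀ g : ℝ, ENNReal.ofReal (K * exp (-((g + a) ^ 2 / 2))) * F g ≤
      ENNReal.ofReal (K * tailConst⁻¹ * exp (-(a ^ 2 / 4))) *
        ((Ioi (0 : ℝ)).indicator (fun g => ENNReal.ofReal ((1 + g) * exp (-(a * g)))) g +
        ENNReal.ofReal (exp (-1 * (g + a / 2) ^ 2))) := by
    intro g
    refine (mul_le_mul_right (inv_gaussianReal_Ioi_sub_one_le g) _).trans ?_
    split_ifs with hg
    · rw [indicator_of_mem (show g ∈ Ioi (0 : ℝ) from hg), mul_add (ENNReal.ofReal _), ← ENNReal.ofReal_mul (by positivity),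
        ← ENNReal.ofReal_mul (by positivity)]
      refine le_add_right (ENNReal.ofReal_le_ofReal ?_)
      have : exp (-((g + a) ^ 2 / 2)) * exp (g ^ 2 / 2) ≤ exp (-(a ^ 2 / 4)) * exp (-(a * g)) := by
        rw [← exp_add, ← exp_add, exp_le_exp]; nlinarith
      calc _ = K * tailConst⁻¹ * (1 + g) * (exp (-((g + a) ^ 2 / 2)) * exp (g ^ 2 / 2)) := by ring
        _ ≤ K * tailConst⁻¹ * (1 + g) * (exp (-(a ^ 2 / 4)) * exp (-(a * g))) := by gcongr
        _ = _ := by ring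
    · rw [indicator_of_notMem (by simpa using hg), zero_add, ← ENNReal.ofReal_mul (by positivity),
        ← ENNReal.ofReal_mul (by positivity)]
      refine ENNReal.ofReal_le_ofReal (le_of_eq ?_)
      have : exp (-((g + a) ^ 2 / 2)) * exp (-(g ^ 2 / 2))
          = exp (-(a ^ 2 / 4)) * exp (-1 * (g + a / 2) ^ 2) := by
        rw [← exp_add, ← exp_add]; congr 1; ring
      calc _ = K * tailConst⁻¹ * (exp (-((g + a) ^ 2 / 2)) * exp (-(g ^ 2 / 2))) := by ring
        _ = _ := by rw [this]; ring
  have s3 : ∫⁻ g : ℝ, ENNReal.ofReal (exp (-1 * (g + a / 2) ^ 2)) = ENNReal.ofReal (√π) := by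
    rw [lintegral_add_right_eq_self (fun g : ℝ => ENNReal.ofReal (exp (-1 * g ^ 2))) (a / 2),
      ← ofReal_integral_eq_lintegral_ofReal (integrable_exp_neg_mul_sq one_pos)
      (Filter.Eventually.of_forall fun x => (exp_pos _).le), integral_gaussian, div_one]
  refine (s1.trans (lintegral_mono s2)).trans ?_
  rw [lintegral_const_mul' _ _ ENNReal.ofReal_ne_top, lintegral_add_right _ (by fun_prop),
    lintegral_indicator measurableSet_Ioi, s3]
  refine (mul_le_mul_right (add_le_add (lintegral_one_add_mul_exp_neg_le ha) le_rfl) _).trans ?_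
  rw [← ENNReal.ofReal_add (by positivity) (by positivity), ← ENNReal.ofReal_mul (by positivity)]
  refine ENNReal.ofReal_le_ofReal ?_
  have : 1 / a + 1 / a ^ 2 + √π ≤ (1 + √π) * (1 + 1 / a + 1 / a ^ 2) := by
    have : 0 ≤ √π * (1 / a + 1 / a ^ 2) := by positivity
    nlinarith
  calc _ ≤ K * tailConst⁻¹ * exp (-(a ^ 2 / 4)) * ((1 + √π) * (1 + 1 / a + 1 / a ^ 2)) := by gcongr
    _ = _ := by ring

/-- The full series is `-log (1 - exp (-c))`, which is logarithmic in `1 / c`; the cruder `1 / √c`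
suffices, since with `c` of order `ε²` it costs just one further power of `1 / ε`. -/
theorem sum_exp_neg_div_le {c : ℝ} (hc : 0 < c) (n : ℕ) :
    ∑ k ∈ Finset.range n, exp (-(c * (k + 1))) / (k + 1) ≤ 2 * (1 + 1 / √c) := by
  set x := exp (-c) with hx
  have hx0 : 0 < x := exp_pos _
  have hx1 : x < 1 := by rw [hx, exp_lt_one_iff]; linarith
  have hs := Real.hasSum_pow_div_log_of_abs_lt_one (by rwa [abs_of_pos hx0] : |x| < 1)
  have e : ∀ k : ℕ, exp (-(c * (k + 1))) / (k + 1) = x ^ (k + 1) / (k + 1) := by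
    intro k; rw [hx, ← exp_nat_mul]; congr 2; push_cast; ring
  simp_rw [e]
  refine (sum_le_hasSum _ (fun k _ => by positivity) hs).trans ?_
  have h1 : c / (1 + c) ≤ 1 - x := by
    have : x ≤ 1 / (1 + c) := by
      rw [hx, exp_neg, ← one_div]
      exact one_div_le_one_div_of_le (by linarith) (by linarith [add_one_le_exp c])
    have h2 : c / (1 + c) = 1 - 1 / (1 + c) := by field_simp; ring
    linarith
  have h2 : -log (1 - x) ≤ -log (c / (1 + c)) := neg_le_neg (log_le_log (by positivity) h1)
  refine h2.trans ?_
  have hsq := sqrt_pos.2 hc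
  have h3 : -log (c / (1 + c)) ≤ log ((1 + 1 / √c) ^ 2) := by
    rw [← log_inv, inv_div]
    refine log_le_log (by positivity) ?_
    have : (1 + 1 / √c) ^ 2 = 1 + 2 / √c + 1 / c := by
      rw [add_sq, div_pow, sq_sqrt hc.le]; ring
    rw [this]
    have : (1 + c) / c = 1 + 1 / c := by field_simp; ring
    have h4 : 0 ≤ 2 / √c := by positivity
    linarith
  refine h3.trans ?_
  rw [log_pow]
  have := log_le_sub_one_of_pos (show 0 < 1 + 1 / √c by positivity)
  push_cast
  have h5 : 0 < 1 / √c := by positivity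
  linarith

theorem sum_exp_neg_le {c : ℝ} (hc : 0 < c) (n : ℕ) :
    ∑ k ∈ Finset.range n, exp (-(c * (k + 1))) ≤ 1 / c := by
  set x := exp (-c) with hx
  have hx0 : 0 < x := exp_pos _
  have hx1 : x < 1 := by rw [hx, exp_lt_one_iff]; linarith
  have e : ∀ k : ℕ, exp (-(c * (k + 1))) = x * x ^ k := by
    intro k; rw [hx, ← exp_nat_mul, ← exp_add]; congr 1; ring
  simp_rw [e, ← Finset.mul_sum]
  have h1 := (summable_geometric_of_lt_one hx0.le hx1).sum_le_tsum (Finset.range n)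
    (fun k _ => by positivity)
  rw [tsum_geometric_of_lt_one hx0.le hx1] at h1
  refine (mul_le_mul_of_nonneg_left h1 hx0.le).trans ?_
  rw [mul_inv_le_iff₀ (by linarith), one_div, inv_mul_eq_div, le_div_iff₀ hc]
  have : x * (c + 1) ≤ 1 := by
    have := mul_le_mul_of_nonneg_left (add_one_le_exp c) hx0.le
    rwa [hx, ← exp_add, neg_add_cancel, exp_zero] at this
  linarith

theorem gaussianReal_eq_map {m : ℝ} {v : ℝ≥0} {s : ℕ} (c : ℝ) (hc : c ^ 2 = (s : ℝ)⁻¹) :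
    gaussianReal m (v / s) = (gaussianReal 0 v).map fun z => m + c * z := by
  have : (fun z : ℝ => m + c * z) = (fun z => m + z) ∘ fun z => c * z := rfl
  rw [this, ← Measure.map_map (by fun_prop) (by fun_prop), gaussianReal_map_const_mul,
    gaussianReal_map_const_add]
  congr 1
  · simp
  · ext; push_cast; simp [hc]; ring

/-- The expected inverse of the probability that the sampled mean exceeds `m - ε`, for an arm of
mean `m` and variance at most `1`. -/
theorem exists_sum_lintegral_inv_gaussianReal_le {v : ℝ≥0} (hv : 0 < v) (hv1 : v ≤ 1) :
    ∃ C : ℝ, 0 ≤ C ∧ ∀ (m ε : ℝ), 0 < ε → ε ≤ 1 → ∀ n : ℕ, ∑ k ∈ Finset.range n,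
      ∫⁻ x, ((gaussianReal x (((k + 1 : ℕ) : ℝ≥0)⁻¹) (Ioi (m - ε)))⁻¹ - 1)
        ∂gaussianReal m (v / ((k + 1 : ℕ) : ℝ≥0)) ≤ ENNReal.ofReal (C / ε ^ 3) := by
  obtain ⟨C, hC, hle⟩ := lintegral_inv_gaussianReal_Ioi_le hv hv1
  refine ⟨20 * C, by positivity, fun m ε hε hε1 n => ?_⟩
  have step : ∀ k : ℕ, ∫⁻ x, ((gaussianReal x (((k + 1 : ℕ) : ℝ≥0)⁻¹) (Ioi (m - ε)))⁻¹ - 1)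
        ∂gaussianReal m (v / ((k + 1 : ℕ) : ℝ≥0)) ≤
        ENNReal.ofReal (C * (2 * (exp (-(ε ^ 2 / 4 * (k + 1))) +
          1 / ε ^ 2 * (exp (-(ε ^ 2 / 4 * (k + 1))) / (k + 1))))) := by
    intro k
    set r := √((k : ℝ) + 1) with hr
    have hk0 : (0 : ℝ) < (k : ℝ) + 1 := by positivity
    have hr0 : 0 < r := sqrt_pos.2 hk0
    have hr2 : r ^ 2 = k + 1 := sq_sqrt hk0.le
    have hmeas : Measurable fun x =>
        ((gaussianReal x (((k + 1 : ℕ) : ℝ≥0)⁻¹) (Ioi (m - ε)))⁻¹ - 1) := by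
      refine (Measurable.inv ?_).sub_const 1
      exact (Measure.measurable_coe measurableSet_Ioi).comp
        (measurable_gaussianReal.comp (measurable_id.prodMk measurable_const))
    rw [gaussianReal_eq_map (s := k + 1) (-r⁻¹) (by rw [neg_sq, inv_pow, hr2]; push_cast; rfl),
      lintegral_map hmeas (by fun_prop)]
    have e : ∀ z : ℝ, gaussianReal (m + -r⁻¹ * z) (((k + 1 : ℕ) : ℝ≥0)⁻¹) (Ioi (m - ε))
        = gaussianReal 0 1 (Ioi (z - ε * r)) := by
      intro z
      rw [← one_div ((k + 1 : ℕ) : ℝ≥0), gaussianReal_eq_map (s := k + 1) r⁻¹ (by rw [inv_pow, hr2]; push_cast; rfl),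
        Measure.map_apply (by fun_prop) measurableSet_Ioi]
      congr 1
      ext y
      simp only [mem_preimage, mem_Ioi]
      rw [← mul_lt_mul_iff_right₀ hr0]
      have : r * (m + -r⁻¹ * z + r⁻¹ * y) = r * m - z + y := by field_simp; ring
      rw [this]
      constructor <;> intro h <;> linarith
    simp_rw [e]
    refine (hle (ε * r) (by positivity)).trans (ENNReal.ofReal_le_ofReal
      (mul_le_mul_of_nonneg_left ?_ hC))
    rw [mul_pow, hr2]
    have e2 : ε ^ 2 * ((k : ℝ) + 1) / 4 = ε ^ 2 / 4 * (k + 1) := by ring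
    rw [e2]
    -- The middle term of `1 + 1 / a + 1 / a²` is absorbed by its neighbours, so only the series
    -- with weights `1` and `1 / (k + 1)` have to be summed.
    have hy : 1 / (ε * r) ≤ 1 + 1 / (ε ^ 2 * (k + 1)) := by
      rw [← hr2, ← mul_pow, ← one_div_pow]
      nlinarith [sq_nonneg (1 / (ε * r) - 1)]
    calc exp (-(ε ^ 2 / 4 * (k + 1))) * (1 + 1 / (ε * r) + 1 / (ε ^ 2 * (k + 1)))
        ≤ exp (-(ε ^ 2 / 4 * (k + 1))) * (2 * (1 + 1 / (ε ^ 2 * (k + 1)))) := by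
          refine mul_le_mul_of_nonneg_left ?_ (exp_pos _).le
          linarith
      _ = _ := by field_simp
  refine (Finset.sum_le_sum fun k _ => step k).trans ?_
  rw [← ENNReal.ofReal_sum_of_nonneg fun k _ => by positivity]
  refine ENNReal.ofReal_le_ofReal ?_
  have hc : 0 < ε ^ 2 / 4 := by positivity
  have h1 := sum_exp_neg_le hc n
  have h2 := sum_exp_neg_div_le hc n
  have h3 : √(ε ^ 2 / 4) = ε / 2 := by
    rw [show ε ^ 2 / 4 = (ε / 2) ^ 2 by ring, sqrt_sq (by positivity)]
  rw [h3] at h2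
  rw [← Finset.mul_sum, ← Finset.mul_sum, Finset.sum_add_distrib, ← Finset.mul_sum]
  calc _ ≤ C * (2 * (1 / (ε ^ 2 / 4) + 1 / ε ^ 2 * (2 * (1 + 1 / (ε / 2))))) := by gcongr
    _ = C * (12 * ε + 8) / ε ^ 3 := by field_simp; ring
    _ ≤ 20 * C / ε ^ 3 := by
      have : C * (12 * ε + 8) ≤ 20 * C := by nlinarith
      gcongr

/-! ### Mean and sum of squared deviations of a Gaussian sample -/

/-- One step of the Helmert transformation: the updated mean and the normalised deviation of the new
reward are uncorrelated linear functions of independent Gaussians. The proof compares characteristic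
functions, where independence amounts to the vanishing of the cross term in `a b`. -/
theorem map_gaussianReal_prod_rotation (m : ℝ) (v : ℝ≥0) (s : ℕ) (hs : 0 < s) :
    ((gaussianReal m (v / s)).prod (gaussianReal m v)).map
      (fun p : ℝ × ℝ => ((s * p.1 + p.2) / ((s : ℝ) + 1), √((s : ℝ) / (s + 1)) * (p.2 - p.1)))
      = (gaussianReal m (v / ((s + 1 : ℕ) : ℝ≥0))).prod (gaussianReal 0 v) := by
  have hs' : (0 : ℝ) < s := by exact_mod_cast hs
  have hr2 : √((s : ℝ) / (s + 1)) ^ 2 = s / (s + 1) := sq_sqrt (by positivity)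
  set r := √((s : ℝ) / (s + 1)) with hr
  have : IsProbabilityMeasure (((gaussianReal m (v / s)).prod (gaussianReal m v)).map
      (fun p : ℝ × ℝ => ((s * p.1 + p.2) / ((s : ℝ) + 1), r * (p.2 - p.1)))) :=
    Measure.isProbabilityMeasure_map (by fun_prop)
  rw [← charFun_eq_prod_iff]
  intro t
  obtain ⟨⟨a, b⟩, rfl⟩ : ∃ p : ℝ × ℝ, WithLp.toLp 2 p = t := ⟨WithLp.ofLp t, rfl⟩
  rw [charFun_apply, integral_map (by fun_prop) (by fun_prop), integral_map (by fun_prop)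
    (by fun_prop)]
  have e : ∀ p : ℝ × ℝ, Complex.exp ((inner ℝ (WithLp.toLp 2
      ((s * p.1 + p.2) / ((s : ℝ) + 1), r * (p.2 - p.1))) (WithLp.toLp 2 (a, b)) : ℝ) * Complex.I)
      = Complex.exp (((a * s / (s + 1) - b * r : ℝ) : ℂ) * p.1 * Complex.I) *
        Complex.exp (((a / (s + 1) + b * r : ℝ) : ℂ) * p.2 * Complex.I) := by
    intro p
    rw [← Complex.exp_add]
    congr 1
    rw [WithLp.prod_inner_apply]
    simp only [RCLike.inner_apply, conj_trivial]
    push_cast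
    ring
  simp_rw [e]
  rw [integral_prod_mul (fun x : ℝ => Complex.exp (((a * s / (s + 1) - b * r : ℝ) : ℂ) * x * Complex.I))
    (fun x : ℝ => Complex.exp (((a / (s + 1) + b * r : ℝ) : ℂ) * x * Complex.I)),
    ← charFun_apply_real, ← charFun_apply_real, charFun_gaussianReal, charFun_gaussianReal,
    charFun_gaussianReal, charFun_gaussianReal, ← Complex.exp_add, ← Complex.exp_add]
  congr 1
  have e1 : (a * s / (s + 1) - b * r) + (a / (s + 1) + b * r) = a := by field_simp; ring
  have e2 : (v / s) * (a * s / (s + 1) - b * r) ^ 2 + v * (a / (s + 1) + b * r) ^ 2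
      = v / (s + 1) * a ^ 2 + v * b ^ 2 := by
    have : (v / s) * (a * s / (s + 1) - b * r) ^ 2 + v * (a / (s + 1) + b * r) ^ 2
        = v / (s + 1) * a ^ 2 + v * (s + 1) / s * b ^ 2 * r ^ 2 := by
      field_simp; ring
    rw [this, hr2]; field_simp
  have e1' := congrArg (fun x : ℝ => (x : ℂ)) e1
  have e2' := congrArg (fun x : ℝ => (x : ℂ)) e2
  push_cast at e1' e2' ⊢
  linear_combination (m * Complex.I) * e1' - e2' / 2

/-- The law, after `k + 1` pulls of an arm, of its empirical mean and of the sum of the squared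
deviations of its rewards from that mean. -/
def statLaw (m : ℝ) (v : ℝ≥0) (k : ℕ) : Measure (ℝ × ℝ) :=
  (gaussianReal m (v / ((k + 1 : ℕ) : ℝ≥0))).prod (sumSqLaw v k)

instance isProbabilityMeasure_statLaw (m : ℝ) (v : ℝ≥0) (k : ℕ) :
    IsProbabilityMeasure (statLaw m v k) := by
  unfold statLaw; infer_instance

theorem lintegral_statLaw (m : ℝ) (v : ℝ≥0) (k : ℕ) {f : ℝ × ℝ → ℝ≥0∞} (hf : Measurable f) :
    ∫⁻ q, f q ∂statLaw m v k =
      ∫⁻ S, ∫⁻ x, f (x, S) ∂gaussianReal m (v / ((k + 1 : ℕ) : ℝ≥0)) ∂sumSqLaw v k := by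
  rw [statLaw, lintegral_prod_symm _ hf.aemeasurable]

/-- One more pull turns `statLaw m v k` into `statLaw m v (k + 1)`. -/
theorem lintegral_statLaw_succ (m : ℝ) (v : ℝ≥0) (k : ℕ) {f : ℝ × ℝ → ℝ≥0∞} (hf : Measurable f) :
    ∫⁻ q, (∫⁻ x, f ((((k + 1 : ℕ) : ℝ) * q.1 + x) / (((k + 1 : ℕ) : ℝ) + 1),
        q.2 + ((k + 1 : ℕ) : ℝ) / (((k + 1 : ℕ) : ℝ) + 1) * (x - q.1) ^ 2) ∂gaussianReal m v)
        ∂statLaw m v k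
      = ∫⁻ q, f q ∂statLaw m v (k + 1) := by
  rw [lintegral_statLaw _ _ _ hf, lintegral_sumSqLaw_succ _ _ (Measurable.lintegral_prod_left'
      (f := fun p : ℝ × ℝ => f p) hf), lintegral_statLaw]
  swap
  · exact Measurable.lintegral_prod_right' (f := fun p : (ℝ × ℝ) × ℝ =>
      f ((((k + 1 : ℕ) : ℝ) * p.1.1 + p.2) / (((k + 1 : ℕ) : ℝ) + 1),
        p.1.2 + ((k + 1 : ℕ) : ℝ) / (((k + 1 : ℕ) : ℝ) + 1) * (p.2 - p.1.1) ^ 2)) (by fun_prop)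
  refine lintegral_congr fun S => ?_
  have h := map_gaussianReal_prod_rotation m v (k + 1) k.succ_pos
  have hm : Measurable fun p : ℝ × ℝ => f (p.1, S + p.2 ^ 2) := by fun_prop
  rw [← lintegral_prod_symm _ hm.aemeasurable, ← h, lintegral_map hm (by fun_prop),
    lintegral_prod _ (by fun_prop)]
  refine lintegral_congr fun x => lintegral_congr fun y => ?_
  rw [mul_pow, sq_sqrt (by positivity)]

/-! ### The parameters of an arm along a run -/

/-- Parameters of arm `i` at the beginning of round `t` of a run. -/
def runParams {Ω : Type*} {K : ℕ} (X : Fin K → ℕ → Ω → ℝ) (A : ℕ → Ω → Fin K) (i : Fin K) (t : ℕ)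
    (ω : Ω) : PostParams :=
  postParams (fun s => A s ω) (fun s => X (A s ω) s ω) i t

section Params

variable {Ω : Type*} {K : ℕ} {X : Fin K → ℕ → Ω → ℝ} {A : ℕ → Ω → Fin K}

theorem runParams_succ (i : Fin K) (t : ℕ) (ω : Ω) :
    runParams X A i (t + 1) ω = if A t ω = i then (runParams X A i t ω).update (X i t ω)
      else runParams X A i t ω := by
  rw [runParams, postParams]
  split_ifs with h
  · rw [h]; rfl
  · rfl

theorem runParams_shape (i : Fin K) (t : ℕ) (ω : Ω) :
    (runParams X A i t ω).shape = ((runParams X A i t ω).pulls + 1) / 2 := by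
  induction t with
  | zero => simp [runParams, postParams, PostParams.init]
  | succ t ih =>
    rw [runParams_succ]
    split_ifs with h
    · simp only [PostParams.update, ih]; push_cast; ring
    · exact ih

theorem half_le_runParams_rate (i : Fin K) (t : ℕ) (ω : Ω) :
    1 / 2 ≤ (runParams X A i t ω).rate := by
  induction t with
  | zero => simp [runParams, postParams, PostParams.init]
  | succ t ih =>
    rw [runParams_succ]
    split_ifs with h
    · simp only [PostParams.update]
      have : 0 ≤ ((runParams X A i t ω).pulls : ℝ) / ((runParams X A i t ω).pulls + 1) *
        (X i t ω - (runParams X A i t ω).mean) ^ 2 / 2 := by positivity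
      linarith
    · exact ih

theorem runParams_pulls (i : Fin K) (t : ℕ) (ω : Ω) :
    (runParams X A i t ω).pulls = ∑ s ∈ Finset.range t, if A s ω = i then 1 else 0 := by
  induction t with
  | zero => simp [runParams, postParams, PostParams.init]
  | succ t ih =>
    rw [runParams_succ, Finset.sum_range_succ, ← ih]
    split_ifs with h <;> simp [PostParams.update]

theorem measurable_runParams [MeasurableSpace Ω] (t : ℕ) (hA : ∀ s < t, Measurable (A s))
    (hX : ∀ s < t, ∀ i, Measurable (X i s)) (i : Fin K) :
    Measurable fun ω => ((runParams X A i t ω).pulls, (runParams X A i t ω).mean,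
      (runParams X A i t ω).rate) := by
  induction t with
  | zero => exact (measurable_const : Measurable fun _ : Ω => ((0 : ℕ), (0 : ℝ), (1 / 2 : ℝ)))
  | succ t ih =>
    have ih := ih (fun s hs => hA s (by omega)) (fun s hs => hX s (by omega))
    have h1 : Measurable fun ω => (runParams X A i t ω).pulls := ih.fst
    have h2 : Measurable fun ω => (runParams X A i t ω).mean := ih.snd.fst
    have h3 : Measurable fun ω => (runParams X A i t ω).rate := ih.snd.snd
    have h4 := hX t (by omega) i
    have h5 : Measurable fun ω => ((runParams X A i t ω).pulls : ℝ) :=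
      measurable_from_nat.comp h1
    have hs : MeasurableSet {ω | A t ω = i} := hA t (by omega) (measurableSet_singleton i)
    have e : (fun ω => ((runParams X A i (t + 1) ω).pulls, (runParams X A i (t + 1) ω).mean,
        (runParams X A i (t + 1) ω).rate)) = fun ω => if A t ω = i then
        ((runParams X A i t ω).pulls + 1,
          ((runParams X A i t ω).pulls * (runParams X A i t ω).mean + X i t ω) /
            ((runParams X A i t ω).pulls + 1),
          (runParams X A i t ω).rate + (runParams X A i t ω).pulls /
            ((runParams X A i t ω).pulls + 1) * (X i t ω - (runParams X A i t ω).mean) ^ 2 / 2)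
        else ((runParams X A i t ω).pulls, (runParams X A i t ω).mean,
          (runParams X A i t ω).rate) := by
      funext ω
      rw [runParams_succ]
      split_ifs <;> rfl
    rw [e]
    refine Measurable.ite hs (Measurable.prodMk ?_ (Measurable.prodMk ?_ ?_)) ih
    · exact h1.add_const 1
    · fun_prop
    · fun_prop

end Params

/-! ### Measurability with respect to the past and the current decision -/

section Sigma

variable {Ω : Type*} {K : ℕ} {X τ θ : Fin K → ℕ → Ω → ℝ} {A : ℕ → Ω → Fin K}

theorem measurable_pastSigma_reward {s t : ℕ} (hst : s < t) (i : Fin K) :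
    Measurable[pastSigma X τ θ A t] (X i s) := by
  have h1 : Measurable[MeasurableSpace.comap (rewards X s) inferInstance] (X i s) :=
    (measurable_pi_apply i).comp (comap_measurable (rewards X s))
  refine h1.mono ?_ le_rfl
  exact le_sup_left.trans (le_iSup₂_of_le (f := fun s (_ : s ∈ Finset.range t) =>
    MeasurableSpace.comap (rewards X s) inferInstance ⊔ decisionSigma τ θ A s) s
    (Finset.mem_range.2 hst) le_rfl)

theorem measurable_pastSigma_arm {s t : ℕ} (hst : s < t) :
    Measurable[pastSigma X τ θ A t] (A s) := by
  have h1 : Measurable[MeasurableSpace.comap (A s) inferInstance] (A s) := comap_measurable (A s)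
  refine h1.mono ?_ le_rfl
  exact (le_sup_right.trans le_sup_right).trans
    (le_iSup₂_of_le (f := fun s (_ : s ∈ Finset.range t) =>
    MeasurableSpace.comap (rewards X s) inferInstance ⊔ decisionSigma τ θ A s) s
    (Finset.mem_range.2 hst) le_rfl)

theorem measurable_decisionSigma_arm (t : ℕ) :
    Measurable[pastSigma X τ θ A t ⊔ decisionSigma τ θ A t] (A t) := by
  have h1 : Measurable[MeasurableSpace.comap (A t) inferInstance] (A t) := comap_measurable (A t)
  exact h1.mono (le_sup_right.trans le_sup_right) le_rfl

theorem measurable_pastSigma_runParams (t : ℕ) (i : Fin K) :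
    Measurable[pastSigma X τ θ A t] fun ω => ((runParams X A i t ω).pulls,
      (runParams X A i t ω).mean, (runParams X A i t ω).rate) :=
  @measurable_runParams Ω K X A (pastSigma X τ θ A t) t
    (fun _ hs => measurable_pastSigma_arm hs) (fun _ hs i => measurable_pastSigma_reward hs i) i

theorem measurable_play_indicator (t : ℕ) (i : Fin K) (s : ℕ) :
    Measurable[pastSigma X τ θ A t ⊔ decisionSigma τ θ A t] fun ω =>
      (if A t ω = i ∧ (runParams X A i t ω).pulls = s then 1 else 0 : ℝ≥0∞) := by
  have h1 : Measurable[pastSigma X τ θ A t ⊔ decisionSigma τ θ A t] fun ω =>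
      (runParams X A i t ω).pulls :=
    (measurable_pastSigma_runParams (X := X) (τ := τ) (θ := θ) (A := A) t i).fst.mono
      le_sup_left le_rfl
  have h2 := measurable_decisionSigma_arm (X := X) (τ := τ) (θ := θ) (A := A) t
  refine @Measurable.ite Ω ℝ≥0∞ _ _ (pastSigma X τ θ A t ⊔ decisionSigma τ θ A t) _ _ _ ?_
    (@measurable_const _ _ _ (_) _) (@measurable_const _ _ _ (_) _)
  exact (h2 (measurableSet_singleton i)).inter (h1 (measurableSet_singleton s))

theorem isProbabilityMeasure_sampleLaw (i : Fin K) (t : ℕ) (ω : Ω) :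
    IsProbabilityMeasure (runParams X A i t ω).sampleLaw := by
  have h1 : 0 < (runParams X A i t ω).shape := by rw [runParams_shape]; positivity
  have h2 : 0 < (runParams X A i t ω).rate := by
    linarith [half_le_runParams_rate (X := X) (A := A) i t ω]
  have := isProbabilityMeasure_gammaMeasure h1 h2
  unfold PostParams.sampleLaw
  infer_instance

end Sigma

/-! ### Conservation of pulls and the law of the parameters at a pull -/

section Run

variable {Ω : Type*} [m0 : MeasurableSpace Ω] {P : Measure Ω} {K : ℕ} {μ : Fin K → ℝ}
  {v : Fin K → ℝ≥0} {L₀ ρ : ℝ} {X τ θ : Fin K → ℕ → Ω → ℝ} {A : ℕ → Ω → Fin K}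

namespace IsSRTS

theorem measurable_rewards (h : IsSRTS P μ v L₀ ρ X τ θ A) (t : ℕ) : Measurable (rewards X t) :=
  measurable_pi_lambda _ fun i => h.measurable_reward i t

theorem comap_rewards_le (h : IsSRTS P μ v L₀ ρ X τ θ A) (t : ℕ) :
    MeasurableSpace.comap (rewards X t) inferInstance ≤ m0 :=
  (h.measurable_rewards t).comap_le

theorem measurable_samples (h : IsSRTS P μ v L₀ ρ X τ θ A) (t : ℕ) :
    Measurable (samples τ θ t) :=
  measurable_pi_lambda _ fun i => (h.measurable_precision i t).prodMk (h.measurable_mean i t)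

theorem decisionSigma_le (h : IsSRTS P μ v L₀ ρ X τ θ A) (t : ℕ) :
    decisionSigma τ θ A t ≤ m0 :=
  sup_le (h.measurable_samples t).comap_le (h.measurable_arm t).comap_le

theorem pastSigma_le (h : IsSRTS P μ v L₀ ρ X τ θ A) (t : ℕ) : pastSigma X τ θ A t ≤ m0 :=
  iSup₂_le fun s _ => sup_le (h.comap_rewards_le s) (h.decisionSigma_le s)

theorem map_reward (h : IsSRTS P μ v L₀ ρ X τ θ A) (i : Fin K) (t : ℕ) :
    P.map (X i t) = gaussianReal (μ i) (v i) := by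
  have : X i t = Function.eval i ∘ rewards X t := rfl
  rw [this, ← Measure.map_map (measurable_pi_apply i) (h.measurable_rewards t),
    h.reward_law t,
    (measurePreserving_eval (fun i => gaussianReal (μ i) (v i)) i).map_eq]

theorem indepFun_reward (h : IsSRTS P μ v L₀ ρ X τ θ A) (i : Fin K) (t : ℕ) {β : Type*}
    [MeasurableSpace β] {Z : Ω → β}
    (hZ : Measurable[pastSigma X τ θ A t ⊔ decisionSigma τ θ A t] Z) : IndepFun Z (X i t) P := by
  refine (IndepFun_iff_Indep _ _ _).2 ?_
  refine indep_of_indep_of_le_left (indep_of_indep_of_le_right (h.reward_indep t).symm ?_)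
    hZ.comap_le
  exact ((measurable_pi_apply i).comp (comap_measurable (rewards X t))).comap_le

/-- A reward is independent of all that happened up to the decision of its round. -/
theorem lintegral_reward [IsProbabilityMeasure P] (h : IsSRTS P μ v L₀ ρ X τ θ A)
    (i : Fin K) (t : ℕ) {β : Type*}
    [MeasurableSpace β] {Z : Ω → β}
    (hZ : Measurable[pastSigma X τ θ A t ⊔ decisionSigma τ θ A t] Z) {F : β × ℝ → ℝ≥0∞}
    (hF : Measurable F) :
    ∫⁻ ω, F (Z ω, X i t ω) ∂P = ∫⁻ ω, ∫⁻ x, F (Z ω, x) ∂gaussianReal (μ i) (v i) ∂P := by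
  have hZ' : Measurable Z := hZ.mono (sup_le (h.pastSigma_le t) (h.decisionSigma_le t)) le_rfl
  have hX := h.measurable_reward i t
  have h1 := (indepFun_iff_map_prod_eq_prod_map_map hZ'.aemeasurable hX.aemeasurable).1
    (h.indepFun_reward i t hZ)
  have : IsProbabilityMeasure (P.map Z) := Measure.isProbabilityMeasure_map hZ'.aemeasurable
  rw [h.map_reward] at h1
  rw [← lintegral_map (f := F) (g := fun ω => (Z ω, X i t ω)) hF (hZ'.prodMk hX), h1,
    lintegral_prod _ hF.aemeasurable, lintegral_map (Measurable.lintegral_prod_right' hF) hZ']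

theorem one_le_pulls (h : IsSRTS P μ v L₀ ρ X τ θ A) (i : Fin K) {t : ℕ} (ht : K ≤ t) (ω : Ω) :
    1 ≤ (runParams X A i t ω).pulls := by
  rw [runParams_pulls]
  have hi : A i ω = i := h.initial_rounds i i.2 ω
  calc 1 = if A i ω = i then 1 else 0 := by rw [if_pos hi]
    _ ≤ _ := Finset.single_le_sum (f := fun s => if A s ω = i then 1 else 0)
      (fun s _ => Nat.zero_le _) (Finset.mem_range.2 (i.2.trans_le ht))

/-- The mean of `G` after the update of mean `q.1` and rate `q.2` at the `s + 1`-st pull. -/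
def stepMean (m : ℝ) (w : ℝ≥0) (s : ℕ) (G : ℝ × ℝ → ℝ≥0∞) (q : ℝ × ℝ) : ℝ≥0∞ :=
  ∫⁻ x, G ((s * q.1 + x) / ((s : ℝ) + 1), q.2 + s / ((s : ℝ) + 1) * (x - q.1) ^ 2 / 2)
    ∂gaussianReal m w

theorem measurable_stepMean (m : ℝ) (w : ℝ≥0) (s : ℕ) {G : ℝ × ℝ → ℝ≥0∞} (hG : Measurable G) :
    Measurable (stepMean m w s G) :=
  Measurable.lintegral_prod_right' (f := fun p : (ℝ × ℝ) × ℝ =>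
    G ((s * p.1.1 + p.2) / ((s : ℝ) + 1), p.1.2 + s / ((s : ℝ) + 1) * (p.2 - p.1.1) ^ 2 / 2))
    (by fun_prop)

/-- Expectation of `G` of the parameters of arm `i` in round `t` on the event that the arm has been
pulled `s` times. -/
def stateMean (P : Measure Ω) (X : Fin K → ℕ → Ω → ℝ) (A : ℕ → Ω → Fin K) (i : Fin K) (s : ℕ)
    (G : ℝ × ℝ → ℝ≥0∞) (t : ℕ) : ℝ≥0∞ :=
  ∫⁻ ω, (if (runParams X A i t ω).pulls = s then 1 else 0) *
    G ((runParams X A i t ω).mean, (runParams X A i t ω).rate) ∂P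

/-- Expectation of `G` of the parameters of arm `i` in round `t` on the event that the arm is
played in that round for the `s + 1`-st time. -/
def playMean (P : Measure Ω) (X : Fin K → ℕ → Ω → ℝ) (A : ℕ → Ω → Fin K) (i : Fin K) (s : ℕ)
    (G : ℝ × ℝ → ℝ≥0∞) (t : ℕ) : ℝ≥0∞ :=
  ∫⁻ ω, (if A t ω = i ∧ (runParams X A i t ω).pulls = s then 1 else 0) *
    G ((runParams X A i t ω).mean, (runParams X A i t ω).rate) ∂P

theorem measurable_params (h : IsSRTS P μ v L₀ ρ X τ θ A) (i : Fin K) (t : ℕ) :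
    Measurable fun ω => ((runParams X A i t ω).pulls,
      (runParams X A i t ω).mean, (runParams X A i t ω).rate) :=
  (measurable_pastSigma_runParams (τ := τ) (θ := θ) t i).mono (h.pastSigma_le t) le_rfl

/-- The indicator of the play and the old parameters are known before the reward is revealed, so the
reward may be integrated out against its own law. -/
theorem lintegral_play_update [IsProbabilityMeasure P] (h : IsSRTS P μ v L₀ ρ X τ θ A)
    (i : Fin K) (s t : ℕ)
    {G : ℝ × ℝ → ℝ≥0∞} (hG : Measurable G) :
    ∫⁻ ω, (if A t ω = i ∧ (runParams X A i t ω).pulls = s then 1 else 0) *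
      G ((s * (runParams X A i t ω).mean + X i t ω) / ((s : ℝ) + 1), (runParams X A i t ω).rate +
        s / ((s : ℝ) + 1) * (X i t ω - (runParams X A i t ω).mean) ^ 2 / 2) ∂P
      = playMean P X A i s (stepMean (μ i) (v i) s G) t := by
  have hZ : Measurable[pastSigma X τ θ A t ⊔ decisionSigma τ θ A t] fun ω =>
      ((if A t ω = i ∧ (runParams X A i t ω).pulls = s then 1 else 0 : ℝ≥0∞),
        ((runParams X A i t ω).mean, (runParams X A i t ω).rate)) :=
    @Measurable.prodMk _ _ _ _ (_) _ _ _ (measurable_play_indicator t i s)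
      ((measurable_pastSigma_runParams t i).snd.mono le_sup_left le_rfl)
  rw [h.lintegral_reward i t hZ (F := fun p => p.1.1 * G ((s * p.1.2.1 + p.2) / ((s : ℝ) + 1),
    p.1.2.2 + s / ((s : ℝ) + 1) * (p.2 - p.1.2.1) ^ 2 / 2)) (by fun_prop)]
  refine lintegral_congr fun ω => ?_
  rw [lintegral_const_mul _ (by fun_prop)]
  rfl

/-- A balance equation for the level of `s + 1` pulls: an arm leaves it by being played there and
enters it by being played at level `s`. The entering mass carries updated parameters, hence
`stepMean`. -/
theorem stateMean_succ_add [IsProbabilityMeasure P] (h : IsSRTS P μ v L₀ ρ X τ θ A)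
    (i : Fin K) (s t : ℕ)
    {G : ℝ × ℝ → ℝ≥0∞} (hG : Measurable G) :
    stateMean P X A i (s + 1) G (t + 1) + playMean P X A i (s + 1) G t
      = stateMean P X A i (s + 1) G t + playMean P X A i s (stepMean (μ i) (v i) s G) t := by
  have hm := h.measurable_params i t
  have hm' := h.measurable_params i (t + 1)
  have hle : pastSigma X τ θ A t ⊔ decisionSigma τ θ A t ≤ m0 :=
    sup_le (h.pastSigma_le t) (h.decisionSigma_le t)
  have hq : Measurable fun ω => G ((runParams X A i t ω).mean, (runParams X A i t ω).rate) :=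
    hG.comp hm.snd
  have hp : Measurable fun ω =>
      (if A t ω = i ∧ (runParams X A i t ω).pulls = s + 1 then 1 else 0 : ℝ≥0∞) :=
    (measurable_play_indicator (τ := τ) (θ := θ) t i (s + 1)).mono hle le_rfl
  have hs : Measurable fun ω => (if (runParams X A i t ω).pulls = s + 1 then 1 else 0 : ℝ≥0∞) :=
    Measurable.ite (hm.fst (measurableSet_singleton (s + 1))) measurable_const measurable_const
  have hpq := hp.mul hq
  have hsq := hs.mul hq
  simp only [Pi.mul_def] at hpq hsq
  rw [← h.lintegral_play_update i s t hG, stateMean, playMean, stateMean,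
    ← lintegral_add_right _ hpq, ← lintegral_add_left hsq]
  refine lintegral_congr fun ω => ?_
  rw [runParams_succ]
  by_cases hA : A t ω = i
  · by_cases hs : (runParams X A i t ω).pulls = s
    · simp [hA, hs, PostParams.update]
    · simp [hA, hs, PostParams.update]
  · simp [hA]

theorem stateMean_zero_add [IsProbabilityMeasure P] (h : IsSRTS P μ v L₀ ρ X τ θ A)
    (i : Fin K) (t : ℕ)
    {G : ℝ × ℝ → ℝ≥0∞} (hG : Measurable G) :
    stateMean P X A i 0 G (t + 1) + playMean P X A i 0 G t = stateMean P X A i 0 G t := by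
  have hm := h.measurable_params i t
  have hle : pastSigma X τ θ A t ⊔ decisionSigma τ θ A t ≤ m0 :=
    sup_le (h.pastSigma_le t) (h.decisionSigma_le t)
  have hq : Measurable fun ω => G ((runParams X A i t ω).mean, (runParams X A i t ω).rate) :=
    hG.comp hm.snd
  have hp : Measurable fun ω =>
      (if A t ω = i ∧ (runParams X A i t ω).pulls = 0 then 1 else 0 : ℝ≥0∞) :=
    (measurable_play_indicator (τ := τ) (θ := θ) t i 0).mono hle le_rfl
  have hpq := hp.mul hq
  simp only [Pi.mul_def] at hpq
  rw [stateMean, playMean, stateMean, ← lintegral_add_right _ hpq]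
  refine lintegral_congr fun ω => ?_
  rw [runParams_succ]
  by_cases hA : A t ω = i
  · simp [hA, PostParams.update]
  · simp [hA]

/-- The balance equations telescope over the rounds. The inequality only discards the mass still
waiting at level `s + 1` after `n` rounds, so the possible absence of the pull never has to be
conditioned on. -/
theorem sum_playMean_succ_le [IsProbabilityMeasure P] (h : IsSRTS P μ v L₀ ρ X τ θ A)
    (i : Fin K) (s n : ℕ)
    {G : ℝ × ℝ → ℝ≥0∞} (hG : Measurable G) :
    ∑ t ∈ Finset.range n, playMean P X A i (s + 1) G t
      ≤ ∑ t ∈ Finset.range n, playMean P X A i s (stepMean (μ i) (v i) s G) t := by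
  have : stateMean P X A i (s + 1) G n + ∑ t ∈ Finset.range n, playMean P X A i (s + 1) G t
      = ∑ t ∈ Finset.range n, playMean P X A i s (stepMean (μ i) (v i) s G) t := by
    induction n with
    | zero => simp [stateMean, runParams, postParams, PostParams.init]
    | succ n ih =>
      rw [Finset.sum_range_succ, Finset.sum_range_succ, ← ih, add_comm _ (playMean _ _ _ _ _ _ _),
        ← add_assoc, h.stateMean_succ_add i s n hG]
      ring
  rw [← this]
  exact le_add_self

theorem sum_playMean_zero_le [IsProbabilityMeasure P] (h : IsSRTS P μ v L₀ ρ X τ θ A)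
    (i : Fin K) (n : ℕ)
    {G : ℝ × ℝ → ℝ≥0∞} (hG : Measurable G) :
    ∑ t ∈ Finset.range n, playMean P X A i 0 G t ≤ G (0, 1 / 2) := by
  have : stateMean P X A i 0 G n + ∑ t ∈ Finset.range n, playMean P X A i 0 G t
      = G (0, 1 / 2) := by
    induction n with
    | zero => simp [stateMean, runParams, postParams, PostParams.init]
    | succ n ih =>
      rw [Finset.sum_range_succ, ← ih, add_comm _ (playMean _ _ _ _ _ _ _), ← add_assoc,
        h.stateMean_zero_add i n hG]
  rw [← this]
  exact le_add_self

/-- The parameters of arm `i` at its `k + 2`-nd pull are distributed as those obtained from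
`k + 1` independent rewards, up to the event that the pull does not take place. -/
theorem sum_playMean_le [IsProbabilityMeasure P] (h : IsSRTS P μ v L₀ ρ X τ θ A)
    (i : Fin K) (k n : ℕ)
    {G : ℝ × ℝ → ℝ≥0∞} (hG : Measurable G) :
    ∑ t ∈ Finset.range n, playMean P X A i (k + 1) G t
      ≤ ∫⁻ q, G (q.1, 1 / 2 + q.2 / 2) ∂statLaw (μ i) (v i) k := by
  induction k generalizing G with
  | zero =>
    -- Before any pull the parameters are the deterministic `(0, 1/2)`. The first update has `s =
    -- 0`, so the mean becomes the reward and the rate stays `1/2`.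
    refine (h.sum_playMean_succ_le i 0 n hG).trans
      ((h.sum_playMean_zero_le i n (measurable_stepMean _ _ _ hG)).trans (le_of_eq ?_))
    rw [lintegral_statLaw _ _ _ (by fun_prop), sumSqLaw, lintegral_dirac, stepMean]
    simp
  | succ k ih =>
    refine (h.sum_playMean_succ_le i (k + 1) n hG).trans
      ((ih (measurable_stepMean _ _ _ hG)).trans (le_of_eq ?_))
    rw [← lintegral_statLaw_succ (μ i) (v i) k (f := fun q => G (q.1, 1 / 2 + q.2 / 2))
      (by fun_prop)]
    refine lintegral_congr fun q => lintegral_congr fun x => ?_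
    congr 2
    push_cast
    ring

/-- The law from which the samples of all arms are drawn in round `t`. -/
def roundLaw (X : Fin K → ℕ → Ω → ℝ) (A : ℕ → Ω → Fin K) (t : ℕ) (ω : Ω) :
    Measure (Fin K → ℝ × ℝ) :=
  Measure.pi fun i => (runParams X A i t ω).sampleLaw

/-- Extends the conditional law from conditional probabilities of events to integrals of nonnegative
functions of the past. Restriction to the event and density by its conditional probability define
the same measure on the past `σ`-algebra. -/
theorem lintegral_samples [IsProbabilityMeasure P] (h : IsSRTS P μ v L₀ ρ X τ θ A)
    {t : ℕ} (ht : K ≤ t)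
    {B : Set (Fin K → ℝ × ℝ)} (hB : MeasurableSet B) {G : Ω → ℝ≥0∞}
    (hG : Measurable[pastSigma X τ θ A t] G) :
    ∫⁻ ω in samples τ θ t ⁻¹' B, G ω ∂P = ∫⁻ ω, roundLaw X A t ω B * G ω ∂P := by
  have hm := h.pastSigma_le t
  have hS : MeasurableSet (samples τ θ t ⁻¹' B) := h.measurable_samples t hB
  set f : Ω → ℝ := P⟦samples τ θ t ⁻¹' B | pastSigma X τ θ A t⟧ with hf
  have hae : ∀ᵐ ω ∂P, roundLaw X A t ω B = ENNReal.ofReal (f ω) := by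
    filter_upwards [h.sample_law t ht B hB] with ω hω
    rw [hf, hω]
    have : ∀ i, IsProbabilityMeasure
        (postParams (fun s => A s ω) (fun s => X (A s ω) s ω) i t).sampleLaw :=
      fun i => isProbabilityMeasure_sampleLaw (X := X) (A := A) i t ω
    rw [ofReal_measureReal]
    rfl
  have hfm : Measurable[pastSigma X τ θ A t] f := stronglyMeasurable_condExp.measurable
  have hf0 : ∀ᵐ ω ∂P, 0 ≤ f ω := by
    filter_upwards [h.sample_law t ht B hB] with ω hω
    rw [hf, hω]
    exact measureReal_nonneg
  have hfm' : Measurable fun ω => ENNReal.ofReal (f ω) := (hfm.mono hm le_rfl).ennreal_ofReal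
  have key : (P.restrict (samples τ θ t ⁻¹' B)).trim hm
      = (P.withDensity fun ω => ENNReal.ofReal (f ω)).trim hm := by
    refine @Measure.ext _ (pastSigma X τ θ A t) _ _ fun E hE => ?_
    rw [trim_measurableSet_eq hm hE, trim_measurableSet_eq hm hE, Measure.restrict_apply (hm _ hE),
      withDensity_apply _ (hm _ hE), ← ofReal_integral_eq_lintegral_ofReal
        integrable_condExp.integrableOn (ae_restrict_of_ae hf0),
      setIntegral_condExp hm ((integrable_const 1).indicator hS) hE,
      setIntegral_indicator hS, setIntegral_const, smul_eq_mul, mul_one, ofReal_measureReal]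
  calc ∫⁻ ω in samples τ θ t ⁻¹' B, G ω ∂P
      = ∫⁻ ω, G ω ∂(P.restrict (samples τ θ t ⁻¹' B)).trim hm := (lintegral_trim hm hG).symm
    _ = ∫⁻ ω, G ω ∂(P.withDensity fun ω => ENNReal.ofReal (f ω)) := by
        rw [key, lintegral_trim hm hG]
    _ = ∫⁻ ω, ENNReal.ofReal (f ω) * G ω ∂P :=
        lintegral_withDensity_eq_lintegral_mul _ hfm' (hG.mono hm le_rfl)
    _ = _ := by
      refine lintegral_congr_ae ?_
      filter_upwards [hae] with ω hω
      rw [hω]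

end IsSRTS

end Run

/-! ### The sampling step -/

/-- The sampling law of an arm that has been pulled `q.1` times, has empirical mean `q.2.1` and
rate `q.2.2`. -/
def stateLaw (q : ℕ × ℝ × ℝ) : Measure (ℝ × ℝ) :=
  (gammaMeasure (((q.1 : ℝ) + 1) / 2) q.2.2).prod (gaussianReal q.2.1 (q.1 : ℝ≥0)⁻¹)

/-- The event that the Sharpe ratio sampled by one arm is larger than `y`. -/
def exceedSet (L₀ ρ y : ℝ) : Set (ℝ × ℝ) := {z | y < z.2 / (L₀ + ρ / z.1)}

theorem measurableSet_exceedSet (L₀ ρ y : ℝ) : MeasurableSet (exceedSet L₀ ρ y) :=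
  measurableSet_lt measurable_const (by fun_prop)

theorem le_mul_inv_sub_one {p q l : ℝ≥0∞} (hpq : p + q = 1) (hl : l ≠ 0) (hlp : l ≤ p) :
    q ≤ p * (l⁻¹ - 1) := by
  have hp0 : p ≠ 0 := fun h => hl (le_antisymm (h ▸ hlp) zero_le)
  have hp1 : p ≤ 1 := hpq ▸ le_self_add
  have hpt : p ≠ ∞ := (hp1.trans_lt ENNReal.one_lt_top).ne
  calc q = 1 - p := by rw [← hpq, ENNReal.add_sub_cancel_left hpt]
    _ = p * (p⁻¹ - 1) := by
      rw [ENNReal.mul_sub (fun _ _ => hpt), ENNReal.mul_inv_cancel hp0 hpt, mul_one]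
    _ ≤ _ := mul_le_mul_right (tsub_le_tsub_right (ENNReal.inv_le_inv.2 hlp) _) _

section Run

variable {Ω : Type*} [m0 : MeasurableSpace Ω] {P : Measure Ω} {K : ℕ} {μ : Fin K → ℝ}
  {v : Fin K → ℝ≥0} {L₀ ρ : ℝ} {X τ θ : Fin K → ℕ → Ω → ℝ} {A : ℕ → Ω → Fin K}

/-- Number of pulls, posterior mean and rate of arm `i` at the beginning of round `t`. -/
def runState (X : Fin K → ℕ → Ω → ℝ) (A : ℕ → Ω → Fin K) (i : Fin K) (t : ℕ) (ω : Ω) :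
    ℕ × ℝ × ℝ :=
  ((runParams X A i t ω).pulls, (runParams X A i t ω).mean, (runParams X A i t ω).rate)

theorem sampleLaw_runParams {Ω : Type*} {X : Fin K → ℕ → Ω → ℝ} {A : ℕ → Ω → Fin K} (i : Fin K)
    (t : ℕ) (ω : Ω) :
    (runParams X A i t ω).sampleLaw = stateLaw (runState X A i t ω) := by
  rw [PostParams.sampleLaw, stateLaw, runParams_shape]
  rfl

namespace IsSRTS

/-- The exchange argument. `B0` (no sample exceeds `y`) and `B1` (only that of `b` does) differ only
in the coordinate `b`. By conditional independence of the samples, the ratio of their conditional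
probabilities is `(1 - p) / p`, and `lo` is a lower bound for `p`. On `B1` the argmax can only be
`b`. -/
theorem prob_forall_le_le [IsProbabilityMeasure P] (h : IsSRTS P μ v L₀ ρ X τ θ A) {b : Fin K}
    {y : ℝ} {lo : ℕ × ℝ × ℝ → ℝ≥0∞} (hlo : Measurable lo)
    (hlo0 : ∀ s m r, 1 ≤ s → 1 / 2 ≤ r → lo (s, m, r) ≠ 0)
    (hlo1 : ∀ s m r, 1 ≤ s → 1 / 2 ≤ r → lo (s, m, r) ≤ stateLaw (s, m, r) (exceedSet L₀ ρ y))
    {t : ℕ} (ht : K ≤ t) :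
    P {ω | ∀ j, samples τ θ t ω j ∉ exceedSet L₀ ρ y}
      ≤ ∫⁻ ω in {ω | A t ω = b}, ((lo (runState X A b t ω))⁻¹ - 1) ∂P := by
  classical
  have hE := measurableSet_exceedSet L₀ ρ y
  set E := exceedSet L₀ ρ y with hEdef
  set B0 : Set (Fin K → ℝ × ℝ) := Set.univ.pi fun _ => Eᶜ with hB0
  set B1 : Set (Fin K → ℝ × ℝ) := Set.univ.pi fun j => if j = b then E else Eᶜ with hB1
  have hB0m : MeasurableSet B0 := MeasurableSet.univ_pi fun _ => hE.compl
  have hB1m : MeasurableSet B1 := MeasurableSet.univ_pi fun j => by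
    split_ifs
    · exact hE
    · exact hE.compl
  have hGm : Measurable[pastSigma X τ θ A t] fun ω => (lo (runState X A b t ω))⁻¹ - 1 :=
    ((hlo.comp (measurable_pastSigma_runParams t b)).inv).sub_const 1
  have e0 : {ω | ∀ j, samples τ θ t ω j ∉ E} = samples τ θ t ⁻¹' B0 := by
    ext ω; simp [hB0]
  have e1 : samples τ θ t ⁻¹' B1 ⊆ {ω | A t ω = b} := by
    intro ω hω
    by_contra hne
    have hne : A t ω ≠ b := hne
    have h1 : samples τ θ t ω b ∈ E := by simpa using hω b (mem_univ b)
    have h2 : samples τ θ t ω (A t ω) ∉ E := by simpa [hne] using hω (A t ω) (mem_univ _)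
    have h3 := h.arm_argmax t ht ω b
    simp only [samples, hEdef, exceedSet, mem_ofPred_eq] at h1 h2
    linarith
  have key : ∀ ω, roundLaw X A t ω B0 ≤
      roundLaw X A t ω B1 * ((lo (runState X A b t ω))⁻¹ - 1) := by
    intro ω
    have hprob : ∀ i, IsProbabilityMeasure (runParams X A i t ω).sampleLaw :=
      fun i => isProbabilityMeasure_sampleLaw i t ω
    rw [roundLaw, Measure.pi_pi, Measure.pi_pi, ← Finset.mul_prod_erase _ _ (Finset.mem_univ b),
      ← Finset.mul_prod_erase _ _ (Finset.mem_univ b), if_pos rfl]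
    have hprod : ∏ x ∈ Finset.univ.erase b, (runParams X A x t ω).sampleLaw
        (if x = b then E else Eᶜ) = ∏ x ∈ Finset.univ.erase b, (runParams X A x t ω).sampleLaw Eᶜ :=
      Finset.prod_congr rfl fun x hx => by rw [if_neg (Finset.ne_of_mem_erase hx)]
    rw [hprod, mul_right_comm]
    refine mul_le_mul_left (le_mul_inv_sub_one (prob_add_prob_compl hE) ?_ ?_) _
    · exact hlo0 _ _ _ (h.one_le_pulls b ht ω) (half_le_runParams_rate b t ω)
    · rw [sampleLaw_runParams]
      exact hlo1 _ _ _ (h.one_le_pulls b ht ω) (half_le_runParams_rate b t ω)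
  calc P {ω | ∀ j, samples τ θ t ω j ∉ E}
      = ∫⁻ ω, roundLaw X A t ω B0 ∂P := by
        have := h.lintegral_samples ht hB0m (G := fun _ => 1) measurable_const
        rw [e0]
        simpa using this
    _ ≤ ∫⁻ ω, roundLaw X A t ω B1 * ((lo (runState X A b t ω))⁻¹ - 1) ∂P := lintegral_mono key
    _ = ∫⁻ ω in samples τ θ t ⁻¹' B1, ((lo (runState X A b t ω))⁻¹ - 1) ∂P :=
        (h.lintegral_samples ht hB1m hGm).symm
    _ ≤ _ := lintegral_mono_set e1

/-- After the initial rounds the number of pulls lies between `1` and `t ≤ n`, so summing over its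
value `k + 1` loses nothing. -/
theorem lintegral_arm_le_sum_playMean [IsProbabilityMeasure P] (h : IsSRTS P μ v L₀ ρ X τ θ A)
    (i : Fin K) {G : ℕ × ℝ × ℝ → ℝ≥0∞} (hG : Measurable G) {t n : ℕ} (htK : K ≤ t) (ht : t ≤ n) :
    ∫⁻ ω in {ω | A t ω = i}, G (runState X A i t ω) ∂P
      ≤ ∑ k ∈ Finset.range n, playMean P X A i (k + 1) (fun q => G (k + 1, q)) t := by
  have hm := h.measurable_params i t
  have hle : pastSigma X τ θ A t ⊔ decisionSigma τ θ A t ≤ m0 :=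
    sup_le (h.pastSigma_le t) (h.decisionSigma_le t)
  unfold playMean
  rw [← lintegral_finsetSum]
  · have hAm : MeasurableSet {ω | A t ω = i} := h.measurable_arm t (measurableSet_singleton i)
    rw [← lintegral_indicator hAm]
    refine lintegral_mono fun ω => ?_
    by_cases hA : A t ω = i
    · rw [indicator_of_mem (by exact hA)]
      have h1 := h.one_le_pulls i htK ω
      have h2 : (runParams X A i t ω).pulls ≤ t := by
        rw [runParams_pulls]
        calc _ ≤ ∑ s ∈ Finset.range t, 1 := Finset.sum_le_sum fun s _ => by split_ifs <;> simp
          _ = t := by simp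
      obtain ⟨k, hk⟩ : ∃ k, (runParams X A i t ω).pulls = k + 1 := ⟨_, (Nat.sub_add_cancel h1).symm⟩
      refine le_trans (le_of_eq ?_) (Finset.single_le_sum (f := fun k =>
        (if A t ω = i ∧ (runParams X A i t ω).pulls = k + 1 then 1 else 0) *
        G (k + 1, (runParams X A i t ω).mean, (runParams X A i t ω).rate))
        (fun _ _ => zero_le) (Finset.mem_range.2 (show k < n by omega)))
      simp [hA, hk, runState]
    · rw [indicator_of_notMem (by exact hA)]
      exact zero_le
  · intro k _
    have hp : Measurable fun ω =>
        (if A t ω = i ∧ (runParams X A i t ω).pulls = k + 1 then 1 else 0 : ℝ≥0∞) :=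
      (measurable_play_indicator (τ := τ) (θ := θ) t i (k + 1)).mono hle le_rfl
    exact hp.mul (hG.comp (measurable_const.prodMk hm.snd))

/-- A play of `i` with a sample above `y` occurs at one of the first pulls, or with more than `L`
pulls in a good state, where the conditional probability is at most `r`, or in a bad state. The
first and last cases are kept as `playMean` so that they can be summed over the rounds. -/
theorem prob_arm_exceed_le [IsProbabilityMeasure P] (h : IsSRTS P μ v L₀ ρ X τ θ A) (i : Fin K)
    {y : ℝ} {L : ℕ} {r : ℝ≥0∞} {good : Set (ℕ × ℝ × ℝ)} (hgood : MeasurableSet good)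
    (hr : ∀ s m w, L < s → 1 / 2 ≤ w → (s, m, w) ∈ good →
      stateLaw (s, m, w) (exceedSet L₀ ρ y) ≤ r)
    {t n : ℕ} (htK : K ≤ t) (ht : t ≤ n) :
    P {ω | A t ω = i ∧ samples τ θ t ω i ∈ exceedSet L₀ ρ y} ≤
      ∑ k ∈ Finset.range L, playMean P X A i (k + 1) 1 t + r +
      ∑ k ∈ Finset.range n, playMean P X A i (k + 1)
        (fun q => goodᶜ.indicator 1 ((k + 1 : ℕ), q)) t := by
  have hE := measurableSet_exceedSet L₀ ρ y
  set E := exceedSet L₀ ρ y with hEdef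
  have hm := h.measurable_params i t
  have hAm : MeasurableSet {ω | A t ω = i} := h.measurable_arm t (measurableSet_singleton i)
  have hle : pastSigma X τ θ A t ⊔ decisionSigma τ θ A t ≤ m0 :=
    sup_le (h.pastSigma_le t) (h.decisionSigma_le t)
  set T : Set Ω := {ω | L < (runParams X A i t ω).pulls ∧ runState X A i t ω ∈ good} with hT
  have hTm : MeasurableSet[pastSigma X τ θ A t] T :=
    (measurable_pastSigma_runParams (X := X) (τ := τ) (θ := θ) (A := A) t i
      ((measurableSet_Ioi (a := L)).prod MeasurableSet.univ |>.inter hgood)) |> fun h => by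
        convert h using 1
        ext ω; simp [hT, runState]
  have sub : {ω | A t ω = i ∧ samples τ θ t ω i ∈ E} ⊆
      ({ω | A t ω = i ∧ (runParams X A i t ω).pulls ≤ L} ∪
        (T ∩ samples τ θ t ⁻¹' (Function.eval i ⁻¹' E))) ∪
        ({ω | A t ω = i} ∩ {ω | runState X A i t ω ∈ goodᶜ}) := by
    rintro ω ⟨h1, h2⟩
    by_cases hL : (runParams X A i t ω).pulls ≤ L
    · exact Or.inl (Or.inl ⟨h1, hL⟩)
    by_cases hg : runState X A i t ω ∈ good
    · exact Or.inl (Or.inr ⟨⟨not_le.1 hL, hg⟩, h2⟩)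
    · exact Or.inr ⟨h1, hg⟩
  refine (measure_mono sub).trans ((measure_union_le _ _).trans (add_le_add
    ((measure_union_le _ _).trans (add_le_add ?_ ?_)) ?_))
  · have hS : ∀ k, MeasurableSet {ω | A t ω = i ∧ (runParams X A i t ω).pulls = k + 1} :=
      fun k => hAm.inter (hm.fst (measurableSet_singleton (k + 1)))
    have e : ∀ k, playMean P X A i (k + 1) 1 t
        = P {ω | A t ω = i ∧ (runParams X A i t ω).pulls = k + 1} := by
      intro k
      rw [← lintegral_indicator_one (hS k), playMean]
      refine lintegral_congr fun ω => ?_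
      simp [indicator_apply]
    simp_rw [e]
    refine le_trans (measure_mono ?_) (measure_biUnion_finset_le _ _)
    rintro ω ⟨h1, h2⟩
    have h3 := h.one_le_pulls i htK ω
    simp only [mem_iUnion, Finset.mem_range]
    exact ⟨(runParams X A i t ω).pulls - 1, by omega, h1, by omega⟩
  · have hTm' := h.pastSigma_le t _ hTm
    have hev : MeasurableSet (Function.eval i ⁻¹' E : Set (Fin K → ℝ × ℝ)) :=
      measurable_pi_apply i hE
    have h1 := h.lintegral_samples htK hev (G := T.indicator 1)
      ((@measurable_const ℝ≥0∞ Ω _ (pastSigma X τ θ A t) 1).indicator hTm)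
    rw [lintegral_indicator_one hTm', Measure.restrict_apply hTm'] at h1
    rw [h1]
    calc ∫⁻ ω, roundLaw X A t ω (Function.eval i ⁻¹' E) * T.indicator 1 ω ∂P
        ≤ ∫⁻ _, r ∂P := by
          refine lintegral_mono fun ω => ?_
          by_cases hω : ω ∈ T
          · rw [indicator_of_mem hω, Pi.one_apply, mul_one]
            have hprob : ∀ i, IsProbabilityMeasure (runParams X A i t ω).sampleLaw :=
              fun i => isProbabilityMeasure_sampleLaw i t ω
            rw [roundLaw, (measurePreserving_eval (fun i => (runParams X A i t ω).sampleLaw)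
              i).measure_preimage hE.nullMeasurableSet, sampleLaw_runParams]
            exact hr _ _ _ hω.1 (half_le_runParams_rate i t ω) hω.2
          · simp [hω]
      _ = r := by simp
  · have h1 := h.lintegral_arm_le_sum_playMean i (G := goodᶜ.indicator 1)
      (measurable_one.indicator hgood.compl) htK ht
    refine le_trans (le_of_eq ?_) h1
    have hb : MeasurableSet {ω | runState X A i t ω ∈ goodᶜ} := hm hgood.compl
    have : (fun ω => goodᶜ.indicator (1 : ℕ × ℝ × ℝ → ℝ≥0∞) (runState X A i t ω))
        = {ω | runState X A i t ω ∈ goodᶜ}.indicator 1 := by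
      funext ω
      by_cases hω : runState X A i t ω ∈ goodᶜ
      · rw [indicator_of_mem hω, indicator_of_mem (by exact hω)]; rfl
      · rw [indicator_of_notMem hω, indicator_of_notMem (by exact hω)]
    rw [this, lintegral_indicator_one hb, Measure.restrict_apply hb, inter_comm]

/-- A bound on the expected number of pulls of a suboptimal arm. -/
theorem sum_prob_arm_le [IsProbabilityMeasure P] (h : IsSRTS P μ v L₀ ρ X τ θ A) (b i : Fin K)
    {y : ℝ} {lo : ℕ × ℝ × ℝ → ℝ≥0∞} (hlo : Measurable lo)
    (hlo0 : ∀ s m r, 1 ≤ s → 1 / 2 ≤ r → lo (s, m, r) ≠ 0)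
    (hlo1 : ∀ s m r, 1 ≤ s → 1 / 2 ≤ r → lo (s, m, r) ≤ stateLaw (s, m, r) (exceedSet L₀ ρ y))
    {L : ℕ} {r : ℝ≥0∞} {good : Set (ℕ × ℝ × ℝ)} (hgood : MeasurableSet good)
    (hr : ∀ s m w, L < s → 1 / 2 ≤ w → (s, m, w) ∈ good →
      stateLaw (s, m, w) (exceedSet L₀ ρ y) ≤ r) (n : ℕ) :
    ∑ t ∈ Finset.range n, P {ω | A t ω = i} ≤ 1 +
      ∑ k ∈ Finset.range n, ∫⁻ q, ((lo (k + 1, q.1, 1 / 2 + q.2 / 2))⁻¹ - 1)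
        ∂statLaw (μ b) (v b) k + (L + n * r) +
      ∑ k ∈ Finset.range n, ∫⁻ q, goodᶜ.indicator 1 ((k + 1 : ℕ), q.1, 1 / 2 + q.2 / 2)
        ∂statLaw (μ i) (v i) k := by
  have hlom : Measurable fun q => (lo q)⁻¹ - 1 := hlo.inv.sub_const 1
  -- Among the first `K` rounds arm `i` is played only in round `i`; this is the leading `1` of the
  -- bound.
  have step : ∀ t ∈ Finset.range n, P {ω | A t ω = i} ≤ (if t = (i : ℕ) then 1 else 0) +
      ∑ k ∈ Finset.range n, playMean P X A b (k + 1) (fun q => (lo (k + 1, q))⁻¹ - 1) t +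
      (∑ k ∈ Finset.range L, playMean P X A i (k + 1) 1 t + r) +
      ∑ k ∈ Finset.range n, playMean P X A i (k + 1)
        (fun q => goodᶜ.indicator 1 ((k + 1 : ℕ), q)) t := by
    intro t ht
    have ht := Finset.mem_range.1 ht
    rcases lt_or_ge t K with htK | htK
    · refine le_add_right (le_add_right (le_add_right ?_))
      split_ifs with hti
      · exact prob_le_one
      · have : {ω | A t ω = i} = ∅ := by
          ext ω
          simp only [mem_ofPred_eq, mem_empty_iff_false, iff_false, h.initial_rounds t htK ω]
          intro h1
          exact hti (by rw [← h1])
        rw [this, measure_empty]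
    · have sub : {ω | A t ω = i} ⊆ {ω | ∀ j, samples τ θ t ω j ∉ exceedSet L₀ ρ y} ∪
          {ω | A t ω = i ∧ samples τ θ t ω i ∈ exceedSet L₀ ρ y} := by
        intro ω hω
        have hω : A t ω = i := hω
        by_cases hi : samples τ θ t ω i ∈ exceedSet L₀ ρ y
        · exact Or.inr ⟨hω, hi⟩
        · refine Or.inl fun j hj => hi ?_
          have := h.arm_argmax t htK ω j
          rw [hω] at this
          simp only [samples, exceedSet, mem_ofPred_eq] at hj ⊢
          linarith
      rw [add_assoc (_ + _)]
      refine (measure_mono sub).trans ((measure_union_le _ _).trans (add_le_add ?_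
        (h.prob_arm_exceed_le i hgood hr htK ht.le)))
      exact le_add_left ((h.prob_forall_le_le (b := b) hlo hlo0 hlo1 htK).trans
        (h.lintegral_arm_le_sum_playMean b hlom htK ht.le))
  refine (Finset.sum_le_sum step).trans ?_
  simp only [Finset.sum_add_distrib]
  have hsnd : ∀ k : ℕ, Measurable fun q : ℝ × ℝ => (k + 1, q) := fun k => by fun_prop
  refine add_le_add (add_le_add (add_le_add ?_ ?_) (add_le_add ?_ ?_)) ?_
  · rw [Finset.sum_ite_eq']; split_ifs <;> simp
  · rw [Finset.sum_comm]
    exact Finset.sum_le_sum fun k _ => h.sum_playMean_le b k n (hlom.comp (hsnd k))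
  · rw [Finset.sum_comm]
    calc _ ≤ ∑ k ∈ Finset.range L, (1 : ℝ≥0∞) := Finset.sum_le_sum fun k _ =>
          (h.sum_playMean_le i k n measurable_one).trans (by simp)
      _ = L := by simp
  · simp
  · rw [Finset.sum_comm]
    exact Finset.sum_le_sum fun k _ =>
      h.sum_playMean_le i k n ((measurable_one.indicator hgood.compl).comp (hsnd k))

end IsSRTS

end Run

/-! ### Pulls of a suboptimal arm, given its sampling tail -/

theorem measurable_gaussianReal_Ioi (c : ℝ) (w : ℝ≥0) :
    Measurable fun m => gaussianReal m w (Ioi c) :=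
  (Measure.measurable_coe measurableSet_Ioi).comp
    (measurable_gaussianReal.comp (measurable_id.prodMk measurable_const))

theorem gaussianReal_Ioi_pos (m c : ℝ) {w : ℝ≥0} (hw : w ≠ 0) : 0 < gaussianReal m w (Ioi c) := by
  rw [pos_iff_ne_zero]
  intro h
  have := gaussianReal_absolutelyContinuous' m hw h
  simp at this

theorem gammaMeasure_Iic_zero (α β : ℝ) : gammaMeasure α β (Iic 0) = 0 := by
  rw [gammaMeasure, withDensity_apply _ measurableSet_Iic, setLIntegral_congr Iio_ae_eq_Iic.symm,
    lintegral_gammaPDF_of_nonpos le_rfl]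

/-- Separates the Gamma factor from the Gaussian factor, so that each term integrates as a product
over the independent statistics. -/
theorem inv_mul_sub_one_le {x y : ℝ≥0∞} (hx : x ≠ ∞) (hy : y ≠ ∞) :
    (x * y)⁻¹ - 1 ≤ (x⁻¹ - 1) + (y⁻¹ - 1) + (x⁻¹ - 1) * (y⁻¹ - 1) := by
  rw [tsub_le_iff_right, ENNReal.mul_inv (Or.inr hy) (Or.inl hx)]
  calc x⁻¹ * y⁻¹ ≤ ((x⁻¹ - 1) + 1) * ((y⁻¹ - 1) + 1) := by gcongr <;> exact le_tsub_add
    _ = _ := by ring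

theorem sumSqLaw_Iio_le {v : ℝ≥0} (hv : 0 < v) {c : ℝ} (hc : 0 < c) (hcv : c < v) (k : ℕ) :
    sumSqLaw v k (Iio (c * (k + 2)))
      ≤ ENNReal.ofReal (exp (1 - c / v) * exp (-(rateFun (c / v) * k))) := by
  have hv' : (0 : ℝ) < v := hv
  have hx : 0 < c / v := by positivity
  -- Chosen so that `1 - 2 l v = v / c`; the exponent then becomes the rate function at `c / v`, and
  -- the shift from `k` to `k + 2` contributes only the factor `exp (1 - c / v)`.
  set l : ℝ := -(v / c - 1) / (2 * v) with hl
  have hl0 : l ≤ 0 := by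
    rw [hl]
    refine div_nonpos_of_nonpos_of_nonneg ?_ (by positivity)
    have : 1 < v / c := by rw [lt_div_iff₀ hc]; linarith
    linarith
  have h1 : 1 - 2 * l * v = (c / v)⁻¹ := by rw [hl]; field_simp; ring
  have hlv : 2 * l * v < 1 := by
    have : 0 < (c / v)⁻¹ := by positivity
    linarith
  refine (measure_le_lintegral_exp measurableSet_Iio l (c * (k + 2)) fun x hx =>
    mul_nonneg_of_nonpos_of_nonpos hl0 (sub_nonpos.2 (le_of_lt hx))).trans ?_
  rw [lintegral_exp_mul_sumSqLaw hv hlv, ← ENNReal.ofReal_mul (exp_pos _).le, h1]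
  refine ENNReal.ofReal_le_ofReal (le_of_eq ?_)
  rw [inv_rpow hx.le, rpow_neg hx.le, inv_inv, rpow_def_of_pos hx, ← exp_add, ← exp_add]
  congr 1
  rw [rateFun, hl]
  field_simp
  ring

theorem sum_gaussianReal_mean_Ioi_le (m : ℝ) {v : ℝ≥0} (hv : 0 < v) {δ : ℝ} (hδ : 0 < δ) (n : ℕ) :
    ∑ k ∈ Finset.range n, gaussianReal m (v / ((k + 1 : ℕ) : ℝ≥0)) (Ioi (m + δ))
      ≤ ENNReal.ofReal (2 * v / δ ^ 2) := by
  have hv' : (0 : ℝ) < v := hv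
  have h1 : ∀ k : ℕ, gaussianReal m (v / ((k + 1 : ℕ) : ℝ≥0)) (Ioi (m + δ))
      ≤ ENNReal.ofReal (exp (-(δ ^ 2 / (2 * v) * (k + 1)))) := by
    intro k
    refine (measure_mono Ioi_subset_Ici_self).trans
      ((gaussianReal_Ici_le m (by positivity) hδ.le).trans (ENNReal.ofReal_le_ofReal
        (exp_le_exp.2 (le_of_eq ?_))))
    push_cast
    field_simp
  refine (Finset.sum_le_sum fun k _ => h1 k).trans ?_
  rw [← ENNReal.ofReal_sum_of_nonneg fun k _ => (exp_pos _).le]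
  refine ENNReal.ofReal_le_ofReal ((sum_exp_neg_le (by positivity) n).trans (le_of_eq ?_))
  field_simp

theorem gaussianReal_sample_Ici_le {m c a : ℝ} {s : ℕ} (hs : 1 ≤ s) (ha : 0 ≤ a) (hm : m + a ≤ c) :
    gaussianReal m (s : ℝ≥0)⁻¹ (Ici c) ≤ ENNReal.ofReal (exp (-(a ^ 2 / 2 * s))) := by
  have hs' : (0 : ℝ≥0) < s := by exact_mod_cast hs
  refine (measure_mono (Ici_subset_Ici.2 hm)).trans ((gaussianReal_Ici_le m (by positivity)
    ha).trans (ENNReal.ofReal_le_ofReal (exp_le_exp.2 (le_of_eq ?_))))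
  push_cast
  have : (0 : ℝ) < s := by exact_mod_cast hs'
  field_simp

/-- A uniform bound on the number of pulls of a suboptimal arm that is needed to rule it out. -/
theorem ceil_add_mul_exp_le {c C₀ : ℝ} (hc : 0 < c) (hC₀ : 0 ≤ C₀) {n : ℕ} (hn : 1 ≤ n) :
    ((⌈log n / c⌉₊ : ℝ≥0∞) + n * ENNReal.ofReal (C₀ * exp (-(c * ⌈log n / c⌉₊))))
      ≤ ENNReal.ofReal (log n / c + 1 + C₀) := by
  have hn0 : (0 : ℝ) < n := by exact_mod_cast hn
  have hlog : 0 ≤ log n := log_nonneg (by exact_mod_cast hn)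
  have h1 : (⌈log n / c⌉₊ : ℝ) ≤ log n / c + 1 := (Nat.ceil_lt_add_one (by positivity)).le
  have h2 : log n ≤ c * ⌈log n / c⌉₊ := by
    have := Nat.le_ceil (log n / c)
    rw [div_le_iff₀ hc] at this
    linarith
  have h3 : n * (C₀ * exp (-(c * ⌈log n / c⌉₊))) ≤ C₀ := by
    have : exp (-(c * ⌈log n / c⌉₊)) ≤ (n : ℝ)⁻¹ := by
      rw [← exp_log hn0, ← exp_neg, exp_le_exp, exp_log hn0]; linarith
    calc _ ≤ n * (C₀ * (n : ℝ)⁻¹) := by gcongr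
      _ = C₀ := by field_simp
  rw [← ENNReal.ofReal_natCast, ← ENNReal.ofReal_natCast n, ← ENNReal.ofReal_mul hn0.le,
    ← ENNReal.ofReal_add (by positivity) (by positivity)]
  exact ENNReal.ofReal_le_ofReal (by linarith)

/-- The posterior of the best arm is optimistic often enough. -/
theorem exists_sum_lintegral_optimism_le {m : ℝ} {v : ℝ≥0} (hv : 0 < v) (hv1 : v ≤ 1) {ε u : ℝ}
    (hε : 0 < ε) (hε1 : ε ≤ 1) (hu : 0 < u) (hvu : v * u < 1) :
    ∃ C : ℝ, 0 ≤ C ∧ ∀ n : ℕ, ∑ k ∈ Finset.range n,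
      ∫⁻ q, ((gammaMeasure ((((k + 1 : ℕ) : ℝ) + 1) / 2) (1 / 2 + q.2 / 2) (Ici u) *
        gaussianReal q.1 (((k + 1 : ℕ) : ℝ≥0)⁻¹) (Ioi (m - ε)))⁻¹ - 1) ∂statLaw m v k
      ≤ ENNReal.ofReal C := by
  obtain ⟨C₁, hC₁, h₁⟩ := exists_sum_lintegral_inv_gammaMeasure_le hv hu hvu
  obtain ⟨C₂, hC₂, h₂⟩ := exists_sum_lintegral_inv_gaussianReal_le hv hv1
  refine ⟨C₁ + C₂ / ε ^ 3 + C₁ * (C₂ / ε ^ 3), by positivity, fun n => ?_⟩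
  set F : ℕ → ℝ → ℝ≥0∞ := fun k S =>
    (gammaMeasure (((k : ℝ) + 2) / 2) (1 / 2 + S / 2) (Ici u))⁻¹ - 1 with hF
  set G : ℕ → ℝ → ℝ≥0∞ := fun k x =>
    (gaussianReal x (((k + 1 : ℕ) : ℝ≥0)⁻¹) (Ioi (m - ε)))⁻¹ - 1 with hG
  have hFm : ∀ k, Measurable (F k) := fun k =>
    (((measurable_gammaMeasure_Ici _ u).comp (by fun_prop : Measurable fun S : ℝ =>
      1 / 2 + S / 2)).inv).sub_const 1
  have hGm : ∀ k, Measurable (G k) := fun k =>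
    ((measurable_gaussianReal_Ioi (m - ε) _).inv).sub_const 1
  set f : ℕ → ℝ≥0∞ := fun k => ∫⁻ S, F k S ∂sumSqLaw v k with hf
  set g : ℕ → ℝ≥0∞ := fun k => ∫⁻ x, G k x ∂gaussianReal m (v / ((k + 1 : ℕ) : ℝ≥0)) with hg
  have step : ∀ k, ∫⁻ q, ((gammaMeasure ((((k + 1 : ℕ) : ℝ) + 1) / 2) (1 / 2 + q.2 / 2) (Ici u) *
        gaussianReal q.1 (((k + 1 : ℕ) : ℝ≥0)⁻¹) (Ioi (m - ε)))⁻¹ - 1) ∂statLaw m v k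
        ≤ f k + g k + f k * g k := by
    intro k
    have e : (((k + 1 : ℕ) : ℝ) + 1) / 2 = ((k : ℝ) + 2) / 2 := by push_cast; ring
    rw [e]
    have hnn : ∀ᵐ q ∂statLaw m v k, 0 ≤ q.2 := by
      have := (Measure.quasiMeasurePreserving_snd
        (μ := gaussianReal m (v / ((k + 1 : ℕ) : ℝ≥0))) (ν := sumSqLaw v k)).ae
        (ae_sumSqLaw_nonneg v k)
      exact this
    calc _ ≤ ∫⁻ q, (F k q.2 + G k q.1 + F k q.2 * G k q.1) ∂statLaw m v k := by
          refine lintegral_mono_ae ?_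
          filter_upwards [hnn] with q hq
          have := isProbabilityMeasure_gammaMeasure (show 0 < ((k : ℝ) + 2) / 2 by positivity)
            (show 0 < 1 / 2 + q.2 / 2 by linarith)
          exact inv_mul_sub_one_le (measure_ne_top _ _) (measure_ne_top _ _)
      _ = f k + g k + f k * g k := by
          have hF2 : Measurable fun q : ℝ × ℝ => F k q.2 := (hFm k).comp measurable_snd
          have hG1 : Measurable fun q : ℝ × ℝ => G k q.1 := (hGm k).comp measurable_fst
          have hFG : Measurable fun q : ℝ × ℝ => F k q.2 + G k q.1 := hF2.add hG1
          rw [lintegral_add_left hFG, lintegral_add_left hF2, statLaw]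
          congr 1
          · congr 1
            · rw [lintegral_prod_symm _ hF2.aemeasurable]
              simp [hf]
            · rw [lintegral_prod _ hG1.aemeasurable]
              simp [hg]
          · simp_rw [mul_comm (F k _)]
            rw [lintegral_prod_mul (hGm k).aemeasurable (hFm k).aemeasurable, mul_comm]
  refine (Finset.sum_le_sum fun k _ => step k).trans ?_
  rw [Finset.sum_add_distrib, Finset.sum_add_distrib, ENNReal.ofReal_add (by positivity)
    (by positivity), ENNReal.ofReal_add (by positivity) (by positivity), ENNReal.ofReal_mul hC₁]
  have hs1 := h₁ n
  have hs2 := h₂ m ε hε hε1 n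
  refine add_le_add (add_le_add hs1 hs2) ?_
  -- For nonnegative terms the sum of products is at most the product of the sums, so no joint decay
  -- of `f` and `g` is needed.
  calc ∑ k ∈ Finset.range n, f k * g k
      ≤ ∑ k ∈ Finset.range n, f k * ∑ j ∈ Finset.range n, g j := by
        refine Finset.sum_le_sum fun k hk => mul_le_mul_right ?_ _
        exact Finset.single_le_sum (f := g) (fun _ _ => zero_le) hk
    _ = (∑ k ∈ Finset.range n, f k) * ∑ j ∈ Finset.range n, g j := by rw [Finset.sum_mul]
    _ ≤ _ := mul_le_mul' hs1 hs2

/-! ### Logarithmic bounds on the pulls of a suboptimal arm -/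

section Exceed

variable {L₀ ρ y : ℝ}

/-- For `y ≥ 0`, a larger precision lowers the mean needed to reach level `y`. A precision of at
least `u` together with a mean above `y (L₀ + ρ / u)` is therefore enough. -/
theorem le_stateLaw_exceedSet (hL₀ : 0 < L₀) (hρ : 0 ≤ ρ) (hy : 0 ≤ y) {u c : ℝ} (hu : 0 < u)
    (hc : y * (L₀ + ρ / u) ≤ c) (q : ℕ × ℝ × ℝ) :
    gammaMeasure (((q.1 : ℝ) + 1) / 2) q.2.2 (Ici u) * gaussianReal q.2.1 (q.1 : ℝ≥0)⁻¹ (Ioi c)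
      ≤ stateLaw q (exceedSet L₀ ρ y) := by
  have hsub : Ici u ×ˢ Ioi c ⊆ exceedSet L₀ ρ y := by
    rintro ⟨x, z⟩ ⟨hx, hz⟩
    have hx : u ≤ x := hx
    have hz : c < z := hz
    have hx0 : 0 < x := hu.trans_le hx
    change y < z / (L₀ + ρ / x)
    rw [lt_div_iff₀ (by positivity)]
    have : ρ / x ≤ ρ / u := div_le_div_of_nonneg_left hρ hu hx
    nlinarith
  refine le_trans ?_ (measure_mono hsub)
  rw [stateLaw]
  exact (le_of_eq (Measure.prod_prod _ _).symm)

/-- To exceed `y`, an arm must sample a large precision or a large mean. Nonpositive precisions form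
a null set and are removed separately. -/
theorem stateLaw_exceedSet_le (hL₀ : 0 < L₀) (hρ : 0 ≤ ρ) (hy : 0 ≤ y) {u c : ℝ}
    (hc : c ≤ y * (L₀ + ρ / u)) {q : ℕ × ℝ × ℝ} (hq : 0 < q.2.2) :
    stateLaw q (exceedSet L₀ ρ y) ≤ gammaMeasure (((q.1 : ℝ) + 1) / 2) q.2.2 (Ici u) +
      gaussianReal q.2.1 (q.1 : ℝ≥0)⁻¹ (Ici c) := by
  have := isProbabilityMeasure_gammaMeasure (show 0 < ((q.1 : ℝ) + 1) / 2 by positivity) hq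
  have hsub : exceedSet L₀ ρ y ⊆ (Ici u ×ˢ univ ∪ univ ×ˢ Ici c) ∪ Iic 0 ×ˢ univ := by
    rintro ⟨x, z⟩ hxz
    have hxz : y < z / (L₀ + ρ / x) := hxz
    by_contra hcon
    simp only [mem_union, mem_prod, mem_Ici, mem_univ, and_true, true_and, mem_Iic, not_or,
      not_le] at hcon
    obtain ⟨⟨h1, h2⟩, h3⟩ := hcon
    rw [lt_div_iff₀ (by positivity)] at hxz
    have : ρ / u ≤ ρ / x := div_le_div_of_nonneg_left hρ h3 h1.le
    nlinarith
  refine (measure_mono hsub).trans ((measure_union_le _ _).trans ?_)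
  rw [stateLaw, Measure.prod_prod, gammaMeasure_Iic_zero, zero_mul, add_zero]
  refine (measure_union_le _ _).trans (le_of_eq ?_)
  rw [Measure.prod_prod, Measure.prod_prod, measure_univ, measure_univ, mul_one, one_mul]

theorem le_stateLaw_exceedSet_zero (hL₀ : 0 < L₀) {c : ℝ} (hc : y * L₀ ≤ c) {q : ℕ × ℝ × ℝ}
    (hq : 0 < q.2.2) :
    gaussianReal q.2.1 (q.1 : ℝ≥0)⁻¹ (Ioi c) ≤ stateLaw q (exceedSet L₀ 0 y) := by
  have := isProbabilityMeasure_gammaMeasure (show 0 < ((q.1 : ℝ) + 1) / 2 by positivity) hq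
  have hsub : univ ×ˢ Ioi c ⊆ exceedSet L₀ 0 y := by
    rintro ⟨x, z⟩ ⟨-, hz⟩
    have hz : c < z := hz
    change y < z / (L₀ + 0 / x)
    rw [zero_div, add_zero, lt_div_iff₀ hL₀]
    linarith
  refine le_trans (le_of_eq ?_) (measure_mono hsub)
  rw [stateLaw, Measure.prod_prod, measure_univ, one_mul]

theorem stateLaw_exceedSet_zero_le (hL₀ : 0 < L₀) {c : ℝ} (hc : c ≤ y * L₀) {q : ℕ × ℝ × ℝ}
    (hq : 0 < q.2.2) :
    stateLaw q (exceedSet L₀ 0 y) ≤ gaussianReal q.2.1 (q.1 : ℝ≥0)⁻¹ (Ici c) := by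
  have := isProbabilityMeasure_gammaMeasure (show 0 < ((q.1 : ℝ) + 1) / 2 by positivity) hq
  have hsub : exceedSet L₀ 0 y ⊆ univ ×ˢ Ici c := by
    rintro ⟨x, z⟩ hxz
    have hxz : y < z / (L₀ + 0 / x) := hxz
    rw [zero_div, add_zero, lt_div_iff₀ hL₀] at hxz
    exact ⟨mem_univ _, show c ≤ z by linarith⟩
  refine (measure_mono hsub).trans (le_of_eq ?_)
  rw [stateLaw, Measure.prod_prod, measure_univ, one_mul]

end Exceed

theorem exists_sum_sumSqLaw_Iio_le {v : ℝ≥0} (hv : 0 < v) {c : ℝ} (hc : 0 < c) (hcv : c < v) :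
    ∃ C : ℝ, 0 ≤ C ∧ ∀ n : ℕ, ∑ k ∈ Finset.range n, sumSqLaw v k (Iio (c * (k + 2)))
      ≤ ENNReal.ofReal C := by
  have hv' : (0 : ℝ) < v := hv
  have hr := rateFun_pos (show 0 < c / v by positivity)
    (by rw [Ne, div_eq_one_iff_eq hv'.ne']; exact hcv.ne)
  have hs : Summable fun k : ℕ => exp (1 - c / v) * exp (-(rateFun (c / v) * k)) :=
    Summable.mul_left _ (by simpa [neg_mul] using Real.summable_pow_mul_exp_neg_nat_mul 0 hr)
  refine ⟨∑' k : ℕ, exp (1 - c / v) * exp (-(rateFun (c / v) * k)),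
    tsum_nonneg fun k => by positivity, fun n =>
    (Finset.sum_le_sum fun k _ => sumSqLaw_Iio_le hv hc hcv k).trans ?_⟩
  rw [← ENNReal.ofReal_sum_of_nonneg fun k _ => by positivity]
  exact ENNReal.ofReal_le_ofReal (hs.sum_le_tsum _ fun k _ => by positivity)

theorem exists_one_le_mul_log (a : ℝ) : ∃ C : ℝ, 0 ≤ C ∧ ∀ n : ℕ, 2 ≤ n → a ≤ C * log n := by
  have h2 : 0 < log 2 := log_pos (by norm_num)
  refine ⟨|a| / log 2, by positivity, fun n hn => ?_⟩
  have : log 2 ≤ log n := log_le_log (by norm_num) (by exact_mod_cast hn)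
  calc a ≤ |a| := le_abs_self a
    _ = |a| / log 2 * log 2 := by field_simp
    _ ≤ _ := by gcongr

theorem measurable_gaussianReal_state_Ioi (c : ℝ) :
    Measurable fun q : ℕ × ℝ × ℝ => gaussianReal q.2.1 (q.1 : ℝ≥0)⁻¹ (Ioi c) :=
  measurable_from_prod_countable_right fun s =>
    (measurable_gaussianReal_Ioi c (s : ℝ≥0)⁻¹).comp measurable_fst

theorem measurable_gammaMeasure_state_Ici (u : ℝ) :
    Measurable fun q : ℕ × ℝ × ℝ => gammaMeasure (((q.1 : ℝ) + 1) / 2) q.2.2 (Ici u) :=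
  measurable_from_prod_countable_right fun s =>
    (measurable_gammaMeasure_Ici (((s : ℝ) + 1) / 2) u).comp measurable_snd

/-- A suboptimal arm with many pulls seldom samples a large Sharpe ratio. -/
theorem exists_good_states {m : ℝ} {v : ℝ≥0} (hv : 0 < v) {L₀ ρ y : ℝ} (hL₀ : 0 < L₀)
    (hρ : 0 ≤ ρ) (hy0 : 0 < y) (hyi : m < y * (L₀ + ρ * v)) :
    ∃ (e C : ℝ) (good : Set (ℕ × ℝ × ℝ)), 0 < e ∧ 0 ≤ C ∧ MeasurableSet good ∧
      (∀ (L s : ℕ) (x r : ℝ), L < s → 1 / 2 ≤ r → (s, x, r) ∈ good →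
        stateLaw (s, x, r) (exceedSet L₀ ρ y) ≤ ENNReal.ofReal (2 * exp (-(e * L)))) ∧
      ∀ n : ℕ, ∑ k ∈ Finset.range n,
        ∫⁻ q, goodᶜ.indicator 1 ((k + 1 : ℕ), q.1, 1 / 2 + q.2 / 2) ∂statLaw m v k
        ≤ ENNReal.ofReal C := by
  have hvi0 : (0 : ℝ) < v := hv
  have hyρ : 0 ≤ y * ρ := by positivity
  set g' := y * (L₀ + ρ * v) - m with hg'
  have hg'0 : 0 < g' := by rw [hg']; linarith
  -- The gap `g'` is divided: lowering the variance from `v` to `w = v - d` costs at most half of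
  -- it, and the remaining half is `2 δ`, one `δ` for the error of the empirical mean and one for
  -- the sampled mean. The bound `v / 2` keeps `w` positive.
  set d : ℝ := min (v / 2) (g' / (2 * (y * ρ + 1))) with hd
  have hd0 : 0 < d := lt_min (by positivity) (by positivity)
  have hdv : d ≤ v / 2 := min_le_left _ _
  have hdg : y * ρ * d ≤ g' / 2 := by
    have : d ≤ g' / (2 * (y * ρ + 1)) := min_le_right _ _
    rw [le_div_iff₀ (by positivity)] at this
    nlinarith
  set w := v - d with hw
  have hw0 : 0 < w := by rw [hw]; linarith
  have hwv : w < v := by rw [hw]; linarith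
  -- In a good state the rate is at least `c` times the shape. Since `c < v`, bad states are
  -- summably rare; since `c > w`, sampling a precision above `1 / w` is a large deviation with
  -- ratio `κ = c / w > 1`.
  obtain ⟨c, hc1, hc2⟩ := exists_between hwv
  have hc0 : 0 < c := hw0.trans hc1
  set δ : ℝ := g' / 4 with hδ
  have hδ0 : 0 < δ := by positivity
  have hci : m + 2 * δ ≤ y * (L₀ + ρ / (1 / w)) := by
    rw [div_div_eq_mul_div, div_one, hw, hδ]
    nlinarith
  set κ := c / w with hκ
  have hκ1 : 1 < κ := by rw [hκ, lt_div_iff₀ hw0]; linarith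
  have hκ0 : 0 < rateFun κ := rateFun_pos (by linarith) hκ1.ne'
  obtain ⟨C₂, hC₂, h₂⟩ := exists_sum_sumSqLaw_Iio_le (hv) hc0 hc2
  set e : ℝ := min (δ ^ 2 / 2) (rateFun κ) with he
  have he0 : 0 < e := lt_min (by positivity) hκ0
  set good : Set (ℕ × ℝ × ℝ) :=
    {q | q.2.1 ≤ m + δ ∧ c * (((q.1 : ℝ) + 1) / 2) ≤ q.2.2} with hgood
  have hfst : Measurable fun q : ℕ × ℝ × ℝ => (q.1 : ℝ) := measurable_from_nat.comp measurable_fst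
  have hgoodm : MeasurableSet good :=
    (measurableSet_le measurable_snd.fst measurable_const).inter
      (measurableSet_le (((hfst.add_const 1).div_const 2).const_mul c) measurable_snd.snd)
  have hr : ∀ (L s : ℕ) (x r : ℝ), L < s → 1 / 2 ≤ r → (s, x, r) ∈ good →
      stateLaw (s, x, r) (exceedSet L₀ ρ y) ≤ ENNReal.ofReal (2 * exp (-(e * L))) := by
    intro L s x r hLs hr hq
    have hq1 : x ≤ m + δ := hq.1
    have hq2 : c * (((s : ℝ) + 1) / 2) ≤ r := hq.2
    have hs1 : (1 : ℝ) ≤ s := by exact_mod_cast (by omega : 1 ≤ s)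
    have hLs' : (L : ℝ) ≤ s := by exact_mod_cast hLs.le
    refine (stateLaw_exceedSet_le hL₀ hρ hy0.le hci
      (show 0 < r by linarith)).trans ?_
    rw [two_mul (exp _), ENNReal.ofReal_add (exp_pos _).le (exp_pos _).le]
    refine add_le_add ?_ ?_
    · refine (gammaMeasure_Ici_le (κ := κ) (by positivity) (by linarith) hκ1.le ?_).trans
        (ENNReal.ofReal_le_ofReal (exp_le_exp.2 ?_))
      · rw [hκ, mul_one_div, div_mul_eq_mul_div]
        exact div_le_div_of_nonneg_right hq2 hw0.le
      · have : e ≤ rateFun κ := min_le_right _ _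
        have h0 : (0 : ℝ) ≤ L := Nat.cast_nonneg L
        nlinarith
    · refine (gaussianReal_sample_Ici_le (a := δ) (by omega) hδ0.le (by linarith)).trans
        (ENNReal.ofReal_le_ofReal (exp_le_exp.2 ?_))
      have : e ≤ δ ^ 2 / 2 := min_le_left _ _
      have h0 : (0 : ℝ) ≤ L := Nat.cast_nonneg L
      nlinarith
  have hbad : ∀ n : ℕ, ∑ k ∈ Finset.range n,
      ∫⁻ q, goodᶜ.indicator 1 ((k + 1 : ℕ), q.1, 1 / 2 + q.2 / 2) ∂statLaw (m) (v) k
      ≤ ENNReal.ofReal (2 * v / δ ^ 2 + C₂) := by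
    intro n
    rw [ENNReal.ofReal_add (by positivity) hC₂]
    refine le_trans ?_ (add_le_add (sum_gaussianReal_mean_Ioi_le (m) (hv) hδ0 n) (h₂ n))
    rw [← Finset.sum_add_distrib]
    refine Finset.sum_le_sum fun k _ => ?_
    have hm : Measurable fun q : ℝ × ℝ => (((k + 1 : ℕ), q.1, 1 / 2 + q.2 / 2) : ℕ × ℝ × ℝ) := by
      fun_prop
    have e1 : (fun q : ℝ × ℝ => goodᶜ.indicator (1 : ℕ × ℝ × ℝ → ℝ≥0∞)
        ((k + 1 : ℕ), q.1, 1 / 2 + q.2 / 2)) =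
        ((fun q : ℝ × ℝ => (((k + 1 : ℕ), q.1, 1 / 2 + q.2 / 2) : ℕ × ℝ × ℝ)) ⁻¹' goodᶜ).indicator
          1 := rfl
    rw [e1, lintegral_indicator_one (hm hgoodm.compl)]
    refine (measure_mono (t := (Ioi (m + δ) ×ˢ univ) ∪ (univ ×ˢ Iio (c * (k + 2)))) ?_).trans
      ((measure_union_le _ _).trans (le_of_eq ?_))
    · rintro ⟨x, S⟩ hx
      by_contra hcon
      simp only [mem_union, mem_prod, mem_Ioi, mem_univ, and_true, true_and, mem_Iio, not_or,
        not_lt] at hcon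
      refine hx ⟨hcon.1, ?_⟩
      change c * ((((k + 1 : ℕ) : ℝ) + 1) / 2) ≤ 1 / 2 + S / 2
      push_cast
      linarith [hcon.2]
    · rw [statLaw, Measure.prod_prod, Measure.prod_prod, measure_univ, measure_univ, mul_one,
        one_mul]
  exact ⟨e, 2 * v / δ ^ 2 + C₂, good, he0, by positivity, hgoodm, hr, hbad⟩

/-- A suboptimal arm is pulled `O(log n)` times. -/
theorem exists_sum_prob_arm_le_log {K : ℕ} (μ : Fin K → ℝ) (v : Fin K → ℝ≥0)
    (hv : ∀ i, 0 < v i) (L₀ ρ : ℝ) (hL₀ : 0 < L₀) (hρ : 0 ≤ ρ) (b i : Fin K)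
    (hi : sharpe L₀ ρ (μ i) (v i) < sharpe L₀ ρ (μ b) (v b))
    (hξ : 0 < sharpe L₀ ρ (μ b) (v b)) (hvb : v b ≤ 1) :
    ∃ C : ℝ, 0 ≤ C ∧ ∀ (Ω : Type w) [MeasurableSpace Ω] (P : Measure Ω) [IsProbabilityMeasure P]
      (X τ θ : Fin K → ℕ → Ω → ℝ) (A : ℕ → Ω → Fin K), IsSRTS P μ v L₀ ρ X τ θ A →
      ∀ n : ℕ, 2 ≤ n →
        ∑ t ∈ Finset.range n, P {ω | A t ω = i} ≤ ENNReal.ofReal (C * log n) := by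
  have hvb0 : (0 : ℝ) < v b := hv b
  -- The level must also be positive, so that `y (L₀ + ρ / τ)` is monotone in the sampled precision.
  obtain ⟨y, hy1, hy2⟩ := exists_between (max_lt hi hξ)
  have hy0 : 0 < y := (le_max_right _ _).trans_lt hy1
  have hyi : μ i < y * (L₀ + ρ * v i) := by
    have := (le_max_left _ _).trans_lt hy1
    rwa [sharpe, div_lt_iff₀ (by positivity)] at this
  have hyb : y * (L₀ + ρ * v b) < μ b := by
    rwa [sharpe, lt_div_iff₀ (by positivity)] at hy2
  have hyρ : 0 ≤ y * ρ := by positivity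
  set g := μ b - y * (L₀ + ρ * v b) with hg
  have hg0 : 0 < g := by rw [hg]; linarith
  -- A slightly inflated variance: `1 / D` is a precision level strictly below the true `1 / v b`,
  -- as summability requires, at the cost of at most a quarter of the gap `g`.
  set D : ℝ := v b + g / (4 * (y * ρ + 1)) with hD
  have hDv : (v b : ℝ) < D := by
    have : 0 < g / (4 * (y * ρ + 1)) := by positivity
    linarith
  have hD0 : 0 < D := hvb0.trans hDv
  have hDg : y * ρ * (D - v b) ≤ g / 4 := by
    rw [hD, add_sub_cancel_left, mul_div_assoc', div_le_iff₀ (by positivity)]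
    nlinarith
  set ε : ℝ := min 1 (g / 4) with hε
  have hε0 : 0 < ε := lt_min one_pos (by positivity)
  have hεg : ε ≤ g / 4 := min_le_right _ _
  have hcb : y * (L₀ + ρ / (1 / D)) ≤ μ b - ε := by
    rw [div_div_eq_mul_div, div_one]
    nlinarith
  obtain ⟨C₁, hC₁, h₁⟩ := exists_sum_lintegral_optimism_le (m := μ b) (hv b) hvb hε0
    (min_le_left _ _) (show 0 < 1 / D by positivity)
    (by rw [mul_one_div, div_lt_one hD0]; exact hDv)
  obtain ⟨e, C₂, good, he0, hC₂, hgoodm, hr, hbad⟩ := exists_good_states (hv i) hL₀ hρ hy0 hyi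
  obtain ⟨C₃, hC₃, h₃⟩ := exists_one_le_mul_log (1 + C₁ + (1 + 2) + C₂)
  refine ⟨1 / e + C₃, by positivity, ?_⟩
  intro Ω _ P _ X τ θ A h n hn
  set lo : ℕ × ℝ × ℝ → ℝ≥0∞ := fun q => gammaMeasure (((q.1 : ℝ) + 1) / 2) q.2.2 (Ici (1 / D)) *
    gaussianReal q.2.1 (q.1 : ℝ≥0)⁻¹ (Ioi (μ b - ε)) with hlo
  have hlom : Measurable lo :=
    (measurable_gammaMeasure_state_Ici (1 / D)).mul (measurable_gaussianReal_state_Ioi (μ b - ε))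
  have main := h.sum_prob_arm_le b i hlom
    (fun s m r hs hr => mul_ne_zero
      (gammaMeasure_Ici_pos (by
        have : (1 : ℝ) ≤ s := by exact_mod_cast hs
        change 1 ≤ ((s : ℝ) + 1) / 2
        linarith) (show 0 < r by linarith) (by positivity)).ne'
      (gaussianReal_Ioi_pos _ _ (by
        have : (0 : ℝ≥0) < s := by exact_mod_cast hs
        exact (inv_pos.2 this).ne')).ne')
    (fun s m r _ _ => le_stateLaw_exceedSet hL₀ hρ hy0.le (by positivity) hcb _)
    hgoodm (hr ⌈log n / e⌉₊) n
  refine main.trans ?_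
  refine (add_le_add (add_le_add (add_le_add le_rfl (h₁ n))
    (ceil_add_mul_exp_le he0 zero_le_two (by omega : 1 ≤ n))) (hbad n)).trans ?_
  have hlog : 0 ≤ log n := log_nonneg (by exact_mod_cast (by omega : 1 ≤ n))
  rw [← ENNReal.ofReal_one, ← ENNReal.ofReal_add zero_le_one hC₁,
    ← ENNReal.ofReal_add (by positivity) (by positivity),
    ← ENNReal.ofReal_add (by positivity) (by positivity)]
  refine ENNReal.ofReal_le_ofReal ?_
  have := h₃ n hn
  have e2 : (1 / e + C₃) * log n = log n / e + C₃ * log n := by ring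
  rw [e2]
  linarith

/-- Without the variance term, the number of pulls of a suboptimal arm with gap `Γ` is at most
`2 log n / (Γ - 2 ε) ^ 2`, up to a polynomial in `1 / ε`. -/
theorem exists_sum_prob_arm_le_of_eps {K : ℕ} (μ : Fin K → ℝ) (v : Fin K → ℝ≥0)
    (hv : ∀ i, 0 < v i) (L₀ : ℝ) (hL₀ : 0 < L₀) (b i : Fin K) (hvb : v b ≤ 1) :
    ∃ C : ℝ, 0 ≤ C ∧ ∀ (Ω : Type w) [MeasurableSpace Ω] (P : Measure Ω) [IsProbabilityMeasure P]
      (X τ θ : Fin K → ℕ → Ω → ℝ) (A : ℕ → Ω → Fin K), IsSRTS P μ v L₀ 0 X τ θ A →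
      ∀ n : ℕ, 1 ≤ n → ∀ ε : ℝ, 0 < ε → ε ≤ 1 → 2 * ε < μ b - μ i →
        ∑ t ∈ Finset.range n, P {ω | A t ω = i}
          ≤ ENNReal.ofReal (2 * log n / (μ b - μ i - 2 * ε) ^ 2 + C / ε ^ 3) := by
  have hvi0 : (0 : ℝ) < v i := hv i
  obtain ⟨C₁, hC₁, h₁⟩ := exists_sum_lintegral_inv_gaussianReal_le (hv b) hvb
  refine ⟨3 + C₁ + 2 * v i, by positivity, ?_⟩
  intro Ω _ P _ X τ θ A h n hn ε hε0 hε1 hεΓ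
  set a := μ b - μ i - 2 * ε with ha
  have ha0 : 0 < a := by rw [ha]; linarith
  have he0 : 0 < a ^ 2 / 2 := by positivity
  -- With empirical mean at most `μ i + ε`, the distance to the sampled level `μ b - ε` is at least
  -- `a = Γ - 2 ε`; the sampling variance `1 / s` then gives the rate `a² / 2` and hence the
  -- constant `2 / a²`.
  set y := (μ b - ε) / L₀ with hy
  have hyL : y * L₀ = μ b - ε := by rw [hy]; field_simp
  set good : Set (ℕ × ℝ × ℝ) := {q | q.2.1 ≤ μ i + ε} with hgood
  have hgoodm : MeasurableSet good := measurableSet_le measurable_snd.fst measurable_const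
  have hr : ∀ (L s : ℕ) (m r : ℝ), L < s → 1 / 2 ≤ r → (s, m, r) ∈ good →
      stateLaw (s, m, r) (exceedSet L₀ 0 y) ≤ ENNReal.ofReal (1 * exp (-(a ^ 2 / 2 * L))) := by
    intro L s m r hLs hr hq
    have hq1 : m ≤ μ i + ε := hq
    have hLs' : (L : ℝ) ≤ s := by exact_mod_cast hLs.le
    refine (stateLaw_exceedSet_zero_le hL₀ hyL.ge (show 0 < r by linarith)).trans
      ((gaussianReal_sample_Ici_le (a := a) (by omega) ha0.le (by linarith)).trans
        (ENNReal.ofReal_le_ofReal ?_))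
    rw [one_mul, exp_le_exp]
    nlinarith
  have hbad : ∑ k ∈ Finset.range n,
      ∫⁻ q, goodᶜ.indicator 1 ((k + 1 : ℕ), q.1, 1 / 2 + q.2 / 2) ∂statLaw (μ i) (v i) k
      ≤ ENNReal.ofReal (2 * v i / ε ^ 2) := by
    refine le_trans (Finset.sum_le_sum fun k _ => ?_)
      (sum_gaussianReal_mean_Ioi_le (μ i) (hv i) hε0 n)
    have e1 : (fun q : ℝ × ℝ => goodᶜ.indicator (1 : ℕ × ℝ × ℝ → ℝ≥0∞)
        ((k + 1 : ℕ), q.1, 1 / 2 + q.2 / 2)) = (Ioi (μ i + ε) ×ˢ univ).indicator 1 := by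
      funext q
      by_cases hq : μ i + ε < q.1
      · rw [indicator_of_mem (show q ∈ Ioi (μ i + ε) ×ˢ univ from ⟨hq, mem_univ _⟩),
          indicator_of_mem (show _ ∈ goodᶜ from fun hc => absurd hq (not_lt.2 hc))]
        rfl
      · rw [indicator_of_notMem (show _ ∉ goodᶜ from fun hc => hc (not_lt.1 hq)),
          indicator_of_notMem fun hc => hq hc.1]
    rw [e1, lintegral_indicator_one (measurableSet_Ioi.prod MeasurableSet.univ), statLaw,
      Measure.prod_prod, measure_univ, mul_one]
  set lo : ℕ × ℝ × ℝ → ℝ≥0∞ := fun q => gaussianReal q.2.1 (q.1 : ℝ≥0)⁻¹ (Ioi (μ b - ε)) with hlo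
  have hlom : Measurable lo := measurable_gaussianReal_state_Ioi (μ b - ε)
  have main := h.sum_prob_arm_le b i hlom
    (fun s m r hs hr => (gaussianReal_Ioi_pos _ _ (by
        have : (0 : ℝ≥0) < s := by exact_mod_cast hs
        exact (inv_pos.2 this).ne')).ne')
    (fun s m r _ hr => le_stateLaw_exceedSet_zero hL₀ hyL.le (show 0 < r by linarith))
    hgoodm (hr ⌈log n / (a ^ 2 / 2)⌉₊) n
  refine main.trans ?_
  have hopt : ∑ k ∈ Finset.range n, ∫⁻ q, ((lo (k + 1, q.1, 1 / 2 + q.2 / 2))⁻¹ - 1)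
      ∂statLaw (μ b) (v b) k ≤ ENNReal.ofReal (C₁ / ε ^ 3) := by
    refine le_trans (Finset.sum_le_sum fun k _ => le_of_eq ?_) (h₁ (μ b) ε hε0 hε1 n)
    have hm : Measurable fun q : ℝ × ℝ =>
        ((gaussianReal q.1 (((k + 1 : ℕ) : ℝ≥0)⁻¹) (Ioi (μ b - ε)))⁻¹ - 1) :=
      (((measurable_gaussianReal_Ioi _ _).comp measurable_fst).inv).sub_const 1
    rw [statLaw, hlo]
    refine (lintegral_prod _ hm.aemeasurable).trans ?_
    simp
  refine (add_le_add (add_le_add (add_le_add le_rfl hopt)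
    (ceil_add_mul_exp_le he0 zero_le_one hn)) hbad).trans ?_
  have hlog : 0 ≤ log n := log_nonneg (by exact_mod_cast hn)
  rw [← ENNReal.ofReal_one, ← ENNReal.ofReal_add zero_le_one (by positivity),
    ← ENNReal.ofReal_add (by positivity) (by positivity),
    ← ENNReal.ofReal_add (by positivity) (by positivity)]
  refine ENNReal.ofReal_le_ofReal ?_
  have e3 : 1 ≤ 1 / ε ^ 3 := by
    rw [le_div_iff₀ (by positivity), one_mul]; exact pow_le_one₀ hε0.le hε1
  have e4 : 2 * v i / ε ^ 2 ≤ 2 * v i / ε ^ 3 :=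
    div_le_div_of_nonneg_left (by positivity) (by positivity)
      (pow_le_pow_of_le_one hε0.le hε1 (by norm_num))
  have e5 : (3 + C₁ + 2 * v i) / ε ^ 3 = 3 * (1 / ε ^ 3) + C₁ / ε ^ 3 + 2 * v i / ε ^ 3 := by ring
  have e6 : log n / (a ^ 2 / 2) = 2 * log n / a ^ 2 := by field_simp
  rw [e5, e6]
  linarith

/-! ### Sums of functions of the received rewards -/

/-- A second order lower bound on the Sharpe ratio around a point. -/
theorem sharpe_sub_le {L₀ ρ m₀ v₀ m W : ℝ} (hL₀ : 0 < L₀) (hρ : 0 ≤ ρ) (hm₀ : 0 ≤ m₀)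
    (hv₀ : 0 ≤ v₀) (hW : m ^ 2 ≤ v₀ + W) :
    sharpe L₀ ρ m₀ v₀ - sharpe L₀ ρ (m₀ + m) (v₀ + W - m ^ 2) ≤
      -(m / (L₀ + ρ * v₀)) + m₀ * ρ / (L₀ + ρ * v₀) ^ 2 * W +
      ((ρ / (2 * L₀) + 1 / 2) / L₀ + ρ / (2 * L₀ ^ 2)) * m ^ 2 + ρ / (2 * L₀ ^ 2) * W ^ 2 := by
  unfold sharpe
  set D := L₀ + ρ * v₀ with hD
  set E := L₀ + ρ * (v₀ + W - m ^ 2) with hE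
  set F := L₀ + ρ * (v₀ + W) with hF
  have hDL : L₀ ≤ D := le_add_of_nonneg_right (by positivity)
  have hEL : L₀ ≤ E := le_add_of_nonneg_right (mul_nonneg hρ (by linarith))
  have hFm : L₀ + ρ * m ^ 2 ≤ F := by rw [hF]; nlinarith
  have hρm : 0 ≤ ρ * m ^ 2 := by positivity
  have hEF : F - E = ρ * m ^ 2 := by rw [hE, hF]; ring
  have hFD : F - D = ρ * W := by rw [hF, hD]; ring
  have hFL : L₀ ≤ F := by linarith
  have hD0 : 0 < D := hL₀.trans_le hDL
  have hE0 : 0 < E := hL₀.trans_le hEL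
  have hF0 : 0 < F := hL₀.trans_le hFL
  have b1 : m₀ / D - m₀ / E ≤ m₀ * ρ / D ^ 2 * W := by
    have h1 : m₀ / F ≤ m₀ / E := div_le_div_of_nonneg_left hm₀ hE0 (by linarith)
    have h2 : m₀ / D - m₀ / F ≤ m₀ * ρ / D ^ 2 * W := by
      have : m₀ * ρ / D ^ 2 * W - (m₀ / D - m₀ / F) = m₀ * (F - D) ^ 2 / (D ^ 2 * F) := by
        have : m₀ * ρ / D ^ 2 * W = m₀ * (F - D) / D ^ 2 := by rw [hFD]; ring
        rw [this]; field_simp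
      have : 0 ≤ m₀ * (F - D) ^ 2 / (D ^ 2 * F) := by positivity
      linarith
    linarith
  -- This term is cubic in `m` at first sight. The constraint `m² ≤ v₀ + W` forces `F ≥ L₀ + ρ m²`,
  -- so `ρ |m| / F` is bounded and a quadratic term remains.
  have b2 : -(m * (1 / E - 1 / F)) ≤ (ρ / (2 * L₀) + 1 / 2) / L₀ * m ^ 2 := by
    have h1 : 1 / E - 1 / F = ρ * m ^ 2 / (E * F) := by rw [← hEF]; field_simp
    have h2 : ρ * |m| ≤ (ρ / (2 * L₀) + 1 / 2) * F := by
      have h3 : ρ * |m| ≤ (ρ / (2 * L₀) + 1 / 2) * (L₀ + ρ * m ^ 2) := by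
        have e : (ρ / (2 * L₀) + 1 / 2) * (L₀ + ρ * m ^ 2) =
          ρ / 2 + ρ * m ^ 2 / 2 + (L₀ / 2 + ρ * (ρ * m ^ 2) / (2 * L₀)) := by field_simp; ring
        have h4 : 0 ≤ L₀ / 2 + ρ * (ρ * m ^ 2) / (2 * L₀) := by positivity
        have h5 : 0 ≤ ρ * (|m| - 1) ^ 2 := by positivity
        rw [e, ← sq_abs m]
        rw [← sq_abs m] at h4
        nlinarith
      exact h3.trans (mul_le_mul_of_nonneg_left hFm (by positivity))
    calc -(m * (1 / E - 1 / F)) ≤ |m| * (ρ * m ^ 2 / (E * F)) := by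
          rw [h1, ← neg_mul]
          exact mul_le_mul_of_nonneg_right (neg_le_abs m) (by positivity)
      _ = (ρ * |m|) * m ^ 2 / (E * F) := by ring
      _ ≤ ((ρ / (2 * L₀) + 1 / 2) * F) * m ^ 2 / (E * F) := by gcongr
      _ = (ρ / (2 * L₀) + 1 / 2) * m ^ 2 / E := by field_simp
      _ ≤ (ρ / (2 * L₀) + 1 / 2) * m ^ 2 / L₀ := by gcongr
      _ = _ := by ring
  have b3 : -(m * (1 / F - 1 / D)) ≤ ρ / (2 * L₀ ^ 2) * m ^ 2 + ρ / (2 * L₀ ^ 2) * W ^ 2 := by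
    have h1 : -(m * (1 / F - 1 / D)) = ρ * (m * W) / (F * D) := by
      have : -(m * (1 / F - 1 / D)) = m * (F - D) / (F * D) := by field_simp; ring
      rw [this, hFD]; ring
    rw [h1]
    have h2 : L₀ ^ 2 ≤ F * D := by rw [sq]; exact mul_le_mul hFL hDL hL₀.le hF0.le
    calc ρ * (m * W) / (F * D) ≤ ρ * ((m ^ 2 + W ^ 2) / 2) / (F * D) := by
          gcongr
          nlinarith [sq_nonneg (m - W)]
      _ ≤ ρ * ((m ^ 2 + W ^ 2) / 2) / L₀ ^ 2 := by gcongr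
      _ = _ := by ring
  have e : m₀ / D - (m₀ + m) / E = (m₀ / D - m₀ / E) + -(m * (1 / E - 1 / F)) +
      -(m * (1 / F - 1 / D)) + -(m / D) := by ring
  rw [e]
  linarith

theorem empVar_eq (y : ℕ → ℝ) {n : ℕ} (hn : 0 < n) (a w : ℝ) :
    empVar y n = w + (∑ t ∈ Finset.range n, ((y t - a) ^ 2 - w)) / n - (empMean y n - a) ^ 2 := by
  have hn' : (n : ℝ) ≠ 0 := by positivity
  set c := empMean y n with hc
  have h1 : ∑ t ∈ Finset.range n, y t = n * c := by rw [hc, empMean]; field_simp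
  have h2 : ∑ t ∈ Finset.range n, (y t - c) ^ 2 = ∑ t ∈ Finset.range n, ((y t - a) ^ 2 - w) +
      n * w - n * (c - a) ^ 2 := by
    have e : ∀ t, (y t - c) ^ 2 = ((y t - a) ^ 2 - w) + (2 * (a - c)) * y t + (w + c ^ 2 - a ^ 2) := by
      intro t; ring
    simp_rw [e]
    rw [Finset.sum_add_distrib, Finset.sum_add_distrib, ← Finset.mul_sum, h1, Finset.sum_const,
      Finset.card_range, nsmul_eq_mul]
    ring
  rw [empVar, ← hc, h2]
  field_simp
  ring

theorem empVar_nonneg (y : ℕ → ℝ) (n : ℕ) : 0 ≤ empVar y n :=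
  div_nonneg (Finset.sum_nonneg fun _ _ => sq_nonneg _) (Nat.cast_nonneg n)

theorem empMean_eq (y : ℕ → ℝ) {n : ℕ} (hn : 0 < n) (a : ℝ) :
    empMean y n = a + (∑ t ∈ Finset.range n, (y t - a)) / n := by
  have hn' : (n : ℝ) ≠ 0 := by positivity
  rw [empMean, Finset.sum_sub_distrib, Finset.sum_const, Finset.card_range, nsmul_eq_mul]
  field_simp
  ring

/-! ### Functions of the arm played and of the reward received -/

section Observed

variable {Ω : Type*} {K : ℕ} {X τ θ : Fin K → ℕ → Ω → ℝ} {A : ℕ → Ω → Fin K}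

/-- A function of the arm played in round `t` and of the reward received. -/
def observed (X : Fin K → ℕ → Ω → ℝ) (A : ℕ → Ω → Fin K) (f : Fin K → ℝ → ℝ) (t : ℕ) (ω : Ω) : ℝ :=
  f (A t ω) (X (A t ω) t ω)

theorem observed_eq_sum (X : Fin K → ℕ → Ω → ℝ) (A : ℕ → Ω → Fin K)
    (f : Fin K → ℝ → ℝ) (t : ℕ) :
    observed X A f t = fun ω => ∑ i, {ω | A t ω = i}.indicator (fun ω => f i (X i t ω)) ω := by
  funext ω
  rw [Finset.sum_eq_single (A t ω)]
  · rw [indicator_of_mem (show ω ∈ {ω' | A t ω' = A t ω} from rfl)]; rfl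
  · intro i _ hi
    exact indicator_of_notMem (s := {ω | A t ω = i}) (fun h => hi h.symm) _
  · simp

theorem measurable_arm_indicator (i : Fin K) (t : ℕ) {Z : Ω → ℝ}
    (hZ : Measurable[pastSigma X τ θ A t ⊔ decisionSigma τ θ A t] Z) :
    Measurable[pastSigma X τ θ A t ⊔ decisionSigma τ θ A t] ({ω | A t ω = i}.indicator Z) :=
  hZ.indicator (measurable_decisionSigma_arm t (measurableSet_singleton i))

theorem measurable_pastSigma_observed {f : Fin K → ℝ → ℝ} (hfm : ∀ i, Measurable (f i)) {s t : ℕ}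
    (hst : s < t) : Measurable[pastSigma X τ θ A t] (observed X A f s) := by
  rw [observed_eq_sum]
  refine @Finset.measurable_sum _ _ _ _ _ _ (pastSigma X τ θ A t) _ _ fun i _ => ?_
  exact ((hfm i).comp (measurable_pastSigma_reward hst i)).indicator
    (measurable_pastSigma_arm hst (measurableSet_singleton i))

end Observed

section Run

variable {Ω : Type*} [m0 : MeasurableSpace Ω] {P : Measure Ω} {K : ℕ} {μ : Fin K → ℝ}
  {v : Fin K → ℝ≥0} {L₀ ρ : ℝ} {X τ θ : Fin K → ℕ → Ω → ℝ} {A : ℕ → Ω → Fin K}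

/-- Expected number of pulls of arm `i` in the first `n` rounds. -/
def expectedPulls (P : Measure Ω) (A : ℕ → Ω → Fin K) (i : Fin K) (n : ℕ) : ℝ :=
  ∑ t ∈ Finset.range n, P.real {ω | A t ω = i}

theorem expectedPulls_nonneg (P : Measure Ω) (A : ℕ → Ω → Fin K) (i : Fin K) (n : ℕ) :
    0 ≤ expectedPulls P A i n :=
  Finset.sum_nonneg fun _ _ => measureReal_nonneg

theorem expectedPulls_le [IsFiniteMeasure P] {i : Fin K} {n : ℕ} {C : ℝ} (hC : 0 ≤ C)
    (h : ∑ t ∈ Finset.range n, P {ω | A t ω = i} ≤ ENNReal.ofReal C) :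
    expectedPulls P A i n ≤ C := by
  have : expectedPulls P A i n = (∑ t ∈ Finset.range n, P {ω | A t ω = i}).toReal := by
    rw [ENNReal.toReal_sum fun _ _ => measure_ne_top _ _]; rfl
  rw [this]
  exact ENNReal.toReal_le_of_le_ofReal hC h

namespace IsSRTS

theorem measurableSet_arm (h : IsSRTS P μ v L₀ ρ X τ θ A) (i : Fin K) (t : ℕ) :
    MeasurableSet {ω | A t ω = i} :=
  h.measurable_arm t (measurableSet_singleton i)

theorem memLp_reward (h : IsSRTS P μ v L₀ ρ X τ θ A) {f : ℝ → ℝ} {p : ℝ≥0∞}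
    (i : Fin K) (t : ℕ) (hf : MemLp f p (gaussianReal (μ i) (v i))) :
    MemLp (fun ω => f (X i t ω)) p P := by
  rw [← h.map_reward i t] at hf
  exact hf.comp_of_map (h.measurable_reward i t).aemeasurable

theorem memLp_observed (h : IsSRTS P μ v L₀ ρ X τ θ A) {f : Fin K → ℝ → ℝ} {p : ℝ≥0∞}
    (hf : ∀ i, MemLp (f i) p (gaussianReal (μ i) (v i))) (t : ℕ) :
    MemLp (observed X A f t) p P := by
  rw [observed_eq_sum]
  exact memLp_finsetSum _ fun i _ => (h.memLp_reward i t (hf i)).indicator (h.measurableSet_arm i t)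

theorem integral_mul_reward (h : IsSRTS P μ v L₀ ρ X τ θ A) {Z : Ω → ℝ} {f : ℝ → ℝ}
    (i : Fin K) (t : ℕ) (hZ : Measurable[pastSigma X τ θ A t ⊔ decisionSigma τ θ A t] Z)
    (hf : Measurable f) :
    ∫ ω, Z ω * f (X i t ω) ∂P = (∫ ω, Z ω ∂P) * ∫ x, f x ∂gaussianReal (μ i) (v i) := by
  have hZ' : Measurable Z := hZ.mono (sup_le (h.pastSigma_le t) (h.decisionSigma_le t)) le_rfl
  have hX := h.measurable_reward i t
  have hind : IndepFun Z (fun ω => f (X i t ω)) P :=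
    (h.indepFun_reward i t hZ).comp measurable_id hf
  rw [hind.integral_fun_mul_eq_mul_integral hZ'.aestronglyMeasurable
    (hf.comp hX).aestronglyMeasurable, ← h.map_reward i t,
    integral_map hX.aemeasurable hf.aestronglyMeasurable]

/-- A function of the arm and the reward of round `t` which is centred for every arm is orthogonal
to everything that happened up to the decision of that round. -/
theorem integral_mul_observed (h : IsSRTS P μ v L₀ ρ X τ θ A) [IsFiniteMeasure P]
    {f : Fin K → ℝ → ℝ} (hfm : ∀ i, Measurable (f i))
    (hf : ∀ i, MemLp (f i) 2 (gaussianReal (μ i) (v i))) {Z : Ω → ℝ} (t : ℕ)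
    (hZ : Measurable[pastSigma X τ θ A t ⊔ decisionSigma τ θ A t] Z) (hZ2 : MemLp Z 2 P) :
    ∫ ω, Z ω * observed X A f t ω ∂P = ∑ i, (∫ ω in {ω | A t ω = i}, Z ω ∂P) *
      ∫ x, f i x ∂gaussianReal (μ i) (v i) := by
  rw [observed_eq_sum]
  have e : ∀ ω, Z ω * ∑ i, {ω | A t ω = i}.indicator (fun ω => f i (X i t ω)) ω
      = ∑ i, {ω | A t ω = i}.indicator Z ω * f i (X i t ω) := by
    intro ω
    rw [Finset.mul_sum]
    refine Finset.sum_congr rfl fun i _ => ?_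
    by_cases hi : ω ∈ {ω | A t ω = i}
    · rw [indicator_of_mem hi, indicator_of_mem hi]
    · rw [indicator_of_notMem hi, indicator_of_notMem hi, mul_zero, zero_mul]
  simp_rw [e]
  rw [integral_finsetSum]
  · refine Finset.sum_congr rfl fun i _ => ?_
    rw [h.integral_mul_reward i t (measurable_arm_indicator i t hZ) (hfm i),
      integral_indicator (h.measurableSet_arm i t)]
  · intro i _
    exact (hZ2.indicator (h.measurableSet_arm i t)).integrable_mul (h.memLp_reward i t (hf i))

theorem integral_observed (h : IsSRTS P μ v L₀ ρ X τ θ A) [IsFiniteMeasure P]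
    {f : Fin K → ℝ → ℝ} (hfm : ∀ i, Measurable (f i))
    (hf : ∀ i, Integrable (f i) (gaussianReal (μ i) (v i))) (t : ℕ) :
    ∫ ω, observed X A f t ω ∂P = ∑ i, P.real {ω | A t ω = i} *
      ∫ x, f i x ∂gaussianReal (μ i) (v i) := by
  rw [observed_eq_sum]
  rw [integral_finsetSum]
  · refine Finset.sum_congr rfl fun i _ => ?_
    have := h.integral_mul_reward i t (Z := {ω | A t ω = i}.indicator fun _ => 1)
      (measurable_arm_indicator i t (@measurable_const _ _ _ (_) _)) (hfm i)
    rw [integral_indicator (h.measurableSet_arm i t), setIntegral_const, smul_eq_mul, mul_one]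
      at this
    rw [← this]
    refine integral_congr_ae (Filter.Eventually.of_forall fun ω => ?_)
    by_cases hi : ω ∈ {ω | A t ω = i}
    · simp only [indicator_of_mem hi, one_mul]
    · simp only [indicator_of_notMem hi, zero_mul]
  · intro i _
    exact (memLp_one_iff_integrable.1 (h.memLp_reward i t
      (memLp_one_iff_integrable.2 (hf i)))).indicator (h.measurableSet_arm i t)

/-- The partial sums form a martingale, so the cross terms vanish and second moments add up. -/
theorem integral_sum_observed_sq_le_of_centred (h : IsSRTS P μ v L₀ ρ X τ θ A)
    [IsProbabilityMeasure P] {f : Fin K → ℝ → ℝ} (hfm : ∀ i, Measurable (f i))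
    (hf : ∀ i, MemLp (f i) 2 (gaussianReal (μ i) (v i)))
    (hf0 : ∀ i, ∫ x, f i x ∂gaussianReal (μ i) (v i) = 0) (n : ℕ) :
    ∫ ω, (∑ t ∈ Finset.range n, observed X A f t ω) ^ 2 ∂P
      ≤ n * ∑ i, ∫ x, f i x ^ 2 ∂gaussianReal (μ i) (v i) := by
  have hL : ∀ n, MemLp (fun ω => ∑ t ∈ Finset.range n, observed X A f t ω) 2 P := fun n =>
    memLp_finsetSum _ fun t _ => h.memLp_observed hf t
  have hnn : ∀ i, 0 ≤ ∫ x, f i x ^ 2 ∂gaussianReal (μ i) (v i) := fun i =>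
    integral_nonneg fun x => sq_nonneg _
  induction n with
  | zero => simp
  | succ n ih =>
    have hN := h.memLp_observed hf n
    have e : ∀ ω, (∑ t ∈ Finset.range (n + 1), observed X A f t ω) ^ 2
        = (∑ t ∈ Finset.range n, observed X A f t ω) ^ 2 +
          2 * ((∑ t ∈ Finset.range n, observed X A f t ω) * observed X A f n ω) +
          observed X A (fun i x => f i x ^ 2) n ω := by
      intro ω
      rw [Finset.sum_range_succ]
      simp only [observed]
      ring
    have i3 : Integrable (observed X A (fun i x => f i x ^ 2) n) P := hN.integrable_sq
    have i2 : Integrable (fun ω => 2 * ((∑ t ∈ Finset.range n, observed X A f t ω) *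
      observed X A f n ω)) P := ((hL n).integrable_mul hN).const_mul 2
    have hS : Measurable[pastSigma X τ θ A n] fun ω => ∑ t ∈ Finset.range n, observed X A f t ω :=
      @Finset.measurable_fun_sum _ _ _ _ _ _ (pastSigma X τ θ A n) _ _ fun s hs =>
        measurable_pastSigma_observed hfm (Finset.mem_range.1 hs)
    have h12 : Integrable (fun ω => (∑ t ∈ Finset.range n, observed X A f t ω) ^ 2 +
        2 * ((∑ t ∈ Finset.range n, observed X A f t ω) * observed X A f n ω)) P :=
      (hL n).integrable_sq.add i2
    have z : ∫ ω, (∑ t ∈ Finset.range n, observed X A f t ω) * observed X A f n ω ∂P = 0 := by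
      rw [h.integral_mul_observed hfm hf n (hS.mono le_sup_left le_rfl) (hL n)]
      simp [hf0]
    simp_rw [e]
    rw [integral_add h12 i3, integral_add (hL n).integrable_sq i2, integral_const_mul, z,
      h.integral_observed (fun i => (hfm i).pow_const 2) (fun i => (hf i).integrable_sq)]
    have : ∑ i, P.real {ω | A n ω = i} * ∫ x, f i x ^ 2 ∂gaussianReal (μ i) (v i)
        ≤ ∑ i, ∫ x, f i x ^ 2 ∂gaussianReal (μ i) (v i) :=
      Finset.sum_le_sum fun i _ => mul_le_of_le_one_left (hnn i) measureReal_le_one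
    push_cast
    linarith

theorem integral_sum_observed (h : IsSRTS P μ v L₀ ρ X τ θ A) [IsFiniteMeasure P]
    {f : Fin K → ℝ → ℝ} (hfm : ∀ i, Measurable (f i))
    (hf : ∀ i, Integrable (f i) (gaussianReal (μ i) (v i))) (n : ℕ) :
    ∫ ω, ∑ t ∈ Finset.range n, observed X A f t ω ∂P = ∑ i, expectedPulls P A i n *
      ∫ x, f i x ∂gaussianReal (μ i) (v i) := by
  rw [integral_finsetSum _ fun t _ => memLp_one_iff_integrable.1
    (h.memLp_observed (fun i => memLp_one_iff_integrable.2 (hf i)) t)]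
  simp_rw [h.integral_observed hfm hf, expectedPulls, Finset.sum_mul]
  exact Finset.sum_comm

/-- Each term is split into its centred part and the mean of the arm played. The centred part is a
martingale increment; for the drift, Cauchy–Schwarz bounds the square of the sum by `n` times the
sum of squares, which is linear in the pulls. After division by `n`, arms whose mean vanishes
contribute nothing through the drift. -/
theorem integral_sum_observed_sq_le (h : IsSRTS P μ v L₀ ρ X τ θ A)
    [IsProbabilityMeasure P] {f : Fin K → ℝ → ℝ} (hfm : ∀ i, Measurable (f i))
    (hf : ∀ i, MemLp (f i) 2 (gaussianReal (μ i) (v i))) (n : ℕ) :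
    ∫ ω, (∑ t ∈ Finset.range n, observed X A f t ω) ^ 2 ∂P ≤
      n * (2 * ∑ i, ∫ x, (f i x - ∫ y, f i y ∂gaussianReal (μ i) (v i)) ^ 2
        ∂gaussianReal (μ i) (v i) +
      2 * ∑ i, expectedPulls P A i n * (∫ y, f i y ∂gaussianReal (μ i) (v i)) ^ 2) := by
  set a : Fin K → ℝ := fun i => ∫ y, f i y ∂gaussianReal (μ i) (v i) with ha
  set f₁ : Fin K → ℝ → ℝ := fun i x => f i x - a i with hf₁
  set f₂ : Fin K → ℝ → ℝ := fun i _ => a i with hf₂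
  have m₂ : ∀ i, MemLp (f₂ i) 2 (gaussianReal (μ i) (v i)) := fun i => memLp_const _
  have m₁ : ∀ i, MemLp (f₁ i) 2 (gaussianReal (μ i) (v i)) := fun i => (hf i).sub (m₂ i)
  have hL : ∀ {g : Fin K → ℝ → ℝ}, (∀ i, MemLp (g i) 2 (gaussianReal (μ i) (v i))) →
      MemLp (fun ω => ∑ t ∈ Finset.range n, observed X A g t ω) 2 P := fun hg =>
    memLp_finsetSum _ fun t _ => h.memLp_observed hg t
  have c₁ := h.integral_sum_observed_sq_le_of_centred (f := f₁) (fun i => (hfm i).sub_const _) m₁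
    (fun i => by
      rw [hf₁, integral_sub ((hf i).integrable one_le_two) (integrable_const _)]
      simp [ha]) n
  have hsq : ∀ i, Integrable (fun x => f₂ i x ^ 2) (gaussianReal (μ i) (v i)) :=
    fun i => (m₂ i).integrable_sq
  have c₂ : ∫ ω, (∑ t ∈ Finset.range n, observed X A f₂ t ω) ^ 2 ∂P ≤
      n * ∑ i, expectedPulls P A i n * a i ^ 2 := by
    have e := h.integral_sum_observed (f := fun i x => f₂ i x ^ 2)
      (fun i => (measurable_const : Measurable fun _ : ℝ => a i ^ 2))
      hsq n
    simp only [hf₂, integral_const, probReal_univ, smul_eq_mul, one_mul] at e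
    rw [← e, ← integral_const_mul]
    refine integral_mono (hL m₂).integrable_sq ?_ fun ω => ?_
    · exact (integrable_finsetSum _ fun t _ => memLp_one_iff_integrable.1
        (h.memLp_observed (fun i => memLp_const _) t)).const_mul _
    · have := sq_sum_le_card_mul_sum_sq (s := Finset.range n) (f := fun t => observed X A f₂ t ω)
      rwa [Finset.card_range] at this
  have split : ∀ ω, (∑ t ∈ Finset.range n, observed X A f t ω) ^ 2 ≤
      2 * (∑ t ∈ Finset.range n, observed X A f₁ t ω) ^ 2 +
      2 * (∑ t ∈ Finset.range n, observed X A f₂ t ω) ^ 2 := by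
    intro ω
    have : ∑ t ∈ Finset.range n, observed X A f t ω = ∑ t ∈ Finset.range n, observed X A f₁ t ω +
        ∑ t ∈ Finset.range n, observed X A f₂ t ω := by
      rw [← Finset.sum_add_distrib]
      refine Finset.sum_congr rfl fun t _ => ?_
      simp only [observed, hf₁, hf₂]; ring
    rw [this]
    nlinarith [sq_nonneg (∑ t ∈ Finset.range n, observed X A f₁ t ω -
        ∑ t ∈ Finset.range n, observed X A f₂ t ω)]
  have j₁ := (hL m₁).integrable_sq.const_mul 2
  have j₂ := (hL m₂).integrable_sq.const_mul 2
  calc ∫ ω, (∑ t ∈ Finset.range n, observed X A f t ω) ^ 2 ∂P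
      ≤ ∫ ω, (2 * (∑ t ∈ Finset.range n, observed X A f₁ t ω) ^ 2 +
        2 * (∑ t ∈ Finset.range n, observed X A f₂ t ω) ^ 2) ∂P :=
        integral_mono (hL hf).integrable_sq (j₁.add j₂) split
    _ ≤ _ := by
      rw [integral_add j₁ j₂, integral_const_mul, integral_const_mul]
      linarith

end IsSRTS

end Run

/-! ### The regret in terms of the pulls -/

theorem sum_mul_le_of_eq_zero {K : ℕ} {b : Fin K} {p g : Fin K → ℝ} (hp : ∀ i, 0 ≤ p i)
    (hg : g b = 0) :
    ∑ i, p i * g i ≤ (∑ j, |g j|) * ∑ i ∈ Finset.univ.erase b, p i := by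
  rw [← Finset.add_sum_erase _ _ (Finset.mem_univ b), hg, mul_zero, zero_add, Finset.mul_sum]
  refine Finset.sum_le_sum fun i _ => ?_
  rw [mul_comm]
  refine mul_le_mul_of_nonneg_right ((le_abs_self _).trans ?_) (hp i)
  exact Finset.single_le_sum (f := fun j => |g j|) (fun j _ => abs_nonneg _) (Finset.mem_univ i)

theorem memLp_sub_gaussianReal (m a : ℝ) (v : ℝ≥0) {p : ℝ≥0∞} (hp : p ≠ ∞) :
    MemLp (fun x => x - a) p (gaussianReal m v) :=
  (memLp_id_gaussianReal' p hp).sub (memLp_const a)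

theorem memLp_sub_sq_gaussianReal (m a w : ℝ) (v : ℝ≥0) :
    MemLp (fun x => (x - a) ^ 2 - w) 2 (gaussianReal m v) := by
  refine MemLp.sub ?_ (memLp_const w)
  refine (memLp_two_iff_integrable_sq (by fun_prop)).2 ?_
  have h := (memLp_sub_gaussianReal m a v (p := (4 : ℕ)) (by simp)).integrable_norm_pow (by norm_num)
  refine h.congr (Filter.Eventually.of_forall fun x => ?_)
  simp only [norm_eq_abs]
  rw [← pow_mul, Even.pow_abs (by decide)]

theorem integral_sub_gaussianReal (m a : ℝ) (v : ℝ≥0) :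
    ∫ x, (x - a) ∂gaussianReal m v = m - a := by
  have h : Integrable (fun x : ℝ => x) (gaussianReal m v) :=
    (memLp_id_gaussianReal' (μ := m) (v := v) 1 (by simp)).integrable le_rfl
  rw [integral_sub h (integrable_const a), integral_id_gaussianReal]
  simp

theorem integral_sub_sq_gaussianReal (m : ℝ) (v : ℝ≥0) :
    ∫ x, ((x - m) ^ 2 - v) ∂gaussianReal m v = 0 := by
  have h : Integrable (fun x : ℝ => (x - m) ^ 2) (gaussianReal m v) :=
    (memLp_sub_gaussianReal m m v (p := 2) (by simp)).integrable_sq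
  have h2 := variance_fun_id_gaussianReal (μ := m) (v := v)
  rw [variance_eq_integral (by fun_prop), integral_id_gaussianReal] at h2
  rw [integral_sub h (integrable_const _), h2]
  simp

section Run

variable {Ω : Type*} [m0 : MeasurableSpace Ω] {P : Measure Ω} {K : ℕ} {μ : Fin K → ℝ}
  {v : Fin K → ℝ≥0} {L₀ ρ : ℝ} {X τ θ : Fin K → ℕ → Ω → ℝ} {A : ℕ → Ω → Fin K}

namespace IsSRTS

theorem measurable_received (h : IsSRTS P μ v L₀ ρ X τ θ A) (t : ℕ) :
    Measurable fun ω => X (A t ω) t ω := by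
  have := observed_eq_sum X A (fun _ x => x) t
  unfold observed at this
  rw [this]
  exact Finset.measurable_fun_sum _ fun i _ =>
    (h.measurable_reward i t).indicator (h.measurableSet_arm i t)

theorem measurable_algSharpe (h : IsSRTS P μ v L₀ ρ X τ θ A) (n : ℕ) :
    Measurable (algSharpe L₀ ρ X A n) := by
  have hX := h.measurable_received
  have hM : Measurable fun ω => empMean (fun t => X (A t ω) t ω) n := by
    unfold empMean
    exact (Finset.measurable_fun_sum _ fun t _ => hX t).div_const _
  have hV : Measurable fun ω => empVar (fun t => X (A t ω) t ω) n := by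
    unfold empVar
    exact (Finset.measurable_fun_sum _ fun t _ => ((hX t).sub hM).pow_const 2).div_const _
  unfold algSharpe empSharpe sharpe
  exact hM.div ((hV.const_mul ρ).const_add L₀)

theorem integrable_algSharpe (h : IsSRTS P μ v L₀ ρ X τ θ A) [IsFiniteMeasure P] (hL₀ : 0 < L₀)
    (hρ : 0 ≤ ρ) (n : ℕ) : Integrable (algSharpe L₀ ρ X A n) P := by
  have hY : ∀ t, Integrable (fun ω => X (A t ω) t ω) P := fun t =>
    memLp_one_iff_integrable.1 (h.memLp_observed (f := fun _ x => x)
      (fun i => memLp_id_gaussianReal' 1 (by simp)) t)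
  have hM : Integrable (fun ω => empMean (fun t => X (A t ω) t ω) n / L₀) P :=
    ((integrable_finsetSum _ fun t _ => hY t).div_const _).div_const _
  refine hM.mono (h.measurable_algSharpe n).aestronglyMeasurable
    (Filter.Eventually.of_forall fun ω => ?_)
  simp only [algSharpe, empSharpe, sharpe, norm_div, norm_eq_abs]
  refine div_le_div_of_nonneg_left (abs_nonneg _) (abs_pos.2 hL₀.ne') ?_
  have := mul_nonneg hρ (empVar_nonneg (fun t => X (A t ω) t ω) n)
  rw [abs_of_pos hL₀, abs_of_nonneg (by linarith)]
  linarith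

theorem integral_empMean (h : IsSRTS P μ v L₀ ρ X τ θ A) [IsProbabilityMeasure P] (m : ℝ) {n : ℕ}
    (hn : 0 < n) :
    ∫ ω, empMean (fun t => X (A t ω) t ω) n ∂P =
      m + (∑ i, expectedPulls P A i n * (μ i - m)) / n := by
  have hf : ∀ i, Integrable (fun x : ℝ => x - m) (gaussianReal (μ i) (v i)) := fun i =>
    memLp_one_iff_integrable.1 (memLp_sub_gaussianReal _ _ _ (by simp))
  have h1 := h.integral_sum_observed (f := fun _ x => x - m) (fun i => by fun_prop) hf n
  have h2 : Integrable (fun ω => ∑ t ∈ Finset.range n, observed X A (fun _ x => x - m) t ω) P :=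
    integrable_finsetSum _ fun t _ => memLp_one_iff_integrable.1
      (h.memLp_observed (fun i => memLp_sub_gaussianReal _ _ _ (by simp)) t)
  simp_rw [integral_sub_gaussianReal] at h1
  have e : (fun ω => empMean (fun t => X (A t ω) t ω) n) = fun ω =>
      m + (∑ t ∈ Finset.range n, observed X A (fun _ x => x - m) t ω) / n :=
    funext fun ω => empMean_eq _ hn m
  rw [e, integral_add (integrable_const _) (h2.div_const _), integral_div, h1]
  simp

/-- Without risk aversion the Sharpe ratio is linear in the rewards, so the decomposition is an
identity and no constant is lost. -/
theorem expectedRegret_of_rho_eq_zero (h : IsSRTS P μ v L₀ 0 X τ θ A) [IsProbabilityMeasure P]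
    (hL₀ : 0 < L₀) (b : Fin K) {n : ℕ} (hn : 0 < n) :
    expectedRegret P L₀ 0 (sharpe L₀ 0 (μ b) (v b)) X A n =
      ∑ i, expectedPulls P A i n * (sharpe L₀ 0 (μ b) (v b) - sharpe L₀ 0 (μ i) (v i)) := by
  have hn' : (n : ℝ) ≠ 0 := by positivity
  have h1 := h.integral_empMean (μ b) hn
  simp only [expectedRegret, algSharpe, empSharpe, sharpe, zero_mul, add_zero]
  rw [integral_div, h1]
  have e : ∀ i, expectedPulls P A i n * (μ b / L₀ - μ i / L₀) =
      -(expectedPulls P A i n * (μ i - μ b)) / L₀ := by intro i; ring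
  simp_rw [e]
  rw [← Finset.sum_div, Finset.sum_neg_distrib]
  field_simp
  ring

/-- `sharpe_sub_le` is applied pointwise with `m = M / n` and `W = Q / n`. Multiplication by `n`
leaves the linear terms of size `M` and `Q` and the quadratic terms of size `M² / n` and `Q² / n`.
-/
theorem expectedRegret_le_second_order (h : IsSRTS P μ v L₀ ρ X τ θ A) [IsProbabilityMeasure P]
    (hL₀ : 0 < L₀) (hρ : 0 ≤ ρ) {b : Fin K} (hb : 0 ≤ μ b) {n : ℕ} (hn : 0 < n)
    {M Q : Ω → ℝ} (hM : M = fun ω => ∑ t ∈ Finset.range n, observed X A (fun _ x => x - μ b) t ω)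
    (hQ : Q = fun ω => ∑ t ∈ Finset.range n, observed X A (fun _ x => (x - μ b) ^ 2 - v b) t ω) :
    expectedRegret P L₀ ρ (sharpe L₀ ρ (μ b) (v b)) X A n ≤
      -((∫ ω, M ω ∂P) / (L₀ + ρ * v b)) + μ b * ρ / (L₀ + ρ * v b) ^ 2 * ∫ ω, Q ω ∂P +
      ((ρ / (2 * L₀) + 1 / 2) / L₀ + ρ / (2 * L₀ ^ 2)) * ((∫ ω, M ω ^ 2 ∂P) / n) +
      ρ / (2 * L₀ ^ 2) * ((∫ ω, Q ω ^ 2 ∂P) / n) := by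
  have hn0 : (0 : ℝ) < n := by exact_mod_cast hn
  have hM2 : MemLp M 2 P := by
    rw [hM]
    exact memLp_finsetSum _ fun t _ => h.memLp_observed
      (fun i => memLp_sub_gaussianReal _ _ _ (by simp)) t
  have hQ2 : MemLp Q 2 P := by
    rw [hQ]
    exact memLp_finsetSum _ fun t _ => h.memLp_observed
      (fun i => memLp_sub_sq_gaussianReal _ _ _ _) t
  have hM1 := hM2.integrable one_le_two
  have hQ1 := hQ2.integrable one_le_two
  set c₁ := (ρ / (2 * L₀) + 1 / 2) / L₀ + ρ / (2 * L₀ ^ 2) with hc₁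
  set c₂ := ρ / (2 * L₀ ^ 2) with hc₂
  set D := L₀ + ρ * v b with hD
  set c₃ := μ b * ρ / D ^ 2 with hc₃
  have hS := h.integrable_algSharpe hL₀ hρ n
  have point : ∀ ω, n * (sharpe L₀ ρ (μ b) (v b) - algSharpe L₀ ρ X A n ω) ≤
      -(M ω / D) + c₃ * Q ω + c₁ * (M ω ^ 2 / n) + c₂ * (Q ω ^ 2 / n) := by
    intro ω
    have e1 : empMean (fun t => X (A t ω) t ω) n = μ b + M ω / n := by
      rw [hM]; exact empMean_eq _ hn (μ b)
    have e2 : empVar (fun t => X (A t ω) t ω) n = v b + Q ω / n - (M ω / n) ^ 2 := by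
      rw [empVar_eq _ hn (μ b) (v b), e1, hQ, add_sub_cancel_left]; rfl
    have hnn := empVar_nonneg (fun t => X (A t ω) t ω) n
    rw [e2] at hnn
    have := sharpe_sub_le hL₀ hρ hb (v b).coe_nonneg (show (M ω / n) ^ 2 ≤ v b + Q ω / n by linarith)
    rw [algSharpe, empSharpe, e1, e2]
    refine (mul_le_mul_of_nonneg_left this hn0.le).trans (le_of_eq ?_)
    simp only [hc₁, hc₂, hc₃, hD]
    field_simp
  have i1 : Integrable (fun ω => -(M ω / D)) P := (hM1.div_const _).neg
  have i2 : Integrable (fun ω => c₃ * Q ω) P := hQ1.const_mul _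
  have i3 : Integrable (fun ω => c₁ * (M ω ^ 2 / n)) P := (hM2.integrable_sq.div_const _).const_mul _
  have i4 : Integrable (fun ω => c₂ * (Q ω ^ 2 / n)) P := (hQ2.integrable_sq.div_const _).const_mul _
  have i12 : Integrable (fun ω => -(M ω / D) + c₃ * Q ω) P := i1.add i2
  have i123 : Integrable (fun ω => -(M ω / D) + c₃ * Q ω + c₁ * (M ω ^ 2 / n)) P := i12.add i3
  have key := integral_mono (((integrable_const _).sub hS).const_mul (n : ℝ)) (i123.add i4) point
  simp only [Pi.add_apply] at key
  rw [integral_add i123 i4, integral_add i12 i3, integral_add i1 i2, integral_neg, integral_div,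
    integral_const_mul, integral_const_mul, integral_const_mul, integral_const_mul, integral_div,
    integral_div] at key
  simp only [Pi.sub_apply] at key
  rw [integral_sub (integrable_const _) hS] at key
  simpa [expectedRegret] using key

end IsSRTS

end Run

/-- The regret is controlled by the number of pulls of the suboptimal arms. -/
theorem exists_expectedRegret_le {K : ℕ} (μ : Fin K → ℝ) (v : Fin K → ℝ≥0) (L₀ ρ : ℝ)
    (hL₀ : 0 < L₀) (hρ : 0 ≤ ρ) (b : Fin K) (hb : 0 ≤ μ b) :
    ∃ C : ℝ, 0 ≤ C ∧ ∀ (Ω : Type w) [MeasurableSpace Ω] (P : Measure Ω) [IsProbabilityMeasure P]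
      (X τ θ : Fin K → ℕ → Ω → ℝ) (A : ℕ → Ω → Fin K), IsSRTS P μ v L₀ ρ X τ θ A →
      ∀ n : ℕ, 1 ≤ n → expectedRegret P L₀ ρ (sharpe L₀ ρ (μ b) (v b)) X A n ≤
        C * (1 + ∑ i ∈ Finset.univ.erase b, expectedPulls P A i n) := by
  set f₁ : Fin K → ℝ → ℝ := fun _ x => x - μ b with hf₁
  set f₂ : Fin K → ℝ → ℝ := fun _ x => (x - μ b) ^ 2 - v b with hf₂
  set a₁ : Fin K → ℝ := fun i => ∫ x, f₁ i x ∂gaussianReal (μ i) (v i) with ha₁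
  set a₂ : Fin K → ℝ := fun i => ∫ x, f₂ i x ∂gaussianReal (μ i) (v i) with ha₂
  -- Centring at the parameters of `b` makes both functions mean zero for that arm, so its pulls, of
  -- which there may be order `n`, drop out of every drift.
  have hz₁ : a₁ b = 0 := by simp only [ha₁, hf₁, integral_sub_gaussianReal, sub_self]
  have hz₂ : a₂ b = 0 := by simp only [ha₂, hf₂, integral_sub_sq_gaussianReal]
  have m₁ : ∀ i, Measurable (f₁ i) := fun i => by fun_prop
  have m₂ : ∀ i, Measurable (f₂ i) := fun i => by fun_prop
  have l₁ : ∀ i, MemLp (f₁ i) 2 (gaussianReal (μ i) (v i)) := fun i =>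
    memLp_sub_gaussianReal _ _ _ (by simp)
  have l₂ : ∀ i, MemLp (f₂ i) 2 (gaussianReal (μ i) (v i)) := fun i =>
    memLp_sub_sq_gaussianReal _ _ _ _
  set q₁ := ∑ i, ∫ x, (f₁ i x - a₁ i) ^ 2 ∂gaussianReal (μ i) (v i) with hq₁
  set q₂ := ∑ i, ∫ x, (f₂ i x - a₂ i) ^ 2 ∂gaussianReal (μ i) (v i) with hq₂
  have hq₁0 : 0 ≤ q₁ := Finset.sum_nonneg fun i _ => integral_nonneg fun x => sq_nonneg _
  have hq₂0 : 0 ≤ q₂ := Finset.sum_nonneg fun i _ => integral_nonneg fun x => sq_nonneg _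
  set D := L₀ + ρ * v b with hD
  have hD0 : 0 < D := by positivity
  set c₁ := (ρ / (2 * L₀) + 1 / 2) / L₀ + ρ / (2 * L₀ ^ 2) with hc₁
  set c₂ := ρ / (2 * L₀ ^ 2) with hc₂
  set c₃ := μ b * ρ / D ^ 2 with hc₃
  have hc₁0 : 0 ≤ c₁ := by positivity
  have hc₂0 : 0 ≤ c₂ := by positivity
  have hc₃0 : 0 ≤ c₃ := by positivity
  set s₁ := ∑ j, |(fun i => -a₁ i) j| with hs₁
  set s₂ := ∑ j, |a₂ j| with hs₂
  set s₃ := ∑ j, |(fun i => a₁ i ^ 2) j| with hs₃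
  set s₄ := ∑ j, |(fun i => a₂ i ^ 2) j| with hs₄
  have hs₁0 : 0 ≤ s₁ := Finset.sum_nonneg fun j _ => abs_nonneg _
  have hs₂0 : 0 ≤ s₂ := Finset.sum_nonneg fun j _ => abs_nonneg _
  have hs₃0 : 0 ≤ s₃ := Finset.sum_nonneg fun j _ => abs_nonneg _
  have hs₄0 : 0 ≤ s₄ := Finset.sum_nonneg fun j _ => abs_nonneg _
  refine ⟨s₁ / D + c₃ * s₂ + c₁ * (2 * q₁ + 2 * s₃) + c₂ * (2 * q₂ + 2 * s₄), by positivity, ?_⟩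
  intro Ω _ P _ X τ θ A h n hn
  have hn0 : (0 : ℝ) < n := by exact_mod_cast hn
  set S := ∑ i ∈ Finset.univ.erase b, expectedPulls P A i n with hS
  have hp := fun i => expectedPulls_nonneg P A i n
  have hS0 : 0 ≤ S := Finset.sum_nonneg fun i _ => hp i
  have main := h.expectedRegret_le_second_order hL₀ hρ hb (n := n) (show 0 < n by omega) rfl rfl
  rw [h.integral_sum_observed m₁ (fun i => (l₁ i).integrable one_le_two),
    h.integral_sum_observed m₂ (fun i => (l₂ i).integrable one_le_two)] at main
  have t₁ : -((∑ i, expectedPulls P A i n * a₁ i) / D) ≤ s₁ / D * S := by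
    have := sum_mul_le_of_eq_zero (b := b) (g := fun i => -a₁ i) hp (by simp [hz₁])
    simp only [mul_neg, Finset.sum_neg_distrib] at this
    rw [← neg_div, div_mul_eq_mul_div]
    exact div_le_div_of_nonneg_right this hD0.le
  have t₂ : c₃ * ∑ i, expectedPulls P A i n * a₂ i ≤ c₃ * s₂ * S := by
    rw [mul_assoc]
    exact mul_le_mul_of_nonneg_left (sum_mul_le_of_eq_zero hp hz₂) hc₃0
  have t₃ : c₁ * ((∫ ω, (∑ t ∈ Finset.range n, observed X A f₁ t ω) ^ 2 ∂P) / n) ≤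
      c₁ * (2 * q₁ + 2 * (s₃ * S)) := by
    refine mul_le_mul_of_nonneg_left ?_ hc₁0
    rw [div_le_iff₀' hn0]
    refine (h.integral_sum_observed_sq_le m₁ l₁ n).trans ?_
    have := sum_mul_le_of_eq_zero (b := b) (g := fun i => a₁ i ^ 2) hp (by simp [hz₁])
    gcongr
  have t₄ : c₂ * ((∫ ω, (∑ t ∈ Finset.range n, observed X A f₂ t ω) ^ 2 ∂P) / n) ≤
      c₂ * (2 * q₂ + 2 * (s₄ * S)) := by
    refine mul_le_mul_of_nonneg_left ?_ hc₂0
    rw [div_le_iff₀' hn0]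
    refine (h.integral_sum_observed_sq_le m₂ l₂ n).trans ?_
    have := sum_mul_le_of_eq_zero (b := b) (g := fun i => a₂ i ^ 2) hp (by simp [hz₂])
    gcongr
  refine main.trans ((add_le_add (add_le_add (add_le_add t₁ t₂) t₃) t₄).trans ?_)
  have e : (s₁ / D + c₃ * s₂ + c₁ * (2 * q₁ + 2 * s₃) + c₂ * (2 * q₂ + 2 * s₄)) * (1 + S) =
      s₁ / D * S + c₃ * s₂ * S + c₁ * (2 * q₁ + 2 * (s₃ * S)) + c₂ * (2 * q₂ + 2 * (s₄ * S)) +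
      (s₁ / D + c₃ * s₂ + c₁ * (2 * s₃ + 2 * q₁ * S) + c₂ * (2 * s₄ + 2 * q₂ * S)) := by ring
  rw [e]
  exact le_add_of_nonneg_right (by positivity)

/-! ### The regret bound -/

/-- The regret is logarithmic. -/
theorem exists_expectedRegret_le_log {K : ℕ} (μ : Fin K → ℝ) (v : Fin K → ℝ≥0)
    (hv : ∀ i, 0 < v i) (L₀ ρ : ℝ) (hL₀ : 0 < L₀) (hρ : 0 ≤ ρ) (b : Fin K)
    (hb : ∀ i, i ≠ b → sharpe L₀ ρ (μ i) (v i) < sharpe L₀ ρ (μ b) (v b))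
    (hξ : 0 < sharpe L₀ ρ (μ b) (v b)) (hvb : v b ≤ 1) :
    ∃ C : ℝ, 0 ≤ C ∧ ∀ (Ω : Type w) [MeasurableSpace Ω] (P : Measure Ω) [IsProbabilityMeasure P]
      (X τ θ : Fin K → ℕ → Ω → ℝ) (A : ℕ → Ω → Fin K), IsSRTS P μ v L₀ ρ X τ θ A →
      ∀ n : ℕ, 2 ≤ n →
        expectedRegret P L₀ ρ (sharpe L₀ ρ (μ b) (v b)) X A n ≤ C * log n := by
  have hμb : 0 < μ b := by
    have hD : 0 < L₀ + ρ * v b := by positivity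
    simpa [sharpe, hD] using (div_pos_iff_of_pos_right hD).1 hξ
  have H : ∀ i, ∃ C : ℝ, 0 ≤ C ∧ (i ≠ b → ∀ (Ω : Type w) [MeasurableSpace Ω] (P : Measure Ω)
      [IsProbabilityMeasure P] (X τ θ : Fin K → ℕ → Ω → ℝ) (A : ℕ → Ω → Fin K),
      IsSRTS P μ v L₀ ρ X τ θ A → ∀ n : ℕ, 2 ≤ n → expectedPulls P A i n ≤ C * log n) := by
    intro i
    by_cases hi : i = b
    · exact ⟨0, le_rfl, fun h => absurd hi h⟩
    · obtain ⟨C, hC, h⟩ := exists_sum_prob_arm_le_log.{w} μ v hv L₀ ρ hL₀ hρ b i (hb i hi) hξ hvb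
      refine ⟨C, hC, fun _ Ω _ P _ X τ θ A hA n hn => ?_⟩
      exact expectedPulls_le (mul_nonneg hC (log_natCast_nonneg n)) (h Ω P X τ θ A hA n hn)
  choose c hc hpulls using H
  obtain ⟨C, hC, hreg⟩ := exists_expectedRegret_le.{w} μ v L₀ ρ hL₀ hρ b hμb.le
  obtain ⟨a, ha, hlog⟩ := exists_one_le_mul_log 1
  refine ⟨C * (a + ∑ i ∈ Finset.univ.erase b, c i),
    mul_nonneg hC (add_nonneg ha (Finset.sum_nonneg fun i _ => hc i)), ?_⟩
  intro Ω _ P _ X τ θ A hA n hn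
  refine (hreg Ω P X τ θ A hA n (by omega)).trans ?_
  rw [mul_assoc, add_mul, Finset.sum_mul]
  refine mul_le_mul_of_nonneg_left (add_le_add (hlog n hn) ?_) hC
  exact Finset.sum_le_sum fun i hi => hpulls i (Finset.ne_of_mem_erase hi) Ω P X τ θ A hA n hn

/-! ### Signs of the weights and size of the leading term -/

section Weight

variable {K : ℕ} {μ : Fin K → ℝ} {v : Fin K → ℝ≥0} {L₀ ρ : ℝ} {b : Fin K}

/-- The weight is `ξ_b - (1 - r) ξ_i` with `r ∈ [0, 1]`. Nonnegativity holds even when `ξ_i < 0`,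
where it uses `ξ_b > 0`. -/
theorem pullWeight_nonneg (hL₀ : 0 < L₀) (hρ : 0 ≤ ρ)
    (hb : ∀ i, i ≠ b → sharpe L₀ ρ (μ i) (v i) < sharpe L₀ ρ (μ b) (v b))
    (hξ : 0 < sharpe L₀ ρ (μ b) (v b)) (i : Fin K) : 0 ≤ pullWeight μ v L₀ ρ b i := by
  have hle : sharpe L₀ ρ (μ i) (v i) ≤ sharpe L₀ ρ (μ b) (v b) := by
    by_cases hi : i = b
    · rw [hi]
    · exact (hb i hi).le
  have hvi : (v i : ℝ) ≤ ∑ j, (v j : ℝ) :=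
    Finset.single_le_sum (fun j _ => (v j).coe_nonneg) (Finset.mem_univ i)
  have hvi0 := (v i).coe_nonneg
  unfold pullWeight
  set x := sharpe L₀ ρ (μ i) (v i)
  set V := ∑ j, (v j : ℝ)
  have hV : 0 ≤ V := hvi0.trans hvi
  have hD : 0 < L₀ + ρ / 2 * maxMeanGap μ ^ 2 + ρ * V := by positivity
  have hN : 0 ≤ maxMeanGap μ ^ 2 / 2 + V - v i := by
    have := sq_nonneg (maxMeanGap μ)
    linarith
  have hr0 : 0 ≤ ρ * (maxMeanGap μ ^ 2 / 2 + V - v i) / (L₀ + ρ / 2 * maxMeanGap μ ^ 2 + ρ * V) := by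
    positivity
  have hr1 : ρ * (maxMeanGap μ ^ 2 / 2 + V - v i) / (L₀ + ρ / 2 * maxMeanGap μ ^ 2 + ρ * V) ≤ 1 := by
    rw [div_le_one hD]
    nlinarith [mul_nonneg hρ hvi0]
  rw [mul_assoc, mul_div_assoc]
  set r := ρ * (maxMeanGap μ ^ 2 / 2 + V - v i) / (L₀ + ρ / 2 * maxMeanGap μ ^ 2 + ρ * V)
  rcases le_total 0 x with h | h
  · have := mul_nonneg h hr0
    linarith
  · nlinarith

/-- A second arm contributes positive variance to the numerator, which is what makes the bound
generous when `ρ > 0`. -/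
theorem pullWeight_pos (hK : 2 ≤ K) (hv : ∀ i, 0 < v i) (hL₀ : 0 < L₀) (hρ : 0 < ρ)
    (hξ : 0 < sharpe L₀ ρ (μ b) (v b)) : 0 < pullWeight μ v L₀ ρ b b := by
  have : Nontrivial (Fin K) := Fin.nontrivial_iff_two_le.2 hK
  obtain ⟨j, hj⟩ := exists_ne b
  have hvb : (v b : ℝ) < ∑ j, (v j : ℝ) :=
    Finset.single_lt_sum hj (Finset.mem_univ b) (Finset.mem_univ j) (by exact_mod_cast hv j)
      fun k _ _ => (v k).coe_nonneg
  have hV : 0 ≤ ∑ j, (v j : ℝ) := (v b).coe_nonneg.trans hvb.le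
  have hN : 0 < maxMeanGap μ ^ 2 / 2 + ∑ j, (v j : ℝ) - v b := by
    have := sq_nonneg (maxMeanGap μ)
    linarith
  unfold pullWeight
  rw [sub_self, zero_add]
  positivity

theorem le_leadingPulls (i : Fin K) (εμ εσ : ℝ) (n : ℕ) :
    2 * log (2 * n) / ((μ b - μ i) - εμ * L₀) ^ 2 ≤ leadingPulls μ v L₀ ρ b i εμ εσ n :=
  le_max_left _ _

theorem log_two_mul_natCast_nonneg (n : ℕ) : 0 ≤ log (2 * n : ℝ) := by
  exact_mod_cast log_natCast_nonneg (2 * n)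

theorem log_le_log_two_mul {n : ℕ} (hn : 1 ≤ n) : log n ≤ log (2 * n : ℝ) := by
  have : (1 : ℝ) ≤ n := by exact_mod_cast hn
  exact log_le_log (by linarith) (by linarith)

theorem leadingPulls_nonneg (i : Fin K) (εμ εσ : ℝ) (n : ℕ) :
    0 ≤ leadingPulls μ v L₀ ρ b i εμ εσ n :=
  (div_nonneg (mul_nonneg zero_le_two (log_two_mul_natCast_nonneg n)) (sq_nonneg _)).trans
    (le_leadingPulls i εμ εσ n)

/-- For the best arm the leading term is of order `(log n) ^ (3 / 2)`. -/
theorem le_leadingPulls_self (hL₀ : 0 < L₀) {c : ℝ} (hc : 0 < c) (εσ : ℝ) {n : ℕ} (hn : 2 ≤ n) :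
    2 / (c * L₀) ^ 2 * (log n * √(log n)) ≤
      leadingPulls μ v L₀ ρ b b (c * log n ^ (-(1 / 4) : ℝ)) εσ n := by
  have hl : 0 < log (n : ℝ) := log_pos (by exact_mod_cast hn)
  refine le_trans ?_ (le_leadingPulls b _ εσ n)
  have e : (μ b - μ b - c * log n ^ (-(1 / 4) : ℝ) * L₀) ^ 2 = (c * L₀) ^ 2 / √(log n) := by
    have : (log (n : ℝ) ^ (-(1 / 4) : ℝ)) ^ 2 = (√(log n))⁻¹ := by
      rw [← rpow_natCast, ← rpow_mul hl.le, sqrt_eq_rpow, ← rpow_neg hl.le]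
      norm_num
    rw [sub_self, zero_sub, neg_sq, mul_pow, mul_pow, this, mul_pow]
    ring
  rw [e, div_div_eq_mul_div, div_mul_eq_mul_div, ← mul_assoc]
  have := log_le_log_two_mul (n := n) (by omega)
  gcongr

end Weight

theorem mul_le_mul_mul_sqrt_add {C κ : ℝ} (hκ : 0 < κ) {x : ℝ} (hx : 0 ≤ x) (hC : 0 ≤ C) :
    C * x ≤ κ * (x * √x) + C * (C / κ) ^ 2 := by
  have hs : √x * √x = x := mul_self_sqrt hx
  by_cases h : C / κ ≤ √x
  · rw [div_le_iff₀ hκ] at h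
    have := mul_le_mul_of_nonneg_right h hx
    have : 0 ≤ C * (C / κ) ^ 2 := by positivity
    nlinarith
  · have h1 : x ≤ (C / κ) ^ 2 := by
      rw [← hs, ← sq]
      exact pow_le_pow_left₀ (sqrt_nonneg x) (not_le.1 h).le 2
    have := mul_le_mul_of_nonneg_left h1 hC
    have : 0 ≤ κ * (x * √x) := by positivity
    linarith

/-- Replacing `g - 2 ε` by `g` costs a term of order `l ε`, and `l ε⁴ = 1` makes it equal to the
other error order `1 / ε³`. The term with `g` is in turn at most the one with `g - s`, since `0 < g
- s ≤ g`. -/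
theorem expectedPulls_bound_le {g ε s C l l2 : ℝ} (hg : 0 < g) (hε0 : 0 < ε) (hε : 4 * ε ≤ g)
    (hs0 : 0 ≤ s) (hs : s < g) (hl2 : l ≤ l2) (hl : l * ε ^ 4 = 1) :
    2 * l / (g - 2 * ε) ^ 2 + C / ε ^ 3 ≤
      2 * l2 / (g - s) ^ 2 + (32 / g ^ 3 + C) * (1 / ε ^ 3) := by
  have hl0 : 0 < l := pos_of_mul_pos_left (by rw [hl]; norm_num) (by positivity)
  have h1 : 2 * l / g ^ 2 ≤ 2 * l2 / (g - s) ^ 2 := by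
    have : 0 < g - s := by linarith
    gcongr
    all_goals linarith
  have h2 : 2 * l / (g - 2 * ε) ^ 2 ≤ 2 * l / g ^ 2 + 32 * l * ε / g ^ 3 := by
    have h3 : 0 < g - 2 * ε := by linarith
    have e : 2 * l / g ^ 2 + 32 * l * ε / g ^ 3 = 2 * l * (g + 16 * ε) / g ^ 3 := by
      field_simp
      ring
    rw [e, div_le_div_iff₀ (by positivity) (by positivity)]
    have : g ^ 3 ≤ (g + 16 * ε) * (g - 2 * ε) ^ 2 := by
      nlinarith [mul_nonneg hε0.le (sub_nonneg.2 hε), mul_nonneg (mul_nonneg hε0.le hg.le) (sub_nonneg.2 hε),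
        mul_pos (mul_pos hε0 hg) hg, mul_pos (mul_pos hε0 hε0) hg, pow_pos hε0 3]
    nlinarith
  have h4 : l * ε = 1 / ε ^ 3 := by
    rw [eq_div_iff (by positivity)]
    linarith
  have h5 : 32 * l * ε / g ^ 3 = 32 / g ^ 3 * (1 / ε ^ 3) := by
    rw [← h4]
    ring
  have h6 : C / ε ^ 3 = C * (1 / ε ^ 3) := by ring
  rw [h6]
  linarith

/-- A refined bound on the pulls of a suboptimal arm in the absence of risk aversion. -/
theorem exists_expectedPulls_le_leadingPulls {K : ℕ} (μ : Fin K → ℝ) (v : Fin K → ℝ≥0)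
    (hv : ∀ i, 0 < v i) (L₀ : ℝ) (hL₀ : 0 < L₀) (b i : Fin K) (hi : μ i < μ b) (hvb : v b ≤ 1)
    {c : ℝ} (hc : 0 < c) :
    ∃ C : ℝ, 0 ≤ C ∧ ∃ N : ℕ, ∀ (Ω : Type w) [MeasurableSpace Ω] (P : Measure Ω)
      [IsProbabilityMeasure P] (X τ θ : Fin K → ℕ → Ω → ℝ) (A : ℕ → Ω → Fin K),
      IsSRTS P μ v L₀ 0 X τ θ A → ∀ n : ℕ, N ≤ n → 2 ≤ n → ∀ εσ : ℝ,
        expectedPulls P A i n ≤ leadingPulls μ v L₀ 0 b i (c * log n ^ (-(1 / 4) : ℝ)) εσ n +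
          C * log n ^ (3 / 4 : ℝ) := by
  obtain ⟨C, hC, hsum⟩ := exists_sum_prob_arm_le_of_eps.{w} μ v hv L₀ hL₀ b i hvb
  have hg : 0 < μ b - μ i := sub_pos.2 hi
  have lim : Filter.Tendsto (fun n : ℕ => log n ^ (-(1 / 4) : ℝ)) Filter.atTop (nhds 0) :=
    (tendsto_rpow_neg_atTop (by norm_num)).comp (tendsto_log_atTop.comp tendsto_natCast_atTop_atTop)
  -- The three bounds on `ε` ensure, for large `n`, that the pull bound applies, that `4 ε ≤ Γ`, and
  -- that the denominator `Γ - c ε L₀` of the leading term is positive.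
  have hη : 0 < min 1 (min ((μ b - μ i) / 4) ((μ b - μ i) / (c * L₀))) := by positivity
  obtain ⟨N, hN⟩ := Filter.eventually_atTop.1 (lim.eventually_lt_const hη)
  refine ⟨32 / (μ b - μ i) ^ 3 + C, by positivity, N, ?_⟩
  intro Ω _ P _ X τ θ A hA n hn hn2 εσ
  have hl : 0 < log (n : ℝ) := log_pos (by exact_mod_cast hn2)
  have hε := hN n hn
  have hε0 : 0 < log (n : ℝ) ^ (-(1 / 4) : ℝ) := rpow_pos_of_pos hl _
  have e3 : log (n : ℝ) ^ (3 / 4 : ℝ) = 1 / (log n ^ (-(1 / 4) : ℝ)) ^ 3 := by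
    rw [← rpow_natCast, ← rpow_mul hl.le, one_div, ← rpow_neg hl.le]
    norm_num
  have e4 : log (n : ℝ) * (log n ^ (-(1 / 4) : ℝ)) ^ 4 = 1 := by
    rw [← rpow_natCast, ← rpow_mul hl.le]
    norm_num [rpow_neg hl.le, hl.ne']
  rw [e3]
  set ε := log (n : ℝ) ^ (-(1 / 4) : ℝ)
  simp only [lt_min_iff] at hε
  obtain ⟨hε1, hε2, hε3⟩ := hε
  rw [lt_div_iff₀ (by positivity)] at hε3
  have hb : 0 ≤ 2 * log n / (μ b - μ i - 2 * ε) ^ 2 + C / ε ^ 3 := by positivity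
  refine (expectedPulls_le hb
    (hsum Ω P X τ θ A hA n (by omega) ε hε0 hε1.le (by linarith))).trans ?_
  refine (expectedPulls_bound_le hg hε0 (by linarith) (s := c * ε * L₀) (by positivity)
    (by linarith) (log_le_log_two_mul (by omega)) e4).trans ?_
  exact add_le_add_left (le_leadingPulls i _ εσ n) _

/-- The summand of the best arm alone is at least `κ (log n)^(3/2)` with `κ > 0`, and all other
summands are nonnegative. -/
theorem exists_expectedRegret_le_of_rho_pos {K : ℕ} (hK : 2 ≤ K) (μ : Fin K → ℝ) (v : Fin K → ℝ≥0)
    (hv : ∀ i, 0 < v i) (L₀ ρ : ℝ) (hL₀ : 0 < L₀) (hρ : 0 < ρ) (b : Fin K)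
    (hb : ∀ i, i ≠ b → sharpe L₀ ρ (μ i) (v i) < sharpe L₀ ρ (μ b) (v b))
    (hξ : 0 < sharpe L₀ ρ (μ b) (v b)) (hvb : v b ≤ 1) (cμ cσ : Fin K → ℝ) (hcμ : ∀ i, 0 < cμ i) :
    ∃ B : ℝ, ∀ (Ω : Type w) [MeasurableSpace Ω] (P : Measure Ω) [IsProbabilityMeasure P]
      (X τ θ : Fin K → ℕ → Ω → ℝ) (A : ℕ → Ω → Fin K), IsSRTS P μ v L₀ ρ X τ θ A →
      ∀ n : ℕ, 2 ≤ n → expectedRegret P L₀ ρ (sharpe L₀ ρ (μ b) (v b)) X A n ≤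
        (∑ i, leadingPulls μ v L₀ ρ b i (cμ i * log n ^ (-(1 / 4) : ℝ))
          (cσ i * log n ^ (-(1 / 4) : ℝ)) n * pullWeight μ v L₀ ρ b i) + B := by
  obtain ⟨C, hC, hreg⟩ := exists_expectedRegret_le_log.{w} μ v hv L₀ ρ hL₀ hρ.le b hb hξ hvb
  have hw := pullWeight_pos hK hv hL₀ hρ hξ
  have hc := hcμ b
  set κ := 2 / (cμ b * L₀) ^ 2 * pullWeight μ v L₀ ρ b b with hκ
  have hκ0 : 0 < κ := by positivity
  refine ⟨C * (C / κ) ^ 2, fun Ω _ P _ X τ θ A hA n hn => ?_⟩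
  refine (hreg Ω P X τ θ A hA n hn).trans
    ((mul_le_mul_mul_sqrt_add hκ0 (log_natCast_nonneg n) hC).trans (add_le_add_left ?_ _))
  refine le_trans ?_ (Finset.single_le_sum (fun i _ => mul_nonneg (leadingPulls_nonneg i _ _ n)
    (pullWeight_nonneg hL₀ hρ.le hb hξ i)) (Finset.mem_univ b))
  rw [hκ, mul_right_comm]
  exact mul_le_mul_of_nonneg_right (le_leadingPulls_self hL₀ hc _ hn) hw.le

theorem exists_expectedRegret_le_of_rho_eq_zero {K : ℕ} (μ : Fin K → ℝ) (v : Fin K → ℝ≥0)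
    (hv : ∀ i, 0 < v i) (L₀ : ℝ) (hL₀ : 0 < L₀) (b : Fin K)
    (hb : ∀ i, i ≠ b → sharpe L₀ 0 (μ i) (v i) < sharpe L₀ 0 (μ b) (v b))
    (hξ : 0 < sharpe L₀ 0 (μ b) (v b)) (hvb : v b ≤ 1) (cμ cσ : Fin K → ℝ) (hcμ : ∀ i, 0 < cμ i) :
    ∃ B D : ℝ, 0 ≤ D ∧ ∀ (Ω : Type w) [MeasurableSpace Ω] (P : Measure Ω) [IsProbabilityMeasure P]
      (X τ θ : Fin K → ℕ → Ω → ℝ) (A : ℕ → Ω → Fin K), IsSRTS P μ v L₀ 0 X τ θ A →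
      ∀ n : ℕ, 2 ≤ n → expectedRegret P L₀ 0 (sharpe L₀ 0 (μ b) (v b)) X A n ≤
        (∑ i, (leadingPulls μ v L₀ 0 b i (cμ i * log n ^ (-(1 / 4) : ℝ))
          (cσ i * log n ^ (-(1 / 4) : ℝ)) n + D * log n ^ (3 / 4 : ℝ)) *
            pullWeight μ v L₀ 0 b i) + B := by
  obtain ⟨C, hC, hreg⟩ := exists_expectedRegret_le_log.{w} μ v hv L₀ 0 hL₀ le_rfl b hb hξ hvb
  have H : ∀ i, ∃ D : ℝ, 0 ≤ D ∧ ∃ N : ℕ, i ≠ b → ∀ (Ω : Type w) [MeasurableSpace Ω]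
      (P : Measure Ω) [IsProbabilityMeasure P] (X τ θ : Fin K → ℕ → Ω → ℝ) (A : ℕ → Ω → Fin K),
      IsSRTS P μ v L₀ 0 X τ θ A → ∀ n : ℕ, N ≤ n → 2 ≤ n → ∀ εσ : ℝ,
        expectedPulls P A i n ≤ leadingPulls μ v L₀ 0 b i (cμ i * log n ^ (-(1 / 4) : ℝ)) εσ n +
          D * log n ^ (3 / 4 : ℝ) := by
    intro i
    by_cases hi : i = b
    · exact ⟨0, le_rfl, 0, fun h => absurd hi h⟩
    · have hμ : μ i < μ b := by
        have := hb i hi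
        simpa [sharpe, div_lt_div_iff_of_pos_right hL₀] using this
      obtain ⟨D, hD, N, h⟩ :=
        exists_expectedPulls_le_leadingPulls.{w} μ v hv L₀ hL₀ b i hμ hvb (hcμ i)
      exact ⟨D, hD, N, fun _ => h⟩
  choose D hD N hpulls using H
  have hD0 : 0 ≤ ∑ i, D i := Finset.sum_nonneg fun i _ => hD i
  have hw := pullWeight_nonneg hL₀ le_rfl hb hξ
  -- The sum of the `N i` dominates every individual threshold. Below it the refined pull bounds may
  -- fail, and the logarithmic regret bound at this fixed size serves as the additive constant.
  refine ⟨C * log (∑ i, N i : ℕ), ∑ i, D i, hD0, fun Ω _ P _ X τ θ A hA n hn => ?_⟩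
  have hB : 0 ≤ C * log (∑ i, N i : ℕ) := mul_nonneg hC (log_natCast_nonneg _)
  have hl : 0 ≤ log (n : ℝ) ^ (3 / 4 : ℝ) := rpow_nonneg (log_natCast_nonneg n) _
  have hpos : ∀ i, 0 ≤ leadingPulls μ v L₀ 0 b i (cμ i * log n ^ (-(1 / 4) : ℝ))
      (cσ i * log n ^ (-(1 / 4) : ℝ)) n + (∑ i, D i) * log n ^ (3 / 4 : ℝ) := fun i =>
    add_nonneg (leadingPulls_nonneg i _ _ n) (mul_nonneg hD0 hl)
  by_cases hN : ∑ i, N i ≤ n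
  · refine le_trans ?_ (le_add_of_nonneg_right hB)
    rw [hA.expectedRegret_of_rho_eq_zero hL₀ b (by omega)]
    refine Finset.sum_le_sum fun i _ => ?_
    have e : pullWeight μ v L₀ 0 b i = sharpe L₀ 0 (μ b) (v b) - sharpe L₀ 0 (μ i) (v i) := by
      simp [pullWeight]
    rw [← e]
    by_cases hi : i = b
    · have : pullWeight μ v L₀ 0 b i = 0 := by rw [e, hi, sub_self]
      simp [this]
    · refine mul_le_mul_of_nonneg_right ?_ (hw i)
      have hNi : N i ≤ n := (Finset.single_le_sum (fun j _ => Nat.zero_le (N j))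
        (Finset.mem_univ i)).trans hN
      refine (hpulls i hi Ω P X τ θ A hA n hNi hn (cσ i * log n ^ (-(1 / 4) : ℝ))).trans ?_
      have := Finset.single_le_sum (fun j _ => hD j) (Finset.mem_univ i)
      gcongr
  · refine (hreg Ω P X τ θ A hA n hn).trans (le_add_of_nonneg_of_le
      (Finset.sum_nonneg fun i _ => mul_nonneg (hpos i) (hw i)) ?_)
    refine mul_le_mul_of_nonneg_left (log_le_log (by positivity) ?_) hC
    exact_mod_cast (not_le.1 hN).le

end

end SharpeBandit

/-! ### The regret theorem -/

theorem theorem2 {K : ℕ} (hK : 2 ≤ K) (μ : Fin K → ℝ) (v : Fin K → ℝ≥0) (hv : ∀ i, 0 < v i)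
    (L₀ ρ : ℝ) (hL₀ : 0 < L₀) (hρ : 0 ≤ ρ) (b : Fin K)
    (hb : ∀ i, i ≠ b →
      SharpeBandit.sharpe L₀ ρ (μ i) (v i) < SharpeBandit.sharpe L₀ ρ (μ b) (v b))
    (hξ : 0 < SharpeBandit.sharpe L₀ ρ (μ b) (v b)) (hvb : v b ≤ 1)
    (cμ cσ : Fin K → ℝ) (hcμ : ∀ i, 0 < cμ i) (hcσ : ∀ i, 0 < cσ i) :
    ∃ A₇ A₈ A₉ A₁₀ A₁₁ C : ℝ,
      ∀ (Ω : Type*) [MeasurableSpace Ω] (P : Measure Ω) [IsProbabilityMeasure P]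
        (X τ θ : Fin K → ℕ → Ω → ℝ) (A : ℕ → Ω → Fin K),
        SharpeBandit.IsSRTS P μ v L₀ ρ X τ θ A →
        ∀ n : ℕ, 2 ≤ n →
          Integrable (SharpeBandit.algSharpe L₀ ρ X A n) P ∧
          SharpeBandit.expectedRegret P L₀ ρ (SharpeBandit.sharpe L₀ ρ (μ b) (v b)) X A n ≤
            (∑ i, (1 +
                SharpeBandit.leadingPulls μ v L₀ ρ b i
                  (cμ i * Real.log n ^ (-(1 / 4) : ℝ)) (cσ i * Real.log n ^ (-(1 / 4) : ℝ)) n +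
                A₈ * Real.log n ^ (3 / 4 : ℝ) + A₉ * Real.log n ^ (1 / 2 : ℝ) +
                A₁₀ * Real.log n ^ (1 / 4 : ℝ) + A₁₁) *
              SharpeBandit.pullWeight μ v L₀ ρ b i) + A₇ ∧
          SharpeBandit.expectedRegret P L₀ ρ (SharpeBandit.sharpe L₀ ρ (μ b) (v b)) X A n ≤
            C * Real.log n := by
  have hw := SharpeBandit.pullWeight_nonneg hL₀ hρ hb hξ
  obtain ⟨C, -, hlog⟩ :=
    SharpeBandit.exists_expectedRegret_le_log μ v hv L₀ ρ hL₀ hρ b hb hξ hvb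
  obtain ⟨B, D, -, hlead⟩ : ∃ B D : ℝ, 0 ≤ D ∧ ∀ (Ω : Type _) [MeasurableSpace Ω] (P : Measure Ω)
      [IsProbabilityMeasure P] (X τ θ : Fin K → ℕ → Ω → ℝ) (A : ℕ → Ω → Fin K),
      SharpeBandit.IsSRTS P μ v L₀ ρ X τ θ A → ∀ n : ℕ, 2 ≤ n →
      SharpeBandit.expectedRegret P L₀ ρ (SharpeBandit.sharpe L₀ ρ (μ b) (v b)) X A n ≤
        (∑ i, (SharpeBandit.leadingPulls μ v L₀ ρ b i
            (cμ i * Real.log n ^ (-(1 / 4) : ℝ)) (cσ i * Real.log n ^ (-(1 / 4) : ℝ)) n +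
            D * Real.log n ^ (3 / 4 : ℝ)) * SharpeBandit.pullWeight μ v L₀ ρ b i) + B := by
    rcases hρ.eq_or_lt with rfl | hρ'
    · exact SharpeBandit.exists_expectedRegret_le_of_rho_eq_zero μ v hv L₀ hL₀ b hb hξ hvb cμ cσ hcμ
    · obtain ⟨B, h⟩ := SharpeBandit.exists_expectedRegret_le_of_rho_pos hK μ v hv L₀ ρ hL₀ hρ' b hb
        hξ hvb cμ cσ hcμ
      exact ⟨B, 0, le_rfl, by simpa only [zero_mul, add_zero] using h⟩
  -- A single error term of order `(log n)^(3/4)` suffices; the lower powers get coefficient `0`,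
  -- and the `1` in each bracket is slack because the weights are nonnegative.
  refine ⟨B, D, 0, 0, 0, C, fun Ω _ P _ X τ θ A h n hn =>
    ⟨h.integrable_algSharpe hL₀ hρ n, (hlead Ω P X τ θ A h n hn).trans ?_,
      hlog Ω P X τ θ A h n hn⟩⟩
  refine add_le_add_left (Finset.sum_le_sum fun i _ => mul_le_mul_of_nonneg_right ?_ (hw i)) _
  simp only [zero_mul, add_zero]
  linarith
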